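/- **Theorem 1 (Existence and uniqueness).** Let $d\in\mathbb N$, $a,b>0$, and let $\mathcal M^s(\mathbb R^d)$ be the space of finite signed Radon measures on $\mathbb R^d$. For $\mu\in\mathcal M^s(\mathbb R^d)$ with Jordan decomposition $\mu=\mu^+-\mu^-$, write $|\mu|=\mu^+(\mathbb R^d)+\mu^-(\mathbb R^d)$, $\operatorname{supp}\mu=\operatorname{supp}(\mu^++\mu^-)$, and $$\|\mu\|^{a,b}=W_1^{a,b}(\mu^+,\mu^-),\qquad W_1^{a,b}(\rho,\sigma)=\inf_{|\tilde\rho|=|\tilde\sigma|}\Big\{a\big(|\rho-\tilde\rho|+|\sigma-\tilde\sigma|\big)+b\,W_1(\tilde\rho,\tilde\sigma)\Big\},$$ where the infimum is over finite positive measures $\tilde\rho,\tilde\sigma$ of equal mass and $W_1(\tilde\rho,\tilde\sigma)=\inf_\pi\int|x-y|\,d\pi(x,y)$ over all measures $\pi$ on $\mathbb R^d\times\mathbb R^d$ with marginals $\tilde\rho,\tilde\sigma$. Let $B_0(r)$ be the closed ball of radius $r$ around $0$. Let $v$ assign to each $\mu\in\mathcal M^s(\mathbb R^d)$ a vector field $v[\mu]:\mathbb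 R^d\to\mathbb R^d$, let $h:\mathcal M^s(\mathbb R^d)\to\mathcal M^s(\mathbb R^d)$, and let $K,L,M,Q,P,R$ be real constants, $L\ge 0$, such that for all $\mu,\nu\in\mathcal M^s(\mathbb R^d)$ and $x,y\in\mathbb R^d$: * (H-1) $\|v[\mu]-v[\nu]\|_{\mathcal C^0(\mathbb R^d)}\le K\|\mu-\nu\|^{a,b}$; * (H-2) $|v[\mu](x)-v[\mu](y)|\le L|x-y|$ and $|v[\mu](x)|\le M$; * (H-3) $\|h[\mu]-h[\nu]\|^{a,b}\le Q\|\mu-\nu\|^{a,b}$, $|h[\mu]|\le P$, $\operatorname{supp}h[\mu]\subset B_0(R)$. A solution with initial datum $\mu_0\in\mathcal M^s(\mathbb R^d)$ of $$\partial_t\mu_t+\operatorname{div}(v[\mu_t]\mu_t)=h[\mu_t],\qquad \mu_{|t=0}=\mu_0,$$ is a map $t\mapsto\mu_t$ from $[0,1]$ to $\mathcal M^s(\mathbb R^d)$, continuous for $\|\cdot\|^{a,b}$ (i.e. an element of $\mathcal C^0([0,1],\mathcal M^s(\mathbb R^d))$ with the norm $\sup_{t\in[0,1]}\|\mu_t\|^{a,b}$),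 equal to $\mu_0$ at $t=0$ and such that for every $\Phi\in\mathcal C_c^\infty(\mathbb R^d)$ and $t\in[0,1]$ (one-sided derivatives at the endpoints) $$\frac{d}{dt}\int\Phi\,d\mu_t=\int v[\mu_t]\cdot\nabla\Phi\,d\mu_t+\int\Phi\,dh[\mu_t].$$ Then: 1. For every compactly supported $\mu_0\in\mathcal M^s(\mathbb R^d)$ there is exactly one solution with initial datum $\mu_0$. 2. If $\mu_t,\nu_t$ are solutions with initial data $\mu_0,\nu_0\in\mathcal M^s(\mathbb R^d)$, then for $t\in[0,1]$ $$\|\mu_t-\nu_t\|^{a,b}\le\|\mu_0-\nu_0\|^{a,b}\,e^{C_1t},\qquad C_1=2L+2bK\big(P+\min\{|\mu_0|,|\nu_0|\}\big)+Q.$$ 3. If $\mu_0$ is compactly supported and $\mu_t$ is the solution with initial datum $\mu_0$, then for $t\in[0,1]$ $$|\mu_t|\le|\mu_0|+Pt,\qquad \operatorname{supp}\mu_t\subset B_0(R'+tM)\ \text{ whenever }\ \operatorname{supp}\mu_0\cup B_0(R)\subset B_0(R'),$$ and for $t,\tau\ge0$ with $t+\tau\le1$ $$\|\mu_{t+\tau}-\mu_t\|^{a,b}\le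 C_2\,\tau,\qquad C_2=aP+bM\big(P(t+\tau)+|\mu_0|\big).$$ -/

import Mathlib

open MeasureTheory Set Filter Topology
open scoped ENNReal ContDiff

noncomputable section

namespace SignedTransport

section Measures

variable {E : Type*} [NormedAddCommGroup E] [MeasurableSpace E] [BorelSpace E]

/-- The total mass `|μ| = μ⁺(E) + μ⁻(E)` of a finite signed measure (Jordan decomposition). -/
def mass (μ : SignedMeasure E) : ℝ := (μ.totalVariation univ).toReal

/-- The support of a signed measure: the support of `μ⁺ + μ⁻`. -/
def supp (μ : SignedMeasure E) : Set E := μ.totalVariation.support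

/-- `π` is a transference plan between `μ` and `ν`: its marginals are `μ` and `ν`. -/
def IsPlan (μ ν : FiniteMeasure E) (π : Measure (E × E)) : Prop :=
  π.fst = (μ : Measure E) ∧ π.snd = (ν : Measure E)

/-- The Wasserstein distance `W₁` between two positive measures of the same mass, with values in
`[0, ∞]` (it is infinite if every plan has infinite cost). -/
def wasserstein (μ ν : FiniteMeasure E) : ℝ≥0∞ :=
  ⨅ (π : Measure (E × E)) (_ : IsPlan μ ν π), ∫⁻ p, edist p.1 p.2 ∂π

/-- The cost `a (|μ - μ'| + |ν - ν'|) + b W₁(μ', ν')`. -/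
def removalTransportCost (a b : ℝ) (μ ν μ' ν' : FiniteMeasure E) : ℝ≥0∞ :=
  ENNReal.ofReal a *
      (((μ : Measure E).toSignedMeasure - (μ' : Measure E).toSignedMeasure).totalVariation univ +
        ((ν : Measure E).toSignedMeasure - (ν' : Measure E).toSignedMeasure).totalVariation univ) +
    ENNReal.ofReal b * wasserstein μ' ν'

/-- The generalized Wasserstein distance `W₁^{a,b}` between two finite positive measures.
The infimum is finite: `μ' = ν' = 0` has cost `a (|μ| + |ν|)`. -/
def genWasserstein (a b : ℝ) (μ ν : FiniteMeasure E) : ℝ :=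
  (⨅ (μ' : FiniteMeasure E) (ν' : FiniteMeasure E) (_ : μ'.mass = ν'.mass),
    removalTransportCost a b μ ν μ' ν').toReal

/-- The positive part of the Jordan decomposition. -/
def jordanPos (μ : SignedMeasure E) : FiniteMeasure E :=
  ⟨μ.toJordanDecomposition.posPart, inferInstance⟩

/-- The negative part of the Jordan decomposition. -/
def jordanNeg (μ : SignedMeasure E) : FiniteMeasure E :=
  ⟨μ.toJordanDecomposition.negPart, inferInstance⟩

/-- The norm `‖μ‖^{a,b} = W₁^{a,b}(μ⁺, μ⁻)` on finite signed measures. -/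
def gwNorm (a b : ℝ) (μ : SignedMeasure E) : ℝ :=
  genWasserstein a b (jordanPos μ) (jordanNeg μ)

end Measures

section Equation

variable {d : ℕ}

/-- Finite signed Borel (equivalently, Radon) measures on `ℝ^d`. -/
abbrev Ms (d : ℕ) : Type := SignedMeasure (EuclideanSpace ℝ (Fin d))

/-- (H-1): `‖v[μ] - v[ν]‖_{C⁰} ≤ K ‖μ - ν‖^{a,b}`. -/
def H1 (a b : ℝ) (v : Ms d → EuclideanSpace ℝ (Fin d) → EuclideanSpace ℝ (Fin d)) (K : ℝ) :
    Prop :=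
  ∀ μ ν : Ms d, ∀ x, ‖v μ x - v ν x‖ ≤ K * gwNorm a b (μ - ν)

/-- (H-2): every `v[μ]` is `L`-Lipschitz and bounded by `M`. (`0 ≤ L` is automatic for `1 ≤ d`.) -/
def H2 (v : Ms d → EuclideanSpace ℝ (Fin d) → EuclideanSpace ℝ (Fin d)) (L M : ℝ) : Prop :=
  0 ≤ L ∧ ∀ μ : Ms d, (∀ x y, ‖v μ x - v μ y‖ ≤ L * ‖x - y‖) ∧ ∀ x, ‖v μ x‖ ≤ M

/-- (H-3): `h` is `Q`-Lipschitz for `‖·‖^{a,b}`, with mass at most `P` and support in the closed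
ball of radius `R` around the origin. -/
def H3 (a b : ℝ) (h : Ms d → Ms d) (Q P R : ℝ) : Prop :=
  (∀ μ ν : Ms d, gwNorm a b (h μ - h ν) ≤ Q * gwNorm a b (μ - ν)) ∧
    ∀ μ : Ms d, mass (h μ) ≤ P ∧ supp (h μ) ⊆ Metric.closedBall 0 R

/-- `μ` (only its values on `[0,1]` matter) is a measure-valued weak solution on `[0,1]` of
`∂ₜ μₜ + div (v[μₜ] μₜ) = h[μₜ]` with initial datum `μ₀`. -/
structure IsWeakSolution (a b : ℝ)
    (v : Ms d → EuclideanSpace ℝ (Fin d) → EuclideanSpace ℝ (Fin d)) (h : Ms d → Ms d)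
    (μ₀ : Ms d) (μ : ℝ → Ms d) : Prop where
  /-- `μ ∈ C⁰([0,1], (M^s, ‖·‖^{a,b}))` -/
  continuous : ∀ s ∈ Icc (0 : ℝ) 1,
    Tendsto (fun t => gwNorm a b (μ t - μ s)) (𝓝[Icc 0 1] s) (𝓝 0)
  initial : μ 0 = μ₀
  /-- `d/dt ⟨Φ, μₜ⟩ = ⟨v[μₜ] · ∇Φ, μₜ⟩ + ⟨Φ, h[μₜ]⟩` for every test function `Φ`; here
  `fderiv ℝ Φ x w = w · ∇Φ(x)`, and the derivative is one-sided at `t = 0` and `t = 1`. -/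
  weak : ∀ Φ : EuclideanSpace ℝ (Fin d) → ℝ, ContDiff ℝ ∞ Φ → HasCompactSupport Φ →
    ∀ t ∈ Icc (0 : ℝ) 1,
      HasDerivWithinAt (fun s => ∫ᵛ x, Φ x ∂<•(μ s))
        ((∫ᵛ x, fderiv ℝ Φ x (v (μ t) x) ∂<•(μ t)) + ∫ᵛ x, Φ x ∂<•(h (μ t)))
        (Icc 0 1) t

end Equation

end SignedTransport

end

open MeasureTheory Set Filter Topology
open scoped ENNReal ContDiff

noncomputable section

set_option linter.unusedSectionVars false

/-! The norm is a dual norm. By a Kantorovich-type duality, `gwNorm a b μ` is the supremum of `∫ f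
dμ` over functions `f` bounded by `a` and `b`-Lipschitz (`pairing_le_gwNorm`,
`gwNorm_le_of_forall_BL`), and smooth compactly supported `f` suffice (`gwNorm_le_of_forall_test`).
The triangle inequality and definiteness follow at once, and every estimate below becomes an
estimate of a pairing with a test function.

Existence comes from the explicit Euler scheme that pushes `μ` forward by `x + τ v[μ](x)` and adds
`τ h[μ]`. Two steps of length `τ` differ from one step of length `2τ` by `O(τ²)`, and one step
expands distances by a factor `1 + O(τ)`, so the dyadic schemes are Cauchy with error `O(2⁻ⁿ)`. The
norm need not be complete, but the approximations have uniformly bounded mass, so a vague limit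
exists and is also a limit in norm (`exists_gwNorm_limit`). The consistency error over a time span
`t` is `O(t²)` uniformly in `n`; this survives in the limit and yields the weak equation.

All properties of an arbitrary solution come from duality with a discrete backward flow: the test
function `ψ` at time `s + τ` is replaced by `ψ(x + τ W(x))` at time `s`, where `W` is a smoothing at
scale `ε` of a velocity. There are two obstacles. First, continuity in the norm gives no direct mass
bound; compactness of `[0,1]` gives the substitute `NearBoundedMass`, where a small multiple of the
Lipschitz constant is allowed besides a multiple of the sup norm. Second, the velocity is only
Lipschitz, so the gradients of the transported test functions have Lipschitz constants of order
`1/ε`; this is harmless because smoothing changes the velocity only by `O(ε)`, and the product stays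
bounded.

`le_of_backward_steps` turns a one-step estimate into a global one for any property of test
functions preserved by the backward step. The property `|ψ| ≤ 1` gives the mass bound, vanishing on
a growing ball gives the support bound, and a Lipschitz bound that grows exponentially backward in
time gives stability, closed by Gronwall's lemma. Uniqueness is stability with equal data. -/

namespace SignedTransport

/-! ### Integration of functions against signed measures -/

section Pairing

variable {E : Type*} [NormedAddCommGroup E] [MeasurableSpace E]

/-- Bounded continuous real functions. -/
def IsBC (f : E → ℝ) : Prop := Continuous f ∧ ∃ C, ∀ x, |f x| ≤ C

/-- Functions bounded by `B` and Lipschitz with constant `Λ`. -/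
structure BL (B Λ : ℝ) (f : E → ℝ) : Prop where
  bound : ∀ x, |f x| ≤ B
  lip : ∀ x y, |f x - f y| ≤ Λ * ‖x - y‖

/-- The integral of a function against a signed measure. -/
def pairing (μ : SignedMeasure E) (f : E → ℝ) : ℝ := ∫ᵛ x, f x ∂<•μ

lemma IsBC.add {f g : E → ℝ} (hf : IsBC f) (hg : IsBC g) : IsBC (fun x => f x + g x) := by
  obtain ⟨hf, C, hC⟩ := hf
  obtain ⟨hg, D, hD⟩ := hg
  exact ⟨hf.add hg, C + D, fun x => (abs_add_le _ _).trans (add_le_add (hC x) (hD x))⟩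

lemma IsBC.const_mul {f : E → ℝ} (hf : IsBC f) (c : ℝ) : IsBC (fun x => c * f x) := by
  obtain ⟨hf, C, hC⟩ := hf
  exact ⟨continuous_const.mul hf, |c| * C, fun x => by
    rw [abs_mul]; exact mul_le_mul_of_nonneg_left (hC x) (abs_nonneg c)⟩

lemma IsBC.sub {f g : E → ℝ} (hf : IsBC f) (hg : IsBC g) : IsBC (fun x => f x - g x) := by
  simpa [sub_eq_add_neg] using hf.add (hg.const_mul (-1))

lemma IsBC.comp {f : E → ℝ} (hf : IsBC f) {T : E → E} (hT : Continuous T) :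
    IsBC (fun x => f (T x)) :=
  ⟨hf.1.comp hT, hf.2.imp fun _ h x => h (T x)⟩

lemma BL.isBC {B Λ : ℝ} {f : E → ℝ} (hf : BL B Λ f) : IsBC f := by
  refine ⟨?_, B, hf.bound⟩
  have : LipschitzWith (Real.toNNReal Λ) f := LipschitzWith.of_dist_le_mul fun x y => by
    rw [dist_eq_norm, dist_eq_norm, Real.norm_eq_abs]
    exact (hf.lip x y).trans
      (mul_le_mul_of_nonneg_right (Real.le_coe_toNNReal Λ) (norm_nonneg _))
  exact this.continuous

lemma BL.bound_nonneg {B Λ : ℝ} {f : E → ℝ} (hf : BL B Λ f) : 0 ≤ B :=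
  (abs_nonneg _).trans (hf.bound 0)

lemma BL.mono {B Λ B' Λ' : ℝ} {f : E → ℝ} (hf : BL B Λ f) (hB : B ≤ B') (hΛ : Λ ≤ Λ') :
    BL B' Λ' f :=
  ⟨fun x => (hf.bound x).trans hB, fun x y => (hf.lip x y).trans (by gcongr)⟩

lemma BL.const_mul {B Λ : ℝ} {f : E → ℝ} (hf : BL B Λ f) (c : ℝ) :
    BL (|c| * B) (|c| * Λ) (fun x => c * f x) :=
  ⟨fun x => by rw [abs_mul]; exact mul_le_mul_of_nonneg_left (hf.bound x) (abs_nonneg c),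
   fun x y => by
    rw [← mul_sub, abs_mul, mul_assoc]
    exact mul_le_mul_of_nonneg_left (hf.lip x y) (abs_nonneg c)⟩

lemma BL.neg {B Λ : ℝ} {f : E → ℝ} (hf : BL B Λ f) : BL B Λ (fun x => - f x) := by
  simpa using hf.const_mul (-1)

lemma BL.comp {B Λ C : ℝ} {f : E → ℝ} (hf : BL B Λ f) (hΛ : 0 ≤ Λ) {T : E → E}
    (hT : ∀ x y, ‖T x - T y‖ ≤ C * ‖x - y‖) : BL B (Λ * C) (fun x => f (T x)) :=
  ⟨fun x => hf.bound _, fun x y => (hf.lip _ _).trans (by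
    rw [mul_assoc]; exact mul_le_mul_of_nonneg_left (hT x y) hΛ)⟩

instance instIsFiniteMeasureVariation (μ : SignedMeasure E) : IsFiniteMeasure μ.variation := by
  rw [← SignedMeasure.totalVariation_eq_variation]
  unfold SignedMeasure.totalVariation
  infer_instance

lemma mass_eq_variation (μ : SignedMeasure E) : mass μ = μ.variation.real univ := by
  rw [mass, SignedMeasure.totalVariation_eq_variation, measureReal_def]

lemma mass_nonneg (μ : SignedMeasure E) : 0 ≤ mass μ := ENNReal.toReal_nonneg

lemma abs_pairing_le_of_ae (μ : SignedMeasure E) {f : E → ℝ} {C : ℝ}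
    (hC : ∀ᵐ x ∂μ.totalVariation, |f x| ≤ C) : |pairing μ f| ≤ C * mass μ := by
  rw [mass_eq_variation]
  rw [SignedMeasure.totalVariation_eq_variation] at hC
  have h := VectorMeasure.norm_integral_le_of_norm_le_const (μ := μ)
    (B := (ContinuousLinearMap.lsmul ℝ ℝ (E := ℝ)).flip) (f := f) (C := C) hC
  have hB : ‖(ContinuousLinearMap.lsmul ℝ ℝ (E := ℝ)).flip‖ = 1 := by
    rw [ContinuousLinearMap.opNorm_flip]; simp
  rw [hB, mul_one] at h
  exact h

lemma abs_pairing_le (μ : SignedMeasure E) {f : E → ℝ} {C : ℝ} (hC : ∀ x, |f x| ≤ C) :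
    |pairing μ f| ≤ C * mass μ := abs_pairing_le_of_ae μ (Eventually.of_forall hC)

lemma pairing_eq_zero_of_ae (μ : SignedMeasure E) {f : E → ℝ}
    (hC : ∀ᵐ x ∂μ.totalVariation, f x = 0) : pairing μ f = 0 := by
  have h := abs_pairing_le_of_ae (f := f) (C := 0) μ (hC.mono fun x hx => by simp [hx])
  simpa using h

variable [BorelSpace E]

lemma IsBC.integrable {f : E → ℝ} (hf : IsBC f) (ν : Measure E) [IsFiniteMeasure ν] :
    Integrable f ν := by
  obtain ⟨hf, C, hC⟩ := hf
  exact Integrable.of_bound hf.aestronglyMeasurable C (Eventually.of_forall hC)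

lemma pairing_sub (μ : SignedMeasure E) {f g : E → ℝ} (hf : IsBC f) (hg : IsBC g) :
    pairing μ (fun x => f x - g x) = pairing μ f - pairing μ g :=
  VectorMeasure.integral_fun_sub (hf.integrable _) (hg.integrable _)

lemma pairing_const_mul (μ : SignedMeasure E) (c : ℝ) (f : E → ℝ) :
    pairing μ (fun x => c * f x) = c * pairing μ f :=
  VectorMeasure.integral_fun_smul μ _ c f

lemma pairing_neg (μ : SignedMeasure E) (f : E → ℝ) :
    pairing μ (fun x => - f x) = - pairing μ f := by
  simpa using pairing_const_mul μ (-1) f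

lemma pairing_add_measure (μ ν : SignedMeasure E) {f : E → ℝ} (hf : IsBC f) :
    pairing (μ + ν) f = pairing μ f + pairing ν f :=
  VectorMeasure.integral_add_vectorMeasure (hf.integrable _) (hf.integrable _)

lemma pairing_sub_measure (μ ν : SignedMeasure E) {f : E → ℝ} (hf : IsBC f) :
    pairing (μ - ν) f = pairing μ f - pairing ν f :=
  VectorMeasure.integral_sub_vectorMeasure (hf.integrable _) (hf.integrable _)

lemma pairing_smul_measure (c : ℝ) (μ : SignedMeasure E) (f : E → ℝ) :
    pairing (c • μ) f = c * pairing μ f :=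
  VectorMeasure.integral_smul_vectorMeasure f c

lemma pairing_neg_measure (μ : SignedMeasure E) (f : E → ℝ) :
    pairing (-μ) f = - pairing μ f := by
  rw [← neg_one_smul ℝ μ, pairing_smul_measure, neg_one_mul]

lemma pairing_map (μ : SignedMeasure E) {T : E → E} (hT : Continuous T) {f : E → ℝ}
    (hf : IsBC f) : pairing (μ.map T) f = pairing μ (fun x => f (T x)) :=
  VectorMeasure.integral_map hT.measurable hf.1.aestronglyMeasurable
    ((hf.comp hT).integrable _)

lemma pairing_toSignedMeasure (ν : Measure E) [IsFiniteMeasure ν] (f : E → ℝ) :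
    pairing ν.toSignedMeasure f = ∫ x, f x ∂ν :=
  VectorMeasure.integral_toSignedMeasure

lemma eq_jordanPos_sub_jordanNeg (μ : SignedMeasure E) :
    μ = (jordanPos μ : Measure E).toSignedMeasure - (jordanNeg μ : Measure E).toSignedMeasure :=
  (SignedMeasure.toSignedMeasure_toJordanDecomposition μ).symm

lemma pairing_eq (μ : SignedMeasure E) {f : E → ℝ} (hf : IsBC f) :
    pairing μ f = ∫ x, f x ∂(jordanPos μ : Measure E) - ∫ x, f x ∂(jordanNeg μ : Measure E) := by
  conv_lhs => rw [eq_jordanPos_sub_jordanNeg μ]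
  rw [pairing_sub_measure _ _ hf, pairing_toSignedMeasure, pairing_toSignedMeasure]

lemma tendsto_pairing_of_dominated (μ : SignedMeasure E) {F : ℕ → E → ℝ} {f : E → ℝ} (C : ℝ)
    (hF : ∀ n, Continuous (F n)) (hC : ∀ n x, |F n x| ≤ C)
    (hlim : ∀ x, Tendsto (fun n => F n x) atTop (𝓝 (f x))) :
    Tendsto (fun n => pairing μ (F n)) atTop (𝓝 (pairing μ f)) :=
  VectorMeasure.tendsto_integral_of_dominated_convergence (fun _ => C)
    (fun n => (hF n).aestronglyMeasurable) (integrable_const _)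
    (fun n => Eventually.of_forall (hC n)) (Eventually.of_forall hlim)

end Pairing

/-! ### Weak duality: admissible functions bound the norm from below -/

section WeakDuality

variable {E : Type*} [NormedAddCommGroup E] [MeasurableSpace E] [BorelSpace E]

lemma abs_integral_sub_le (ρ ρ' : FiniteMeasure E) {f : E → ℝ} {C : ℝ} (hf : Continuous f)
    (hC : ∀ x, |f x| ≤ C) :
    |∫ x, f x ∂(ρ : Measure E) - ∫ x, f x ∂(ρ' : Measure E)| ≤
      C * mass ((ρ : Measure E).toSignedMeasure - (ρ' : Measure E).toSignedMeasure) := by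
  rw [← pairing_toSignedMeasure, ← pairing_toSignedMeasure,
    ← pairing_sub_measure _ _ ⟨hf, C, hC⟩]
  exact abs_pairing_le _ hC

lemma ofReal_mass (μ : SignedMeasure E) : ENNReal.ofReal (mass μ) = μ.totalVariation univ := by
  rw [mass, ENNReal.ofReal_toReal]
  rw [SignedMeasure.totalVariation_eq_variation]
  exact measure_ne_top _ _

lemma integral_sub_le_of_isPlan [SecondCountableTopology E] {b : ℝ} {B : ℝ} {f : E → ℝ}
    (hf : BL B b f) {ρ σ : FiniteMeasure E} {π : Measure (E × E)} (hπ : IsPlan ρ σ π)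
    (hfin : ∫⁻ p, edist p.1 p.2 ∂π ≠ ⊤) :
    ∫ x, f x ∂(ρ : Measure E) - ∫ x, f x ∂(σ : Measure E) ≤
      b * (∫⁻ p, edist p.1 p.2 ∂π).toReal := by
  have hπfin : IsFiniteMeasure π := ⟨by
    rw [← Measure.fst_univ, hπ.1]; exact measure_lt_top _ _⟩
  obtain ⟨hc, C, hC⟩ := hf.isBC
  have h1 : Integrable (fun p : E × E => f p.1) π :=
    Integrable.of_bound (hc.comp continuous_fst).aestronglyMeasurable C
      (Eventually.of_forall fun p => hC p.1)
  have h2 : Integrable (fun p : E × E => f p.2) π :=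
    Integrable.of_bound (hc.comp continuous_snd).aestronglyMeasurable C
      (Eventually.of_forall fun p => hC p.2)
  have hd : Integrable (fun p : E × E => dist p.1 p.2) π := by
    refine ⟨continuous_dist.aestronglyMeasurable, ?_⟩
    rw [HasFiniteIntegral]
    refine lt_of_eq_of_lt (lintegral_congr fun p => ?_) hfin.lt_top
    rw [edist_dist, Real.enorm_eq_ofReal dist_nonneg]
  rw [← hπ.1, ← hπ.2, Measure.fst, Measure.snd,
    integral_map measurable_fst.aemeasurable hc.aestronglyMeasurable,
    integral_map measurable_snd.aemeasurable hc.aestronglyMeasurable, ← integral_sub h1 h2]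
  have h3 : (∫⁻ p, edist p.1 p.2 ∂π).toReal = ∫ p, dist p.1 p.2 ∂π := by
    rw [integral_eq_lintegral_of_nonneg_ae (Eventually.of_forall fun p => dist_nonneg)
      continuous_dist.aestronglyMeasurable]
    congr 1
    exact lintegral_congr fun p => edist_dist _ _
  rw [h3, ← integral_const_mul]
  refine integral_mono (h1.sub h2) (hd.const_mul b) fun p => ?_
  have := (le_abs_self _).trans (hf.lip p.1 p.2)
  simpa [dist_eq_norm] using this

/-- Replacing `μ⁺, μ⁻` by `ρ, σ` changes the integral of `f` by at most `a` times the removed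
masses, and along any plan between `ρ` and `σ` the difference of the integrals is at most `b` times
the cost. -/
lemma pairing_le_removalTransportCost [SecondCountableTopology E] {a b : ℝ} (ha : 0 < a)
    (hb : 0 < b) (μ : SignedMeasure E) {f : E → ℝ} (hf : BL a b f) (ρ σ : FiniteMeasure E) :
    ENNReal.ofReal (pairing μ f) ≤ removalTransportCost a b (jordanPos μ) (jordanNeg μ) ρ σ := by
  -- The removal terms and the factor `b` are moved to the left in `ℝ≥0∞`, so that the infimum over
  -- plans stands alone and can be tested plan by plan.
  rw [removalTransportCost, ← tsub_le_iff_left, mul_comm (ENNReal.ofReal b),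
    ← ENNReal.div_le_iff_le_mul (Or.inl (by simpa using hb)) (Or.inl ENNReal.ofReal_ne_top),
    wasserstein]
  refine le_iInf₂ fun π hπ => ?_
  rw [ENNReal.div_le_iff_le_mul (Or.inl (by simpa using hb)) (Or.inl ENNReal.ofReal_ne_top),
    tsub_le_iff_left]
  by_cases hfin : ∫⁻ p, edist p.1 p.2 ∂π = ⊤
  · rw [hfin, ENNReal.top_mul (by simpa using hb), add_top]
    exact le_top
  have h1 := (le_abs_self _).trans (abs_integral_sub_le (jordanPos μ) ρ hf.isBC.1 hf.bound)
  have h2 := (neg_le_abs _).trans (abs_integral_sub_le (jordanNeg μ) σ hf.isBC.1 hf.bound)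
  have h3 := integral_sub_le_of_isPlan hf hπ hfin
  have h4 := pairing_eq μ hf.isBC
  rw [← ofReal_mass, ← ofReal_mass, ← ENNReal.ofReal_toReal hfin,
    ← ENNReal.ofReal_add (mass_nonneg _) (mass_nonneg _), ← ENNReal.ofReal_mul ha.le,
    ← ENNReal.ofReal_mul ENNReal.toReal_nonneg, ← ENNReal.ofReal_add
      (mul_nonneg ha.le (add_nonneg (mass_nonneg _) (mass_nonneg _)))
      (mul_nonneg ENNReal.toReal_nonneg hb.le)]
  refine ENNReal.ofReal_le_ofReal ?_
  rw [mul_add, mul_comm (ENNReal.toReal _) b]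
  linarith

lemma iInf_removalTransportCost_ne_top (a b : ℝ) (ρ σ : FiniteMeasure E) :
    (⨅ (μ' : FiniteMeasure E) (ν' : FiniteMeasure E) (_ : μ'.mass = ν'.mass),
      removalTransportCost a b ρ σ μ' ν') ≠ ⊤ := by
  refine ne_top_of_le_ne_top ?_ (iInf_le_of_le 0 (iInf_le_of_le 0 (iInf_le_of_le rfl le_rfl)))
  rw [removalTransportCost]
  have hW : wasserstein (0 : FiniteMeasure E) 0 = 0 := by
    refine le_antisymm ?_ bot_le
    refine iInf₂_le_of_le 0 ⟨?_, ?_⟩ (by simp)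
    · simp [Measure.fst]
    · simp [Measure.snd]
  rw [hW, mul_zero, add_zero, ← ofReal_mass, ← ofReal_mass]
  finiteness

/-- Weak duality. -/
lemma pairing_le_gwNorm [SecondCountableTopology E] {a b : ℝ} (ha : 0 < a) (hb : 0 < b)
    (μ : SignedMeasure E) {f : E → ℝ} (hf : BL a b f) : pairing μ f ≤ gwNorm a b μ := by
  rw [gwNorm, genWasserstein]
  refine (ENNReal.ofReal_le_iff_le_toReal (iInf_removalTransportCost_ne_top _ _ _ _)).1 ?_
  exact le_iInf fun ρ => le_iInf fun σ => le_iInf fun _ =>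
    pairing_le_removalTransportCost ha hb μ hf ρ σ

lemma gwNorm_nonneg (a b : ℝ) (μ : SignedMeasure E) : 0 ≤ gwNorm a b μ := ENNReal.toReal_nonneg

lemma abs_pairing_le_gwNorm [SecondCountableTopology E] {a b : ℝ} (ha : 0 < a) (hb : 0 < b)
    (μ : SignedMeasure E) {f : E → ℝ} {c : ℝ} (hc : 0 ≤ c) (hf : BL (c * a) (c * b) f) :
    |pairing μ f| ≤ c * gwNorm a b μ := by
  rcases hc.eq_or_lt with rfl | hc
  · have h0 := abs_pairing_le μ (C := 0) fun x => by simpa using hf.bound x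
    simpa using h0
  have key : ∀ g : E → ℝ, BL (c * a) (c * b) g → pairing μ g ≤ c * gwNorm a b μ := fun g hg => by
    have h1 : BL a b (fun x => c⁻¹ * g x) := by
      have := hg.const_mul c⁻¹
      rwa [abs_of_pos (inv_pos.2 hc), inv_mul_cancel_left₀ hc.ne',
        inv_mul_cancel_left₀ hc.ne'] at this
    have h2 := pairing_le_gwNorm ha hb μ h1
    rwa [pairing_const_mul, inv_mul_le_iff₀ hc] at h2
  refine abs_le.2 ⟨?_, key f hf⟩
  have := key _ hf.neg
  rw [pairing_neg] at this
  linarith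

end WeakDuality

open scoped BoundedContinuousFunction CompactlySupported

/-! ### Partial transport duality by Hahn-Banach and Riesz -/

section PartialTransport

variable {E : Type*} [NormedAddCommGroup E] [MeasurableSpace E] [BorelSpace E]

/-- Values of the dual partial transport problem for the reward `f`. -/
def dualValues (ρ σ : Measure E) (f : E × E →ᵇ ℝ) : Set ℝ :=
  {r | ∃ φ ψ : E →ᵇ ℝ, (∀ x, 0 ≤ φ x) ∧ (∀ y, 0 ≤ ψ y) ∧ (∀ x y, f (x, y) ≤ φ x + ψ y) ∧
    r = ∫ x, φ x ∂ρ + ∫ y, ψ y ∂σ}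

/-- Optimal value of the dual partial transport problem for the reward `f`. -/
def dualInf (ρ σ : Measure E) (f : E × E →ᵇ ℝ) : ℝ := sInf (dualValues ρ σ f)

variable (ρ σ : Measure E)

lemma dualValues_bddBelow (f : E × E →ᵇ ℝ) : BddBelow (dualValues ρ σ f) := by
  refine ⟨0, ?_⟩
  rintro r ⟨φ, ψ, hφ, hψ, -, rfl⟩
  exact add_nonneg (integral_nonneg hφ) (integral_nonneg hψ)

lemma dualValues_nonempty (f : E × E →ᵇ ℝ) : (dualValues ρ σ f).Nonempty :=
  ⟨_, BoundedContinuousFunction.const E ‖f‖, 0, fun _ => norm_nonneg f, fun _ => le_rfl,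
    fun x y => by simpa using (le_abs_self _).trans (f.norm_coe_le_norm (x, y)), rfl⟩

lemma dualInf_le {f : E × E →ᵇ ℝ} (φ ψ : E →ᵇ ℝ) (hφ : ∀ x, 0 ≤ φ x) (hψ : ∀ y, 0 ≤ ψ y)
    (h : ∀ x y, f (x, y) ≤ φ x + ψ y) : dualInf ρ σ f ≤ ∫ x, φ x ∂ρ + ∫ y, ψ y ∂σ :=
  csInf_le (dualValues_bddBelow ρ σ f) ⟨φ, ψ, hφ, hψ, h, rfl⟩

lemma dualInf_smul_le {c : ℝ} (hc : 0 < c) (f : E × E →ᵇ ℝ) :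
    dualInf ρ σ (c • f) ≤ c * dualInf ρ σ f := by
  rw [← inv_mul_le_iff₀ hc]
  refine le_csInf (dualValues_nonempty ρ σ f) ?_
  rintro r ⟨φ, ψ, hφ, hψ, h, rfl⟩
  rw [inv_mul_le_iff₀ hc]
  refine (dualInf_le ρ σ (c • φ) (c • ψ) (fun x => mul_nonneg hc.le (hφ x))
    (fun x => mul_nonneg hc.le (hψ x)) fun x y => ?_).trans (le_of_eq ?_)
  · have := mul_le_mul_of_nonneg_left (h x y) hc.le
    simpa [mul_add] using this
  · simp [integral_const_mul, mul_add]

lemma dualInf_smul {c : ℝ} (hc : 0 < c) (f : E × E →ᵇ ℝ) :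
    dualInf ρ σ (c • f) = c * dualInf ρ σ f := by
  refine le_antisymm (dualInf_smul_le ρ σ hc f) ?_
  have h := dualInf_smul_le ρ σ (inv_pos.2 hc) (c • f)
  rw [inv_smul_smul₀ hc.ne', le_inv_mul_iff₀ hc] at h
  exact h

lemma dualInf_nonneg (f : E × E →ᵇ ℝ) : 0 ≤ dualInf ρ σ f := by
  refine le_csInf (dualValues_nonempty ρ σ f) ?_
  rintro r ⟨φ, ψ, hφ, hψ, -, rfl⟩
  exact add_nonneg (integral_nonneg hφ) (integral_nonneg hψ)

variable [SecondCountableTopology E] [IsFiniteMeasure ρ] [IsFiniteMeasure σ]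

lemma dualInf_add_le (f g : E × E →ᵇ ℝ) :
    dualInf ρ σ (f + g) ≤ dualInf ρ σ f + dualInf ρ σ g := by
  rw [← sub_le_iff_le_add]
  refine le_csInf (dualValues_nonempty ρ σ f) ?_
  rintro r ⟨φ, ψ, hφ, hψ, h, rfl⟩
  rw [sub_le_comm]
  refine le_csInf (dualValues_nonempty ρ σ g) ?_
  rintro s ⟨φ', ψ', hφ', hψ', h', rfl⟩
  rw [sub_le_iff_le_add]
  refine (dualInf_le ρ σ (φ + φ') (ψ + ψ') (fun x => add_nonneg (hφ x) (hφ' x))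
    (fun x => add_nonneg (hψ x) (hψ' x)) fun x y => ?_).trans (le_of_eq ?_)
  · have h1 := h x y
    have h2 := h' x y
    simp only [BoundedContinuousFunction.coe_add, Pi.add_apply]
    linarith
  · simp only [BoundedContinuousFunction.coe_add, Pi.add_apply]
    rw [integral_add (φ.integrable ρ) (φ'.integrable ρ),
      integral_add (ψ.integrable σ) (ψ'.integrable σ)]
    ring

/-- The dual value is sublinear in the reward, so Hahn-Banach extends the functional `c f₀ ↦ c *
dualInf f₀` from the line of `f₀` while staying below it. -/
lemma exists_linear_le_dualInf (f₀ : E × E →ᵇ ℝ) :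
    ∃ Λ : (E × E →ᵇ ℝ) →ₗ[ℝ] ℝ, Λ f₀ = dualInf ρ σ f₀ ∧ ∀ f, Λ f ≤ dualInf ρ σ f := by
  have hzero : dualInf ρ σ 0 = 0 := by
    refine le_antisymm ?_ (dualInf_nonneg ρ σ 0)
    refine (dualInf_le ρ σ 0 0 (fun _ => le_rfl) (fun _ => le_rfl) fun x y => ?_).trans ?_ <;> simp
  by_cases hf₀ : f₀ = 0
  · subst hf₀
    exact ⟨0, by simp [hzero], fun f => by simpa using dualInf_nonneg ρ σ f⟩
  obtain ⟨Λ, h1, h2⟩ := exists_extension_of_le_sublinear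
    (LinearPMap.mkSpanSingleton f₀ (dualInf ρ σ f₀) hf₀) (dualInf ρ σ)
    (fun c hc f => dualInf_smul ρ σ hc f) (dualInf_add_le ρ σ) (by
      rintro ⟨x, hx⟩
      obtain ⟨c, rfl⟩ := Submodule.mem_span_singleton.1 hx
      have happ : LinearPMap.mkSpanSingleton f₀ (dualInf ρ σ f₀) hf₀ ⟨c • f₀, hx⟩ =
          c • dualInf ρ σ f₀ := LinearPMap.mkSpanSingleton'_apply _ _ _ c hx
      rw [happ]
      -- For negative `c`, subadditivity gives `0 = dualInf 0 ≤ dualInf (c f₀) + (-c) dualInf f₀`,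
      -- which is the required bound.
      rcases lt_trichotomy c 0 with hc | rfl | hc
      · have h1 := dualInf_add_le ρ σ (c • f₀) ((-c) • f₀)
        rw [← add_smul, add_neg_cancel, zero_smul, hzero, dualInf_smul ρ σ (neg_pos.2 hc)] at h1
        simp only [smul_eq_mul]
        linarith
      · simp [hzero]
      · rw [dualInf_smul ρ σ hc, smul_eq_mul])
  refine ⟨Λ, ?_, h2⟩
  have := h1 ⟨f₀, Submodule.mem_span_singleton_self f₀⟩
  rw [this]
  exact LinearPMap.mkSpanSingleton_apply ℝ ℝ hf₀ (dualInf ρ σ f₀)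

variable [ProperSpace E]

/-- A compactly supported continuous function as a bounded continuous function. -/
def bcfOfCompactSupport {X : Type*} [TopologicalSpace X] :
    C_c(X, ℝ) →ₗ[ℝ] (X →ᵇ ℝ) where
  toFun f := f.toBoundedContinuousFunction
  map_add' _ _ := rfl
  map_smul' _ _ := rfl

@[simp]
lemma bcfOfCompactSupport_apply {X : Type*} [TopologicalSpace X] (f : C_c(X, ℝ)) (x : X) :
    bcfOfCompactSupport f x = f x := rfl

lemma linear_nonneg_of_le_dualInf {Λ : (E × E →ᵇ ℝ) →ₗ[ℝ] ℝ} (hΛ : ∀ f, Λ f ≤ dualInf ρ σ f)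
    (f : E × E →ᵇ ℝ) (hf : ∀ p, 0 ≤ f p) : 0 ≤ Λ f := by
  have h1 := hΛ (-f)
  have h2 := dualInf_le (f := -f) ρ σ 0 0 (fun _ => le_rfl) (fun _ => le_rfl)
    (fun x y => by simpa using hf (x, y))
  simp only [map_neg, BoundedContinuousFunction.coe_zero, Pi.zero_apply, integral_zero] at h1 h2
  linarith

/-- The compactly supported product `(x, y) ↦ f x * g y`. -/
def prodCompact (f g : C_c(E, ℝ)) : C_c(E × E, ℝ) where
  toFun p := f p.1 * g p.2
  continuous_toFun := by fun_prop
  hasCompactSupport' := by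
    refine HasCompactSupport.intro (f.hasCompactSupport.isCompact.prod
      g.hasCompactSupport.isCompact) fun p hp => ?_
    simp only [mem_prod, not_and_or] at hp
    rcases hp with hp | hp
    · simp [image_eq_zero_of_notMem_tsupport hp]
    · simp [image_eq_zero_of_notMem_tsupport hp]

lemma exists_compact_bump {K U : Set E} (hK : IsCompact K) (hU : IsOpen U) (hKU : K ⊆ U) :
    ∃ f : C_c(E, ℝ), (∀ x ∈ K, f x = 1) ∧ (∀ x, 0 ≤ f x) ∧ (∀ x, f x ≤ 1) ∧
      ∀ x ∉ U, f x = 0 := by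
  obtain ⟨f, h1, h2, h3, h4⟩ := exists_continuousMap_one_of_isCompact_subset_isOpen hK hU hKU
  exact ⟨⟨f, h2⟩, fun x hx => h1 hx, fun x => (h4 x).1, fun x => (h4 x).2, fun x hx =>
    image_eq_zero_of_notMem_tsupport fun h => hx (h3 h)⟩

lemma integral_le_measureReal_of_le_one {ν : Measure E} [IsFiniteMeasure ν] {U : Set E}
    (hU : IsOpen U) (f : E →ᵇ ℝ) (h1 : ∀ x, f x ≤ 1)
    (hU0 : ∀ x ∉ U, f x = 0) : ∫ x, f x ∂ν ≤ ν.real U := by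
  rw [← integral_indicator_one hU.measurableSet]
  refine integral_mono (f.integrable ν)
    ((integrable_const (1 : ℝ)).indicator hU.measurableSet) fun x => ?_
  by_cases hx : x ∈ U
  · simp [hx, h1 x]
  · simp [hx, hU0 x hx]

lemma measure_le_of_forall_isOpen {ν ν' : Measure E} [IsFiniteMeasure ν']
    (h : ∀ U, IsOpen U → ν U ≤ ν' U) : ν ≤ ν' := by
  refine Measure.le_iff.2 fun s _ => ?_
  rw [s.measure_eq_iInf_isOpen ν']
  exact le_iInf₂ fun U hsU => le_iInf fun hU => (measure_mono hsU).trans (h U hU)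

/-- The Hahn-Banach functional is positive, since a nonpositive reward has dual value at most `0`,
so on compactly supported functions it is integration against a measure `π`. Products `f ⊗ g` of
cut-offs are dominated by `f` alone and by `g` alone, so the dual value bounds the marginals of `π`
by `ρ` and `σ`. Tightness of `ρ` and `σ` shows that the functional loses nothing at infinity. -/
lemma exists_partial_plan (f₀ : E × E →ᵇ ℝ) (hf₀ : ∀ p, 0 ≤ f₀ p) :
    ∃ π : Measure (E × E), π.fst ≤ ρ ∧ π.snd ≤ σ ∧ dualInf ρ σ f₀ ≤ ∫ p, f₀ p ∂π := by
  obtain ⟨Λ, hΛ0, hΛ⟩ := exists_linear_le_dualInf ρ σ f₀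
  have hpos := linear_nonneg_of_le_dualInf ρ σ hΛ
  let Λc : C_c(E × E, ℝ) →ₚ[ℝ] ℝ := PositiveLinearMap.mk₀ (Λ ∘ₗ bcfOfCompactSupport)
    fun f hf => hpos _ fun p => hf p
  have hΛc : ∀ f, Λc f = Λ (bcfOfCompactSupport f) := fun f => rfl
  set π := RealRMK.rieszMeasure Λc with hπ
  have hint : ∀ f : C_c(E × E, ℝ), ∫ p, f p ∂π = Λ (bcfOfCompactSupport f) := fun f => by
    rw [hπ, RealRMK.integral_rieszMeasure, hΛc]
  have hfst : π.fst ≤ ρ := by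
    refine measure_le_of_forall_isOpen fun U hU => ?_
    rw [Measure.fst_apply hU.measurableSet, (hU.preimage continuous_fst).measure_eq_iSup_isCompact]
    refine iSup₂_le fun K hKU => iSup_le fun hK => ?_
    obtain ⟨f, hf1, hf2, hf3, hf4⟩ := exists_compact_bump (hK.image continuous_fst) hU
      (image_subset_iff.2 hKU)
    obtain ⟨g, hg1, hg2, hg3, -⟩ := exists_compact_bump (hK.image continuous_snd) isOpen_univ
      (subset_univ _)
    refine (RealRMK.rieszMeasure_le_of_eq_one Λc (f := prodCompact f g)
      (fun p => mul_nonneg (hf2 _) (hg2 _)) hK fun p hp => ?_).trans ?_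
    · change f p.1 * g p.2 = 1
      rw [hf1 _ ⟨p, hp, rfl⟩, hg1 _ ⟨p, hp, rfl⟩, one_mul]
    · refine ENNReal.ofReal_le_of_le_toReal ?_
      rw [hΛc]
      refine (hΛ _).trans ((dualInf_le ρ σ (bcfOfCompactSupport f) 0 hf2 (fun _ => le_rfl)
        fun x y => ?_).trans ?_)
      · change f x * g y ≤ f x + 0
        rw [add_zero]
        exact mul_le_of_le_one_right (hf2 x) (hg3 y)
      · simpa [measureReal_def] using
          integral_le_measureReal_of_le_one (ν := ρ) hU (bcfOfCompactSupport f) hf3 hf4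
  have hsnd : π.snd ≤ σ := by
    refine measure_le_of_forall_isOpen fun U hU => ?_
    rw [Measure.snd_apply hU.measurableSet, (hU.preimage continuous_snd).measure_eq_iSup_isCompact]
    refine iSup₂_le fun K hKU => iSup_le fun hK => ?_
    obtain ⟨f, hf1, hf2, hf3, -⟩ := exists_compact_bump (hK.image continuous_fst) isOpen_univ
      (subset_univ _)
    obtain ⟨g, hg1, hg2, hg3, hg4⟩ := exists_compact_bump (hK.image continuous_snd) hU
      (image_subset_iff.2 hKU)
    refine (RealRMK.rieszMeasure_le_of_eq_one Λc (f := prodCompact f g)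
      (fun p => mul_nonneg (hf2 _) (hg2 _)) hK fun p hp => ?_).trans ?_
    · change f p.1 * g p.2 = 1
      rw [hf1 _ ⟨p, hp, rfl⟩, hg1 _ ⟨p, hp, rfl⟩, one_mul]
    · refine ENNReal.ofReal_le_of_le_toReal ?_
      rw [hΛc]
      refine (hΛ _).trans ((dualInf_le ρ σ 0 (bcfOfCompactSupport g) (fun _ => le_rfl) hg2
        fun x y => ?_).trans ?_)
      · change f x * g y ≤ 0 + g y
        rw [zero_add]
        exact mul_le_of_le_one_left (hg2 y) (hf3 x)
      · simpa [measureReal_def] using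
          integral_le_measureReal_of_le_one (ν := σ) hU (bcfOfCompactSupport g) hg3 hg4
  have hfin : IsFiniteMeasure π := ⟨by
    rw [← Measure.fst_univ]; exact (hfst univ).trans_lt (measure_lt_top ρ univ)⟩
  refine ⟨π, hfst, hsnd, ?_⟩
  rw [← hΛ0]
  refine le_of_forall_pos_le_add fun ε hε => ?_
  -- The functional agrees with `π` only on compactly supported functions. Cutting `f₀` off outside
  -- a large product of compacts costs at most `ε`, because the removed part is dominated by a sum
  -- of two functions of small integral.
  have htight : ∀ ν : Measure E, IsFiniteMeasure ν → ∀ δ > 0, ∃ K : Set E, IsCompact K ∧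
      ν.real Kᶜ ≤ δ := fun ν _ δ hδ => by
    obtain ⟨K, -, hK, hlt⟩ := MeasurableSet.univ.exists_isCompact_lt_add
      (measure_ne_top ν univ) (ε := ENNReal.ofReal δ) (by simpa using hδ)
    refine ⟨K, hK, ?_⟩
    rw [measureReal_compl hK.measurableSet, measureReal_def, measureReal_def, sub_le_iff_le_add']
    rw [← ENNReal.toReal_ofReal hδ.le, ← ENNReal.toReal_add (measure_ne_top _ _)
      ENNReal.ofReal_ne_top]
    exact ENNReal.toReal_mono (by finiteness) hlt.le
  obtain ⟨C, hC0, hC⟩ : ∃ C > 0, ∀ p, f₀ p ≤ C := ⟨‖f₀‖ + 1, by positivity, fun p =>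
    ((le_abs_self _).trans (f₀.norm_coe_le_norm p)).trans (by linarith)⟩
  obtain ⟨K₁, hK₁, hK₁'⟩ := htight ρ inferInstance (ε / (2 * C)) (by positivity)
  obtain ⟨K₂, hK₂, hK₂'⟩ := htight σ inferInstance (ε / (2 * C)) (by positivity)
  obtain ⟨f, hf1, hf2, hf3, -⟩ := exists_compact_bump hK₁ isOpen_univ (subset_univ _)
  obtain ⟨g, hg1, hg2, hg3, -⟩ := exists_compact_bump hK₂ isOpen_univ (subset_univ _)
  let u : C_c(E × E, ℝ) := ⟨⟨fun p => f₀ p * prodCompact f g p, by fun_prop⟩,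
    (prodCompact f g).hasCompactSupport.mul_left⟩
  have hu : ∀ p, u p = f₀ p * (f p.1 * g p.2) := fun p => rfl
  have h1 : Λ f₀ = Λ (bcfOfCompactSupport u) + Λ (f₀ - bcfOfCompactSupport u) := by
    rw [← map_add, add_sub_cancel]
  have hcompl : ∀ (ν : Measure E) [IsFiniteMeasure ν] (K : Set E) (w : C_c(E, ℝ)),
      IsCompact K → (∀ x ∈ K, w x = 1) → (∀ x, 0 ≤ w x) → (∀ x, w x ≤ 1) →
      ∫ x, (C • (BoundedContinuousFunction.const E (1 : ℝ) - bcfOfCompactSupport w)) x ∂ν ≤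
        C * ν.real Kᶜ := fun ν _ K w hK hw1 hw2 hw3 => by
    have := integral_le_measureReal_of_le_one (ν := ν) hK.isClosed.isOpen_compl
      (BoundedContinuousFunction.const E (1 : ℝ) - bcfOfCompactSupport w)
      (fun x => by simpa using hw2 x)
      (fun x hx => by simp [hw1 x (not_not.1 hx)])
    have h2 := mul_le_mul_of_nonneg_left this hC0.le
    rw [← integral_const_mul] at h2
    exact h2
  have h2 : Λ (f₀ - bcfOfCompactSupport u) ≤ ε := by
    refine (hΛ _).trans ((dualInf_le ρ σ
      (C • (BoundedContinuousFunction.const E (1 : ℝ) - bcfOfCompactSupport f))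
      (C • (BoundedContinuousFunction.const E (1 : ℝ) - bcfOfCompactSupport g))
      (fun x => mul_nonneg hC0.le (sub_nonneg.2 (hf3 x)))
      (fun x => mul_nonneg hC0.le (sub_nonneg.2 (hg3 x))) fun x y => ?_).trans ?_)
    -- This uses `1 - f g ≤ (1 - f) + (1 - g)`, that is, `(1 - f)(1 - g) ≥ 0`.
    · change f₀ (x, y) - f₀ (x, y) * (f x * g y) ≤ C * (1 - f x) + C * (1 - g y)
      have e1 : f₀ (x, y) * (1 - f x * g y) ≤ C * (1 - f x * g y) :=
        mul_le_mul_of_nonneg_right (hC _)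
          (sub_nonneg.2 (mul_le_one₀ (hf3 x) (hg2 y) (hg3 y)))
      have e2 : 0 ≤ C * ((1 - f x) * (1 - g y)) := mul_nonneg hC0.le
        (mul_nonneg (sub_nonneg.2 (hf3 x)) (sub_nonneg.2 (hg3 y)))
      nlinarith
    · have e1 := hcompl ρ K₁ f hK₁ hf1 hf2 hf3
      have e2 := hcompl σ K₂ g hK₂ hg1 hg2 hg3
      have e3 : C * ρ.real K₁ᶜ ≤ ε / 2 := by
        calc C * ρ.real K₁ᶜ ≤ C * (ε / (2 * C)) := by gcongr
          _ = ε / 2 := by field_simp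
      have e4 : C * σ.real K₂ᶜ ≤ ε / 2 := by
        calc C * σ.real K₂ᶜ ≤ C * (ε / (2 * C)) := by gcongr
          _ = ε / 2 := by field_simp
      linarith
  have h3 : Λ (bcfOfCompactSupport u) ≤ ∫ p, f₀ p ∂π := by
    rw [← hint]
    refine integral_mono ((bcfOfCompactSupport u).integrable π) (f₀.integrable π) fun p => ?_
    rw [hu]
    exact mul_le_of_le_one_right (hf₀ p) (mul_le_one₀ (hf3 _) (hg2 _) (hg3 _))
  linarith

end PartialTransport

/-! ### Strong duality for the generalized Wasserstein norm -/

section StrongDuality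

variable {E : Type*} [NormedAddCommGroup E] [MeasurableSpace E] [BorelSpace E]

lemma mass_toSignedMeasure_sub_of_le {ρ ρ' : Measure E} [IsFiniteMeasure ρ] [IsFiniteMeasure ρ']
    (h : ρ' ≤ ρ) :
    mass (ρ.toSignedMeasure - ρ'.toSignedMeasure) = ρ.real univ - ρ'.real univ := by
  rw [mass, SignedMeasure.totalVariation, Measure.toJordanDecomposition_toSignedMeasure_sub,
    Measure.jordanDecompositionOfToSignedMeasureSub_posPart,
    Measure.jordanDecompositionOfToSignedMeasureSub_negPart, Measure.sub_eq_zero_of_le h, add_zero,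
    Measure.sub_apply MeasurableSet.univ h, ENNReal.toReal_sub_of_le (h univ) (measure_ne_top _ _)]
  rfl

/-- The reward of transporting a unit of mass instead of removing it. -/
def transportReward (E : Type*) [NormedAddCommGroup E] {a b : ℝ} (ha : 0 < a) (hb : 0 < b) :
    E × E →ᵇ ℝ :=
  BoundedContinuousFunction.ofNormedAddCommGroup (fun p => max 0 (2 * a - b * dist p.1 p.2))
    (by fun_prop) (2 * a) fun p => by
      rw [Real.norm_eq_abs, abs_of_nonneg (le_max_left _ _)]
      have : 0 ≤ b * dist p.1 p.2 := by positivity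
      exact max_le (by positivity) (by linarith)

lemma transportReward_apply {a b : ℝ} (ha : 0 < a) (hb : 0 < b) (p : E × E) :
    transportReward E ha hb p = max 0 (2 * a - b * dist p.1 p.2) := rfl

variable [SecondCountableTopology E]

/-- Removing everything costs `a (|μ⁺| + |μ⁻|)`; transporting a unit of mass over distance `r`
instead saves `2a - b r`. Only the part of `π` where this saving is nonnegative is kept. There the
distance is at most `2a/b`, so the transport cost is finite, and off it the reward vanishes, so the
total saving is the integral of the reward against all of `π`. -/
lemma gwNorm_le_of_partial_plan {a b : ℝ} (ha : 0 < a) (hb : 0 < b) (μ : SignedMeasure E)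
    (π : Measure (E × E)) (h₁ : π.fst ≤ jordanPos μ) (h₂ : π.snd ≤ jordanNeg μ) :
    gwNorm a b μ ≤ a * ((jordanPos μ : Measure E).real univ + (jordanNeg μ : Measure E).real univ)
      - ∫ p, transportReward E ha hb p ∂π := by
  have hπ : IsFiniteMeasure π := ⟨by
    rw [← Measure.fst_univ]; exact (h₁ univ).trans_lt (measure_lt_top _ univ)⟩
  set S : Set (E × E) := {p | b * dist p.1 p.2 ≤ 2 * a} with hS
  have hSm : MeasurableSet S := (isClosed_le (by fun_prop) (by fun_prop)).measurableSet
  set π' := π.restrict S with hπ'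
  have h₁' : π'.fst ≤ jordanPos μ :=
    (Measure.map_mono Measure.restrict_le_self measurable_fst).trans h₁
  have h₂' : π'.snd ≤ jordanNeg μ :=
    (Measure.map_mono Measure.restrict_le_self measurable_snd).trans h₂
  let ρ : FiniteMeasure E := ⟨π'.fst, inferInstance⟩
  let σ : FiniteMeasure E := ⟨π'.snd, inferInstance⟩
  have hmass : ρ.mass = σ.mass := by
    rw [FiniteMeasure.mass, FiniteMeasure.mass]
    change (π'.fst univ).toNNReal = (π'.snd univ).toNNReal
    rw [Measure.fst_univ, Measure.snd_univ]
  have hd : Integrable (fun p : E × E => dist p.1 p.2) π' := by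
    refine Integrable.of_bound continuous_dist.aestronglyMeasurable (2 * a / b) ?_
    refine (ae_restrict_iff' hSm).2 (Eventually.of_forall fun p hp => ?_)
    rw [Real.norm_eq_abs, abs_of_nonneg dist_nonneg, le_div_iff₀ hb, mul_comm]
    exact hp
  have hW : wasserstein ρ σ ≤ ENNReal.ofReal (∫ p, dist p.1 p.2 ∂π') := by
    refine (iInf₂_le π' ⟨rfl, rfl⟩).trans (le_of_eq ?_)
    rw [ofReal_integral_eq_lintegral_ofReal hd (Eventually.of_forall fun p => dist_nonneg)]
    exact lintegral_congr fun p => edist_dist _ _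
  have hreward : ∫ p, transportReward E ha hb p ∂π =
      2 * a * π'.real univ - b * ∫ p, dist p.1 p.2 ∂π' := by
    have e1 : ∫ p, transportReward E ha hb p ∂π = ∫ p in S, transportReward E ha hb p ∂π := by
      rw [setIntegral_eq_integral_of_forall_compl_eq_zero fun p hp => ?_]
      rw [transportReward_apply]
      exact max_eq_left (by have := not_le.1 (show ¬ b * dist p.1 p.2 ≤ 2 * a from hp); linarith)
    have e2 : ∫ p in S, transportReward E ha hb p ∂π =
        ∫ p in S, (2 * a - b * dist p.1 p.2) ∂π :=
      setIntegral_congr_fun hSm fun p hp => by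
        rw [transportReward_apply]
        exact max_eq_right (by have : b * dist p.1 p.2 ≤ 2 * a := hp; linarith)
    rw [e1, e2, integral_sub (integrable_const _) (hd.const_mul b), integral_const_mul b,
      integral_const, smul_eq_mul, mul_comm _ (2 * a)]
  have hcost : removalTransportCost a b (jordanPos μ) (jordanNeg μ) ρ σ ≤ ENNReal.ofReal
      (a * ((jordanPos μ : Measure E).real univ + (jordanNeg μ : Measure E).real univ)
        - ∫ p, transportReward E ha hb p ∂π) := by
    have e1 : mass ((jordanPos μ : Measure E).toSignedMeasure - (ρ : Measure E).toSignedMeasure) =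
        (jordanPos μ : Measure E).real univ - π'.real univ := by
      rw [mass_toSignedMeasure_sub_of_le (ρ' := (ρ : Measure E)) h₁']
      change _ - π'.fst.real univ = _
      rw [measureReal_def π'.fst, Measure.fst_univ, measureReal_def π']
    have e2 : mass ((jordanNeg μ : Measure E).toSignedMeasure - (σ : Measure E).toSignedMeasure) =
        (jordanNeg μ : Measure E).real univ - π'.real univ := by
      rw [mass_toSignedMeasure_sub_of_le (ρ' := (σ : Measure E)) h₂']
      change _ - π'.snd.real univ = _
      rw [measureReal_def π'.snd, Measure.snd_univ, measureReal_def π']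
    rw [removalTransportCost, ← ofReal_mass, ← ofReal_mass,
      ← ENNReal.ofReal_add (mass_nonneg _) (mass_nonneg _), ← ENNReal.ofReal_mul ha.le, e1, e2,
      hreward]
    refine (add_le_add le_rfl (mul_le_mul_right hW _)).trans ?_
    rw [← ENNReal.ofReal_mul hb.le, ← ENNReal.ofReal_add]
    · refine ENNReal.ofReal_le_ofReal (le_of_eq ?_)
      ring
    · rw [← e1, ← e2]
      exact mul_nonneg ha.le (add_nonneg (mass_nonneg _) (mass_nonneg _))
    · exact mul_nonneg hb.le (integral_nonneg fun p => dist_nonneg)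
  have hnn : 0 ≤ a * ((jordanPos μ : Measure E).real univ + (jordanNeg μ : Measure E).real univ)
        - ∫ p, transportReward E ha hb p ∂π := by
    rw [hreward]
    have i1 : π'.real univ ≤ (jordanPos μ : Measure E).real univ := by
      rw [measureReal_def, measureReal_def, ← Measure.fst_univ]
      exact ENNReal.toReal_mono (measure_ne_top _ _) (h₁' univ)
    have i2 : π'.real univ ≤ (jordanNeg μ : Measure E).real univ := by
      rw [measureReal_def, measureReal_def, ← Measure.snd_univ]
      exact ENNReal.toReal_mono (measure_ne_top _ _) (h₂' univ)
    have i3 : 0 ≤ b * ∫ p, dist p.1 p.2 ∂π' :=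
      mul_nonneg hb.le (integral_nonneg fun p => dist_nonneg)
    nlinarith
  rw [gwNorm, genWasserstein]
  refine ENNReal.toReal_le_of_le_ofReal hnn ?_
  exact (iInf_le_of_le ρ (iInf_le_of_le σ (iInf_le_of_le hmass le_rfl))).trans hcost

/-- The function is the inf-convolution of `ψ - a` with `b * dist`, truncated above at `a`.
Inf-convolution makes it `b`-Lipschitz, `ψ ≥ 0` keeps it above `-a`, the constraint on `φ` and `ψ`
keeps it above `a - φ`, and the choice `y = x` gives the upper bound. Thus a dual pair is replaced
by a single admissible function. -/
lemma exists_BL_between {a b : ℝ} (ha : 0 < a) (hb : 0 < b) (φ ψ : E → ℝ) (hφ : ∀ x, 0 ≤ φ x)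
    (hψ : ∀ y, 0 ≤ ψ y) (h : ∀ x y, 2 * a - b * dist x y ≤ φ x + ψ y) :
    ∃ g : E → ℝ, BL a b g ∧ (∀ x, a - φ x ≤ g x) ∧ ∀ x, g x ≤ ψ x - a := by
  have hbdd : ∀ x, BddBelow (range fun y => b * dist x y + ψ y - a) := fun x => ⟨-a, by
    rintro _ ⟨y, rfl⟩
    have := hψ y
    have : 0 ≤ b * dist x y := by positivity
    dsimp only
    linarith⟩
  set u : E → ℝ := fun x => ⨅ y, (b * dist x y + ψ y - a) with hu
  have hlip : ∀ x x', u x ≤ u x' + b * dist x x' := fun x x' => by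
    rw [← sub_le_iff_le_add]
    refine le_ciInf fun y => ?_
    have h1 := ciInf_le (hbdd x) y
    have h2 : b * dist x y ≤ b * (dist x x' + dist x' y) := by gcongr; exact dist_triangle _ _ _
    linarith
  have hlow : ∀ x, -a ≤ u x := fun x => le_ciInf fun y => by
    have := hψ y
    have : 0 ≤ b * dist x y := by positivity
    linarith
  refine ⟨fun x => min a (u x), ⟨fun x => abs_le.2 ⟨le_min (by linarith) (hlow x),
    min_le_left _ _⟩, fun x y => ?_⟩, fun x => le_min (by linarith [hφ x]) (le_ciInf fun y => ?_),
    fun x => (min_le_right _ _).trans ?_⟩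
  · refine (abs_min_sub_min_le_max a (u x) a (u y)).trans ?_
    rw [sub_self, abs_zero, ← dist_eq_norm]
    refine max_le (by positivity) (abs_le.2 ⟨?_, ?_⟩)
    · have := hlip y x
      rw [dist_comm] at this
      linarith
    · linarith [hlip x y]
  · linarith [h x y]
  · have := ciInf_le (hbdd x) x
    simpa using this

/-- Strong duality. -/
theorem gwNorm_le_of_forall_BL [ProperSpace E] {a b : ℝ} (ha : 0 < a) (hb : 0 < b)
    (μ : SignedMeasure E) {c : ℝ} (h : ∀ f : E → ℝ, BL a b f → pairing μ f ≤ c) :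
    gwNorm a b μ ≤ c := by
  obtain ⟨π, h₁, h₂, h₃⟩ := exists_partial_plan (jordanPos μ : Measure E) (jordanNeg μ : Measure E)
    (transportReward E ha hb) fun p => le_max_left _ _
  refine (gwNorm_le_of_partial_plan ha hb μ π h₁ h₂).trans ?_
  rw [sub_le_comm]
  refine le_trans ?_ h₃
  -- It remains to bound every dual value below by `a (|μ⁺| + |μ⁻|) - c`: the function `g` lying
  -- between `a - φ` and `ψ - a` has pairing at most `c`.
  refine le_csInf (dualValues_nonempty _ _ _) ?_
  rintro r ⟨φ, ψ, hφ, hψ, hle, rfl⟩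
  obtain ⟨g, hg, hg1, hg2⟩ := exists_BL_between ha hb φ ψ hφ hψ fun x y =>
    (le_max_right _ _).trans (hle x y)
  have hp := h g hg
  rw [pairing_eq μ hg.isBC] at hp
  have i1 : ∫ x, (a - φ x) ∂(jordanPos μ : Measure E) ≤ ∫ x, g x ∂(jordanPos μ : Measure E) :=
    integral_mono ((integrable_const a).sub (φ.integrable _)) (hg.isBC.integrable _) hg1
  have i2 : ∫ x, g x ∂(jordanNeg μ : Measure E) ≤ ∫ x, (ψ x - a) ∂(jordanNeg μ : Measure E) :=
    integral_mono (hg.isBC.integrable _) ((ψ.integrable _).sub (integrable_const a)) hg2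
  rw [integral_sub (integrable_const a) (φ.integrable _), integral_const, smul_eq_mul] at i1
  rw [integral_sub (ψ.integrable _) (integrable_const a), integral_const, smul_eq_mul] at i2
  linarith

end StrongDuality

/-! ### Smoothing of bounded Lipschitz maps -/

section Mollification

open scoped Convolution

variable {E : Type*} [NormedAddCommGroup E] [NormedSpace ℝ E] [FiniteDimensional ℝ E]
  [MeasurableSpace E] [BorelSpace E]
variable {F : Type*} [NormedAddCommGroup F] [NormedSpace ℝ F] [CompleteSpace F]

lemma norm_convolution_sub_le {G H : Type*} [NormedAddCommGroup G] [NormedSpace ℝ G]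
    [NormedAddCommGroup H] [NormedSpace ℝ H]
    (B : G →L[ℝ] F →L[ℝ] H) {k : E → G} (hk : Continuous k) (hks : HasCompactSupport k)
    {w : E → F} (hw : Continuous w) {Λ : ℝ} (hlip : ∀ x y, ‖w x - w y‖ ≤ Λ * ‖x - y‖) (x y : E) :
    ‖(k ⋆[B, Measure.addHaar] w) x - (k ⋆[B, Measure.addHaar] w) y‖ ≤
      (‖B‖ * ∫ t, ‖k t‖ ∂(Measure.addHaar : Measure E)) * (Λ * ‖x - y‖) := by
  have hint : ∀ z, Integrable (fun t => B (k t) (w (z - t))) Measure.addHaar := fun z =>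
    HasCompactSupport.convolutionExists_left B hks hk hw.locallyIntegrable z
  have hkint : Integrable (fun t => ‖k t‖) (Measure.addHaar : Measure E) :=
    (hk.integrable_of_hasCompactSupport hks).norm
  rw [convolution_def, convolution_def, ← integral_sub (hint x) (hint y)]
  calc ‖∫ t, (B (k t) (w (x - t)) - B (k t) (w (y - t))) ∂Measure.addHaar‖
      ≤ ∫ t, ‖B‖ * ‖k t‖ * (Λ * ‖x - y‖) ∂Measure.addHaar := by
        refine norm_integral_le_of_norm_le ((hkint.const_mul _).mul_const _)
          (Eventually.of_forall fun t => ?_)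
        rw [← map_sub]
        refine (B.le_opNorm₂ _ _).trans ?_
        have := hlip (x - t) (y - t)
        rw [sub_sub_sub_cancel_right] at this
        gcongr
    _ = _ := by rw [integral_mul_const, integral_const_mul]

/-- A smooth nonnegative kernel supported in the unit ball, with integral one. -/
def unitKernel (E : Type*) [NormedAddCommGroup E] [NormedSpace ℝ E] [FiniteDimensional ℝ E]
    [MeasurableSpace E] [BorelSpace E] : E → ℝ :=
  ContDiffBump.normed (⟨1 / 2, 1, by norm_num, by norm_num⟩ : ContDiffBump (0 : E))
    Measure.addHaar

lemma unitKernel_contDiff : ContDiff ℝ ∞ (unitKernel E) := ContDiffBump.contDiff_normed _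

lemma unitKernel_hasCompactSupport : HasCompactSupport (unitKernel E) :=
  ContDiffBump.hasCompactSupport_normed _

lemma unitKernel_nonneg (x : E) : 0 ≤ unitKernel E x := ContDiffBump.nonneg_normed _ x

lemma unitKernel_integral : ∫ x, unitKernel E x ∂Measure.addHaar = 1 :=
  ContDiffBump.integral_normed _

lemma unitKernel_support : Function.support (unitKernel E) = Metric.ball 0 1 :=
  ContDiffBump.support_normed_eq _

/-- Convolution with the unit kernel. -/
def mollify (w : E → F) : E → F :=
  unitKernel E ⋆[ContinuousLinearMap.lsmul ℝ ℝ, Measure.addHaar] w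

lemma mollify_contDiff {w : E → F} (hw : Continuous w) : ContDiff ℝ ∞ (mollify w) :=
  unitKernel_hasCompactSupport.contDiff_convolution_left _ unitKernel_contDiff
    hw.locallyIntegrable

lemma dist_mollify_le {w : E → F} (hw : Continuous w) {x : E} {z : F} {δ : ℝ} (hδ : 0 ≤ δ)
    (h : ∀ y ∈ Metric.ball x 1, dist (w y) z ≤ δ) : dist (mollify w x) z ≤ δ :=
  dist_convolution_le hδ unitKernel_support.subset unitKernel_nonneg unitKernel_integral
    hw.aestronglyMeasurable h

lemma norm_mollify_sub_le {w : E → F} (hw : Continuous w) {Λ : ℝ} (hΛ : 0 ≤ Λ)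
    (hlip : ∀ x y, ‖w x - w y‖ ≤ Λ * ‖x - y‖) (x y : E) :
    ‖mollify w x - mollify w y‖ ≤ Λ * ‖x - y‖ := by
  refine (norm_convolution_sub_le (ContinuousLinearMap.lsmul ℝ ℝ)
    unitKernel_contDiff.continuous unitKernel_hasCompactSupport hw hlip x y).trans ?_
  have h1 : ∫ t, ‖unitKernel E t‖ ∂Measure.addHaar = 1 := by
    rw [← unitKernel_integral (E := E)]
    exact integral_congr_ae (Eventually.of_forall fun t =>
      Real.norm_of_nonneg (unitKernel_nonneg t))
  rw [h1, mul_one]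
  exact mul_le_of_le_one_left (by positivity) ContinuousLinearMap.opNorm_lsmul_le

-- The derivative falls on the kernel, so a Lipschitz bound on `w` already controls the variation of
-- the derivative of its mollification. The constant depends only on the spaces.
set_option maxSynthPendingDepth 3 in
lemma exists_norm_fderiv_mollify_sub_le (E F : Type*) [NormedAddCommGroup E] [NormedSpace ℝ E]
    [FiniteDimensional ℝ E] [MeasurableSpace E] [BorelSpace E]
    [NormedAddCommGroup F] [NormedSpace ℝ F] [CompleteSpace F] :
    ∃ c : ℝ, 0 ≤ c ∧ ∀ (w : E → F) (Λ : ℝ), Continuous w →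
      (∀ x y, ‖w x - w y‖ ≤ Λ * ‖x - y‖) → ∀ x y,
      ‖fderiv ℝ (mollify w) x - fderiv ℝ (mollify w) y‖ ≤ c * (Λ * ‖x - y‖) := by
  refine ⟨‖(ContinuousLinearMap.lsmul ℝ ℝ : ℝ →L[ℝ] F →L[ℝ] F).precompL E‖ *
    ∫ t, ‖fderiv ℝ (unitKernel E) t‖ ∂Measure.addHaar, by positivity, fun w Λ hw hlip x y => ?_⟩
  have hd : ∀ x, fderiv ℝ (mollify w) x = (fderiv ℝ (unitKernel E)
      ⋆[(ContinuousLinearMap.lsmul ℝ ℝ : ℝ →L[ℝ] F →L[ℝ] F).precompL E, Measure.addHaar] w) x :=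
    fun x => (unitKernel_hasCompactSupport.hasFDerivAt_convolution_left _
      (unitKernel_contDiff.of_le (by norm_cast)) hw.locallyIntegrable x).fderiv
  rw [hd, hd]
  exact norm_convolution_sub_le _ (unitKernel_contDiff.continuous_fderiv (by simp))
    (unitKernel_hasCompactSupport.fderiv ℝ) hw hlip x y

/-- Smooth approximation at scale `ε` of a bounded Lipschitz map. -/
structure IsSmoothApprox (c L M ε : ℝ) (w W : E → F) : Prop where
  contDiff : ContDiff ℝ ∞ W
  bound : ∀ x, ‖W x‖ ≤ M
  fderiv_bound : ∀ x, ‖fderiv ℝ W x‖ ≤ L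
  fderiv_lip : ∀ x y, ‖fderiv ℝ W x - fderiv ℝ W y‖ ≤ c * L / ε * ‖x - y‖
  close : ∀ x, ‖W x - w x‖ ≤ L * ε
  support : ∀ r, (∀ x, r ≤ ‖x‖ → w x = 0) → ∀ x, r + ε ≤ ‖x‖ → W x = 0

lemma continuous_of_lip {w : E → F} {L : ℝ} (hlip : ∀ x y, ‖w x - w y‖ ≤ L * ‖x - y‖) :
    Continuous w := by
  have : LipschitzWith (Real.toNNReal L) w := LipschitzWith.of_dist_le_mul fun x y => by
    rw [dist_eq_norm, dist_eq_norm]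
    exact (hlip x y).trans
      (mul_le_mul_of_nonneg_right (Real.le_coe_toNNReal L) (norm_nonneg _))
  exact this.continuous

/-- Conjugating the unit-scale mollification by the dilation of factor `ε` preserves the Lipschitz
constant `L`. It multiplies displacements by `ε`, whence closeness `L ε`, and divides the Lipschitz
constant of the derivative by `ε`. -/
lemma exists_isSmoothApprox (E F : Type*) [NormedAddCommGroup E] [NormedSpace ℝ E]
    [FiniteDimensional ℝ E] [NormedAddCommGroup F] [NormedSpace ℝ F] [CompleteSpace F] :
    ∃ c : ℝ, 0 ≤ c ∧ ∀ (w : E → F) (L M ε : ℝ), 0 < ε → 0 ≤ L →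
      (∀ x, ‖w x‖ ≤ M) → (∀ x y, ‖w x - w y‖ ≤ L * ‖x - y‖) →
      ∃ W : E → F, IsSmoothApprox c L M ε w W := by
  borelize E
  obtain ⟨c, hc, hcw⟩ := exists_norm_fderiv_mollify_sub_le E F
  refine ⟨c, hc, fun w L M ε hε hL hM hlip => ?_⟩
  set u : E → F := fun y => ε⁻¹ • w (ε • y) with hu
  have hw : Continuous w := continuous_of_lip hlip
  have huc : Continuous u := by fun_prop
  have hulip : ∀ x y, ‖u x - u y‖ ≤ L * ‖x - y‖ := fun x y => by
    rw [hu, ← smul_sub, norm_smul, Real.norm_of_nonneg (inv_nonneg.2 hε.le),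
      inv_mul_le_iff₀ hε]
    refine (hlip _ _).trans (le_of_eq ?_)
    rw [← smul_sub, norm_smul, Real.norm_of_nonneg hε.le]
    ring
  have hM0 : 0 ≤ M := (norm_nonneg _).trans (hM 0)
  set W : E → F := fun x => ε • mollify u (ε⁻¹ • x) with hW
  have hWd : ∀ x, HasFDerivAt W (fderiv ℝ (mollify u) (ε⁻¹ • x)) x := fun x => by
    have h1 : HasFDerivAt (mollify u) (fderiv ℝ (mollify u) (ε⁻¹ • x)) (ε⁻¹ • x) :=
      ((mollify_contDiff huc).differentiable (by simp) _).hasFDerivAt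
    have h2 : HasFDerivAt (fun x : E => ε⁻¹ • x) (ε⁻¹ • ContinuousLinearMap.id ℝ E) x :=
      (hasFDerivAt_id x).const_smul ε⁻¹
    have h3 := (h1.comp x h2).const_smul ε
    refine h3.congr_fderiv ?_
    ext z
    simp [smul_smul, hε.ne']
  have hWu : ∀ x, fderiv ℝ W x = fderiv ℝ (mollify u) (ε⁻¹ • x) := fun x => (hWd x).fderiv
  refine ⟨W, ⟨?_, fun x => ?_, fun x => ?_, fun x y => ?_, fun x => ?_, fun r hr x hx => ?_⟩⟩
  · exact ((mollify_contDiff huc).comp (contDiff_const_smul ε⁻¹)).const_smul ε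
  · have := dist_mollify_le huc (x := ε⁻¹ • x) (z := 0) (δ := ε⁻¹ * M) (by positivity)
      fun y _ => by
        rw [dist_zero_right, hu, norm_smul, Real.norm_of_nonneg (inv_nonneg.2 hε.le)]
        gcongr
        exact hM _
    rw [dist_zero_right, le_inv_mul_iff₀ hε] at this
    rw [hW, norm_smul, Real.norm_of_nonneg hε.le]
    exact this
  · rw [hWu]
    refine norm_fderiv_le_of_lip' ℝ hL (Eventually.of_forall fun y => ?_)
    exact norm_mollify_sub_le huc hL hulip _ _
  · rw [hWu, hWu]
    refine (hcw u L huc hulip _ _).trans (le_of_eq ?_)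
    rw [← smul_sub, norm_smul, Real.norm_of_nonneg (inv_nonneg.2 hε.le)]
    ring
  · have := dist_mollify_le huc (x := ε⁻¹ • x) (z := u (ε⁻¹ • x)) (δ := L) hL fun y hy => by
      rw [dist_eq_norm]
      refine (hulip _ _).trans (mul_le_of_le_one_right hL ?_)
      rw [← dist_eq_norm]
      exact (Metric.mem_ball.1 hy).le
    have e : W x - w x = ε • (mollify u (ε⁻¹ • x) - u (ε⁻¹ • x)) := by
      have e' : u (ε⁻¹ • x) = ε⁻¹ • w x := by simp [hu, smul_smul, hε.ne']
      rw [smul_sub, e', smul_inv_smul₀ hε.ne']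
    rw [e, norm_smul, Real.norm_of_nonneg hε.le, mul_comm, ← dist_eq_norm]
    gcongr
  · have := dist_mollify_le huc (x := ε⁻¹ • x) (z := 0) (δ := 0) le_rfl fun y hy => by
      rw [dist_zero_right, hu]
      dsimp only
      rw [hr, smul_zero, norm_zero]
      rw [Metric.mem_ball, dist_eq_norm] at hy
      have h1 : ‖ε • y - x‖ ≤ ε := by
        have : ε • y - x = ε • (y - ε⁻¹ • x) := by simp [smul_sub, smul_smul, hε.ne']
        rw [this, norm_smul, Real.norm_of_nonneg hε.le]
        exact mul_le_of_le_one_right hε.le hy.le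
      have h2 := norm_sub_norm_le x (ε • y)
      rw [norm_sub_rev] at h2
      linarith
    rw [dist_le_zero] at this
    rw [hW]
    dsimp only
    rw [this, smul_zero]

end Mollification

/-! ### Reduction of the duality to smooth compactly supported functions -/

section SmoothDuality

variable {E : Type*} [NormedAddCommGroup E] [NormedSpace ℝ E] [FiniteDimensional ℝ E]

/-- Smooth compactly supported test functions. -/
def IsTest (φ : E → ℝ) : Prop := ContDiff ℝ ∞ φ ∧ HasCompactSupport φ

lemma hasCompactSupport_of_norm {φ : E → ℝ} {r : ℝ} (h : ∀ x, r ≤ ‖x‖ → φ x = 0) :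
    HasCompactSupport φ :=
  HasCompactSupport.intro (isCompact_closedBall (0 : E) r) fun x hx => h x (by
    rw [mem_closedBall_zero_iff, not_le] at hx
    exact hx.le)

lemma lip_of_norm_fderiv_le {F : Type*} [NormedAddCommGroup F] [NormedSpace ℝ F] {φ : E → F}
    (hφ : Differentiable ℝ φ) {Λ : ℝ} (h : ∀ x, ‖fderiv ℝ φ x‖ ≤ Λ) (x y : E) :
    ‖φ x - φ y‖ ≤ Λ * ‖x - y‖ :=
  convex_univ.norm_image_sub_le_of_norm_fderiv_le (fun z _ => hφ z) (fun z _ => h z)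
    (mem_univ y) (mem_univ x)

/-- Bounded Lipschitz functions are boundedly approximated by test functions. -/
lemma exists_test_seq {a b : ℝ} (hb : 0 < b) {f : E → ℝ} (hf : BL a b f) :
    ∃ φ : ℕ → E → ℝ, (∀ n, IsTest (φ n) ∧ BL a b (φ n)) ∧
      ∀ x, Tendsto (fun n => φ n x) atTop (𝓝 (f x)) := by
  obtain ⟨c, -, hc⟩ := exists_isSmoothApprox E ℝ
  -- The cut-off clamps `f` between `-g n` and `g n`, where `g n` is a cone of slope `b`.
  -- Multiplication by a cut-off would increase the Lipschitz constant; clamping preserves both `a`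
  -- and `b`, and leaves `f` unchanged where `g n ≥ a`.
  let g : ℕ → E → ℝ := fun n x => max 0 (b * (n - ‖x‖))
  let T : ℕ → E → ℝ := fun n x => max (-(g n x)) (min (f x) (g n x))
  have hg0 : ∀ n x, 0 ≤ g n x := fun n x => le_max_left _ _
  have hglip : ∀ n x y, |g n x - g n y| ≤ b * ‖x - y‖ := fun n x y => by
    refine (abs_max_sub_max_le_max _ _ _ _).trans ?_
    rw [sub_self, abs_zero, ← mul_sub, abs_mul, abs_of_pos hb]
    refine max_le (by positivity) ?_
    gcongr
    rw [sub_sub_sub_cancel_left, abs_sub_comm]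
    exact abs_norm_sub_norm_le x y
  have hTb : ∀ n x, |T n x| ≤ a := fun n x => by
    have h1 := abs_le.1 (hf.bound x)
    have h2 := hg0 n x
    refine abs_le.2 ⟨?_, ?_⟩
    · rcases le_total (f x) (g n x) with h | h
      · exact le_max_of_le_right (by rw [min_eq_left h]; exact h1.1)
      · exact le_max_of_le_right (by rw [min_eq_right h]; linarith)
    · exact max_le (by linarith) ((min_le_left _ _).trans h1.2)
  have hTlip : ∀ n x y, |T n x - T n y| ≤ b * ‖x - y‖ := fun n x y => by
    refine (abs_max_sub_max_le_max _ _ _ _).trans (max_le ?_ ?_)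
    · rw [neg_sub_neg, abs_sub_comm]; exact hglip n x y
    · exact (abs_min_sub_min_le_max _ _ _ _).trans (max_le (hf.lip x y) (hglip n x y))
  have hTs : ∀ (n : ℕ) x, (n : ℝ) ≤ ‖x‖ → T n x = 0 := fun n x hx => by
    have : g n x = 0 := max_eq_left (by nlinarith)
    simp only [T, this]
    simp
  have hTe : ∀ (n : ℕ) x, a / b + ‖x‖ ≤ n → T n x = f x := fun n x hx => by
    have h1 := abs_le.1 (hf.bound x)
    have h2 : a ≤ g n x := le_max_of_le_right (by
      have : a / b ≤ n - ‖x‖ := by linarith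
      rw [div_le_iff₀ hb] at this
      linarith)
    simp only [T]
    rw [min_eq_left (by linarith), max_eq_right (by linarith)]
  choose φ hφ using fun n : ℕ => hc (T n) b a (1 / ((n : ℝ) + 1)) (by positivity) hb.le (hTb n)
    (hTlip n)
  refine ⟨φ, fun n => ⟨⟨(hφ n).contDiff, hasCompactSupport_of_norm ((hφ n).support n (hTs n))⟩,
    (hφ n).bound, fun x y => ?_⟩, fun x => ?_⟩
  · exact lip_of_norm_fderiv_le ((hφ n).contDiff.differentiable (by simp)) (hφ n).fderiv_bound x y
  · have hlim : Tendsto (fun n : ℕ => b * (1 / ((n : ℝ) + 1))) atTop (𝓝 0) := by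
      simpa using tendsto_one_div_add_atTop_nhds_zero_nat.const_mul b
    rw [tendsto_iff_norm_sub_tendsto_zero]
    refine squeeze_zero' (Eventually.of_forall fun n => norm_nonneg _) ?_ hlim
    obtain ⟨N, hN⟩ := exists_nat_ge (a / b + ‖x‖)
    filter_upwards [eventually_ge_atTop N] with n hn
    have : (N : ℝ) ≤ n := by exact_mod_cast hn
    rw [← hTe n x (by linarith)]
    exact (hφ n).close x

variable [MeasurableSpace E] [BorelSpace E]

/-- Strong duality with smooth compactly supported functions. -/
theorem gwNorm_le_of_forall_test {a b : ℝ} (ha : 0 < a) (hb : 0 < b)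
    (μ : SignedMeasure E) {c : ℝ} (h : ∀ φ : E → ℝ, IsTest φ → BL a b φ → pairing μ φ ≤ c) :
    gwNorm a b μ ≤ c := by
  have : ProperSpace E := FiniteDimensional.proper ℝ E
  refine gwNorm_le_of_forall_BL ha hb μ fun f hf => ?_
  obtain ⟨φ, hφ, hlim⟩ := exists_test_seq hb hf
  exact le_of_tendsto' (tendsto_pairing_of_dominated μ a (fun n => (hφ n).1.1.continuous)
    (fun n => (hφ n).2.bound) hlim) fun n => h _ (hφ n).1 (hφ n).2

end SmoothDuality

/-! ### Mass and support seen by test functions -/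

section TotalVariation

variable {E : Type*} [NormedAddCommGroup E] [NormedSpace ℝ E] [FiniteDimensional ℝ E]

lemma exists_smooth_bump {K U : Set E} (hK : IsCompact K) (hU : IsOpen U) (hKU : K ⊆ U) :
    ∃ f : E → ℝ, IsTest f ∧ (∀ x ∈ K, f x = 1) ∧ (∀ x, 0 ≤ f x) ∧ (∀ x, f x ≤ 1) ∧
      ∀ x ∉ U, f x = 0 := by
  have : ProperSpace E := FiniteDimensional.proper ℝ E
  obtain ⟨r, hr⟩ := hK.isBounded.subset_ball 0
  obtain ⟨f, h0, h1, hf⟩ := exists_contMDiffMap_zero_one_of_isClosed (n := (⊤ : ℕ∞))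
    (modelWithCornersSelf ℝ E) (s := (U ∩ Metric.ball 0 r)ᶜ) (t := K)
    (hU.inter Metric.isOpen_ball).isClosed_compl hK.isClosed
    (disjoint_compl_left_iff_subset.2 (subset_inter hKU hr))
  refine ⟨f, ⟨contMDiff_iff_contDiff.1 f.contMDiff, hasCompactSupport_of_norm (r := r)
    fun x hx => h0 fun h => ?_⟩, fun x hx => h1 hx, fun x => (hf x).1, fun x => (hf x).2,
    fun x hx => h0 fun h => hx h.1⟩
  exact absurd (mem_ball_zero_iff.1 h.2) (not_lt.2 hx)

lemma IsTest.sub {f g : E → ℝ} (hf : IsTest f) (hg : IsTest g) : IsTest (fun x => f x - g x) :=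
  ⟨hf.1.sub hg.1, by
    simp only [sub_eq_add_neg]
    exact hf.2.add hg.2.neg⟩

lemma IsTest.isBC {f : E → ℝ} (hf : IsTest f) : IsBC f :=
  ⟨hf.1.continuous, hf.2.exists_bound_of_continuous hf.1.continuous⟩

lemma IsTest.exists_fderiv_bound {φ : E → ℝ} (hφ : IsTest φ) :
    ∃ Λ, 0 ≤ Λ ∧ ∀ x, ‖fderiv ℝ φ x‖ ≤ Λ := by
  obtain ⟨Λ, hΛ⟩ := (hφ.2.fderiv ℝ).exists_bound_of_continuous
    (hφ.1.continuous_fderiv (by simp))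
  exact ⟨Λ, (norm_nonneg _).trans (hΛ 0), hΛ⟩

lemma IsTest.exists_BL {φ : E → ℝ} (hφ : IsTest φ) : ∃ B Λ, 0 ≤ Λ ∧ BL B Λ φ := by
  obtain ⟨-, B, hB⟩ := hφ.isBC
  obtain ⟨Λ, h0, hΛ⟩ := hφ.exists_fderiv_bound
  exact ⟨B, Λ, h0, hB, lip_of_norm_fderiv_le (hφ.1.differentiable (by simp)) hΛ⟩

variable [MeasurableSpace E] [BorelSpace E]

/-- The hypotheses amount to the pointwise bound `φ ≥ 2 · 1_K - 1_U`, which is then integrated. -/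
lemma sub_le_integral_of_compact {ν : Measure E} [IsFiniteMeasure ν] {K U : Set E}
    (hK : IsCompact K) (hU : IsOpen U) {φ : E → ℝ} (hφ : IsBC φ) (h1 : ∀ x ∈ K, φ x = 1)
    (h2 : ∀ x, -1 ≤ φ x) (h0 : ∀ x ∉ U, φ x = 0) :
    2 * ν.real K - ν.real U ≤ ∫ x, φ x ∂ν := by
  have iK : Integrable (K.indicator (1 : E → ℝ)) ν :=
    (integrable_const (1 : ℝ)).indicator hK.measurableSet
  have iU : Integrable (U.indicator (1 : E → ℝ)) ν :=
    (integrable_const (1 : ℝ)).indicator hU.measurableSet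
  have h : ∫ x, (2 * K.indicator (1 : E → ℝ) x - U.indicator (1 : E → ℝ) x) ∂ν ≤ ∫ x, φ x ∂ν := by
    refine integral_mono ((iK.const_mul 2).sub iU) (hφ.integrable ν) fun x => ?_
    by_cases hxK : x ∈ K
    · by_cases hxU : x ∈ U
      · simp only [hxK, hxU, indicator_of_mem, Pi.one_apply]
        linarith [h1 x hxK]
      · exact absurd (h1 x hxK) (by rw [h0 x hxU]; norm_num)
    · by_cases hxU : x ∈ U
      · simp only [hxK, hxU, indicator_of_mem, indicator_of_notMem, not_false_eq_true,
          Pi.one_apply]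
        linarith [h2 x]
      · simp [hxK, hxU, h0 x hxU]
  rw [integral_sub (iK.const_mul 2) iU, integral_const_mul,
    integral_indicator_one hK.measurableSet, integral_indicator_one hU.measurableSet] at h
  exact h

/-- The sign function of a Hahn decomposition is approximated: compacts inside the two Hahn pieces
of `U` carry almost all of `μ⁺` and `μ⁻`, and being disjoint they are separated by open sets. The
difference of smooth bumps on these sets is an admissible test function with almost maximal pairing.
-/
lemma totalVariation_real_le_of_forall_test (μ : SignedMeasure E) {U : Set E} (hU : IsOpen U)
    {c : ℝ} (h : ∀ φ : E → ℝ, IsTest φ → (∀ x, |φ x| ≤ 1) → (∀ x ∉ U, φ x = 0) →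
      pairing μ φ ≤ c) : (μ.totalVariation U).toReal ≤ c := by
  have : ProperSpace E := FiniteDimensional.proper ℝ E
  obtain ⟨A, hA, hpA, hnA⟩ := μ.toJordanDecomposition.mutuallySingular
  set p : Measure E := (jordanPos μ : Measure E) with hp
  set n : Measure E := (jordanNeg μ : Measure E) with hn
  have hpA : p A = 0 := hpA
  have hnA : n Aᶜ = 0 := hnA
  have hinner : ∀ (ν : Measure E) [IsFiniteMeasure ν] (S : Set E), MeasurableSet S → ν S = 0 →
      ∀ ε > 0, ∃ K ⊆ U ∩ Sᶜ, IsCompact K ∧ ν.real U ≤ ν.real K + ε := fun ν _ S hS hS0 ε hε => by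
    obtain ⟨K, hKU, hK, hlt⟩ := (hU.measurableSet.inter hS.compl).exists_isCompact_lt_add
      (measure_ne_top ν _) (ε := ENNReal.ofReal ε) (by simpa using hε)
    refine ⟨K, hKU, hK, ?_⟩
    have e1 : ν U = ν (U ∩ Sᶜ) := by
      rw [← sdiff_eq, measure_sdiff_null hS0]
    rw [measureReal_def, measureReal_def, e1, ← ENNReal.toReal_ofReal hε.le,
      ← ENNReal.toReal_add (measure_ne_top _ _) ENNReal.ofReal_ne_top]
    exact ENNReal.toReal_mono (by finiteness) hlt.le
  have htv : (μ.totalVariation U).toReal = p.real U + n.real U := by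
    rw [SignedMeasure.totalVariation, Measure.add_apply,
      ENNReal.toReal_add (measure_ne_top _ _) (measure_ne_top _ _)]
    rfl
  rw [htv]
  refine le_of_forall_pos_le_add fun ε hε => ?_
  obtain ⟨K₁, hK₁U, hK₁, hK₁'⟩ := hinner p A hA hpA (ε / 4) (by positivity)
  obtain ⟨K₂, hK₂U, hK₂, hK₂'⟩ := hinner n Aᶜ hA.compl hnA (ε / 4) (by positivity)
  have hdisj : Disjoint K₁ K₂ := by
    refine Set.disjoint_left.2 fun x h1 h2 => ?_
    exact (hK₂U h2).2 (hK₁U h1).2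
  obtain ⟨V₁, V₂, hV₁, hV₂, hKV₁, hKV₂, hV⟩ := SeparatedNhds.of_isCompact_isCompact hK₁ hK₂ hdisj
  obtain ⟨f, hft, hf1, hf0, hfle, hfU⟩ := exists_smooth_bump hK₁ (hV₁.inter hU)
    (subset_inter hKV₁ fun x hx => (hK₁U hx).1)
  obtain ⟨g, hgt, hg1, hg0, hgle, hgU⟩ := exists_smooth_bump hK₂ (hV₂.inter hU)
    (subset_inter hKV₂ fun x hx => (hK₂U hx).1)
  have hφ := hft.sub hgt
  have hb : ∀ x, |f x - g x| ≤ 1 := fun x => abs_le.2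
    ⟨by linarith [hf0 x, hgle x], by linarith [hg0 x, hfle x]⟩
  have hout : ∀ x ∉ U, f x - g x = 0 := fun x hx => by
    rw [hfU x fun h => hx h.2, hgU x fun h => hx h.2, sub_zero]
  have e0 := h _ hφ hb hout
  rw [pairing_eq μ hφ.isBC] at e0
  have e1 := sub_le_integral_of_compact (ν := p) hK₁ hU hφ.isBC (fun x hx => by
    rw [hf1 x hx, hgU x fun h => Set.disjoint_left.1 hV (hKV₁ hx) h.1, sub_zero])
    (fun x => (abs_le.1 (hb x)).1) hout
  have e2 := sub_le_integral_of_compact (ν := n) hK₂ hU (hgt.sub hft).isBC (fun x hx => by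
    rw [hg1 x hx, hfU x fun h => Set.disjoint_left.1 hV h.1 (hKV₂ hx), sub_zero])
    (fun x => by linarith [(abs_le.1 (hb x)).2]) (fun x hx => by linarith [hout x hx])
  have e3 : ∫ x, (g x - f x) ∂n = - ∫ x, (f x - g x) ∂n := by
    rw [← integral_neg]
    simp only [neg_sub]
  rw [e3] at e2
  linarith

lemma mass_le_of_forall_test (μ : SignedMeasure E) {c : ℝ}
    (h : ∀ φ : E → ℝ, IsTest φ → (∀ x, |φ x| ≤ 1) → pairing μ φ ≤ c) : mass μ ≤ c :=
  totalVariation_real_le_of_forall_test μ isOpen_univ fun φ h1 h2 _ => h φ h1 h2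

lemma eq_zero_of_mass_eq_zero {μ : SignedMeasure E} (h : mass μ ≤ 0) : μ = 0 := by
  ext i hi
  have h0 : μ.totalVariation univ = 0 := by
    rw [← ofReal_mass, ENNReal.ofReal_eq_zero]; exact h
  exact μ.null_of_totalVariation_zero (measure_mono_null (subset_univ i) h0)

lemma supp_subset_of_forall_test (μ : SignedMeasure E) {C : Set E} (hC : IsClosed C)
    (h : ∀ φ : E → ℝ, IsTest φ → (∀ x ∈ C, φ x = 0) → pairing μ φ = 0) : supp μ ⊆ C := by
  refine Measure.support_subset_of_isClosed hC ?_
  have h1 := totalVariation_real_le_of_forall_test (c := 0) μ hC.isOpen_compl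
    fun φ hφ _ h0 => (h φ hφ fun x hx => h0 x fun h => h hx).le
  have h2 : (μ.totalVariation Cᶜ) ≠ ⊤ := by
    rw [SignedMeasure.totalVariation_eq_variation]; exact measure_ne_top _ _
  exact (ENNReal.toReal_eq_zero_iff _).1 (le_antisymm h1 ENNReal.toReal_nonneg) |>.resolve_right h2

lemma pairing_eq_zero_of_supp (μ : SignedMeasure E) {f : E → ℝ} (h : ∀ x ∈ supp μ, f x = 0) :
    pairing μ f = 0 := by
  have : ProperSpace E := FiniteDimensional.proper ℝ E
  refine pairing_eq_zero_of_ae μ ?_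
  filter_upwards [Measure.support_mem_ae (μ := μ.totalVariation)] with x hx using h x hx

end TotalVariation

/-! ### Norm properties read off from duality -/

section Norm

variable {E : Type*} [NormedAddCommGroup E] [NormedSpace ℝ E] [FiniteDimensional ℝ E]
  [MeasurableSpace E] [BorelSpace E] {a b : ℝ}

lemma abs_pairing_le_of_BL (ha : 0 < a) (hb : 0 < b) (μ : SignedMeasure E) {B Λ : ℝ} {f : E → ℝ}
    (hΛ : 0 ≤ Λ) (hf : BL B Λ f) : |pairing μ f| ≤ (B / a + Λ / b) * gwNorm a b μ := by
  have : ProperSpace E := FiniteDimensional.proper ℝ E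
  have hB := hf.bound_nonneg
  refine abs_pairing_le_gwNorm ha hb μ (by positivity) (hf.mono ?_ ?_)
  · rw [add_mul, div_mul_cancel₀ _ ha.ne']
    have : 0 ≤ Λ / b * a := by positivity
    linarith
  · rw [add_mul, div_mul_cancel₀ _ hb.ne']
    have : 0 ≤ B / a * b := by positivity
    linarith

lemma pairing_le_gwNorm_of_BL (ha : 0 < a) (hb : 0 < b) (μ : SignedMeasure E) {f : E → ℝ}
    (hf : BL a b f) : pairing μ f ≤ gwNorm a b μ := by
  have : ProperSpace E := FiniteDimensional.proper ℝ E
  exact pairing_le_gwNorm ha hb μ hf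

lemma gwNorm_le_mass (ha : 0 < a) (hb : 0 < b) (μ : SignedMeasure E) :
    gwNorm a b μ ≤ a * mass μ :=
  gwNorm_le_of_forall_test ha hb μ fun _ _ h =>
    (le_abs_self _).trans (abs_pairing_le μ h.bound)

lemma gwNorm_zero (ha : 0 < a) (hb : 0 < b) : gwNorm a b (0 : SignedMeasure E) = 0 := by
  refine le_antisymm ((gwNorm_le_mass ha hb 0).trans ?_) (gwNorm_nonneg _ _ _)
  rw [mass, SignedMeasure.totalVariation_zero]
  simp

/-- Jordan decompositions do not add up, so the transport definition does not give this directly;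
for a supremum of linear functionals it is immediate. -/
lemma gwNorm_add_le (ha : 0 < a) (hb : 0 < b) (μ ν : SignedMeasure E) :
    gwNorm a b (μ + ν) ≤ gwNorm a b μ + gwNorm a b ν :=
  gwNorm_le_of_forall_test ha hb _ fun φ _ h => by
    rw [pairing_add_measure _ _ h.isBC]
    exact add_le_add (pairing_le_gwNorm_of_BL ha hb μ h) (pairing_le_gwNorm_of_BL ha hb ν h)

lemma gwNorm_neg (ha : 0 < a) (hb : 0 < b) (μ : SignedMeasure E) :
    gwNorm a b (-μ) = gwNorm a b μ := by
  have key : ∀ ν : SignedMeasure E, gwNorm a b (-ν) ≤ gwNorm a b ν := fun ν =>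
    gwNorm_le_of_forall_test ha hb _ fun φ _ h => by
      rw [pairing_neg_measure, ← pairing_neg]
      exact pairing_le_gwNorm_of_BL ha hb ν h.neg
  refine le_antisymm (key μ) ?_
  simpa using key (-μ)

lemma gwNorm_sub_comm (ha : 0 < a) (hb : 0 < b) (μ ν : SignedMeasure E) :
    gwNorm a b (μ - ν) = gwNorm a b (ν - μ) := by
  rw [← gwNorm_neg ha hb, neg_sub]

lemma gwNorm_sub_le (ha : 0 < a) (hb : 0 < b) (μ ν ρ : SignedMeasure E) :
    gwNorm a b (μ - ρ) ≤ gwNorm a b (μ - ν) + gwNorm a b (ν - ρ) := by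
  have := gwNorm_add_le ha hb (μ - ν) (ν - ρ)
  rwa [sub_add_sub_cancel] at this

lemma eq_zero_of_gwNorm_eq_zero (ha : 0 < a) (hb : 0 < b) {μ : SignedMeasure E}
    (h : gwNorm a b μ ≤ 0) : μ = 0 := by
  have h0 : gwNorm a b μ = 0 := le_antisymm h (gwNorm_nonneg _ _ _)
  refine eq_zero_of_mass_eq_zero (mass_le_of_forall_test μ fun φ hφ _ => ?_)
  obtain ⟨B, Λ, hΛ, hBL⟩ := hφ.exists_BL
  have := abs_pairing_le_of_BL ha hb μ hΛ hBL
  rw [h0, mul_zero] at this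
  exact (le_abs_self _).trans this

/-- The pseudometric on signed measures defined by the generalized Wasserstein norm. -/
abbrev gwPseudoMetric (ha : 0 < a) (hb : 0 < b) : PseudoMetricSpace (SignedMeasure E) where
  dist μ ν := gwNorm a b (μ - ν)
  dist_self μ := by rw [sub_self, gwNorm_zero ha hb]
  dist_comm := gwNorm_sub_comm ha hb
  dist_triangle μ ν ρ := gwNorm_sub_le ha hb μ ν ρ

end Norm

/-! ### Vague compactness and convergence of Cauchy sequences of bounded mass -/

section WeakCompactness

open scoped CompactlySupported

variable {E : Type*} [NormedAddCommGroup E] [NormedSpace ℝ E] [FiniteDimensional ℝ E]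
  [MeasurableSpace E] [BorelSpace E]

/-- Along an ultrafilter the bounded integrals converge for all test functions simultaneously, so no
diagonal extraction is needed. The limit functional is positive and linear, and Riesz represents it.
Mass may escape to infinity, but the limit has mass at most `m`. -/
lemma exists_vague_limit (ρ : ℕ → FiniteMeasure E) {m : ℝ}
    (hm : ∀ n, (ρ n : Measure E).real univ ≤ m) :
    ∃ ρ' : FiniteMeasure E, ∀ φ : C_c(E, ℝ), Tendsto (fun n => ∫ x, φ x ∂(ρ n : Measure E))
      (hyperfilter ℕ) (𝓝 (∫ x, φ x ∂(ρ' : Measure E))) := by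
  have : ProperSpace E := FiniteDimensional.proper ℝ E
  have hm0 : 0 ≤ m := measureReal_nonneg.trans (hm 0)
  have hbd : ∀ (φ : C_c(E, ℝ)) (C : ℝ), (∀ x, |φ x| ≤ C) → ∀ n,
      |∫ x, φ x ∂(ρ n : Measure E)| ≤ C * m := fun φ C hC n => by
    have h1 := norm_integral_le_of_norm_le_const (μ := (ρ n : Measure E)) (f := φ) (C := C)
      (Eventually.of_forall hC)
    exact h1.trans (mul_le_mul_of_nonneg_left (hm n) ((abs_nonneg _).trans (hC 0)))
  have hlim : ∀ φ : C_c(E, ℝ), ∃ r, Tendsto (fun n => ∫ x, φ x ∂(ρ n : Measure E))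
      (hyperfilter ℕ) (𝓝 r) := fun φ => by
    obtain ⟨C, hC⟩ := φ.hasCompactSupport.exists_bound_of_continuous φ.continuous
    obtain ⟨r, -, hr⟩ := (isCompact_Icc (a := -(C * m)) (b := C * m)).ultrafilter_le_nhds
      ((hyperfilter ℕ).map fun n => ∫ x, φ x ∂(ρ n : Measure E)) (by
        rw [le_principal_iff]
        exact mem_map.2 (Eventually.of_forall fun n : ℕ => abs_le.1 (hbd φ C hC n)))
    exact ⟨r, hr⟩
  choose Λ hΛ using hlim
  let Λc : C_c(E, ℝ) →ₚ[ℝ] ℝ := PositiveLinearMap.mk₀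
    { toFun := Λ
      map_add' := fun φ ψ => tendsto_nhds_unique (hΛ (φ + ψ)) (by
        refine ((hΛ φ).add (hΛ ψ)).congr fun n => ?_
        exact (integral_add φ.integrable ψ.integrable).symm)
      map_smul' := fun c φ => tendsto_nhds_unique (hΛ (c • φ)) (by
        refine ((hΛ φ).const_mul c).congr fun n => ?_
        exact (integral_const_mul c _).symm) }
    fun φ hφ => ge_of_tendsto' (hΛ φ) fun n => integral_nonneg hφ
  have hfin : IsFiniteMeasure (RealRMK.rieszMeasure Λc) := ⟨by
    refine lt_of_le_of_lt ?_ (ENNReal.ofReal_lt_top (r := m))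
    rw [isOpen_univ.measure_eq_iSup_isCompact]
    refine iSup₂_le fun K _ => iSup_le fun hK => ?_
    obtain ⟨f, hf1, hf0, hfle, -⟩ := exists_compact_bump hK isOpen_univ (subset_univ _)
    refine (RealRMK.rieszMeasure_le_of_eq_one Λc hf0 hK hf1).trans ?_
    refine ENNReal.ofReal_le_ofReal (le_of_tendsto' (hΛ f) fun n => ?_)
    have := hbd f 1 (fun x => by rw [abs_of_nonneg (hf0 x)]; exact hfle x) n
    rw [one_mul] at this
    exact (le_abs_self _).trans this⟩
  refine ⟨⟨RealRMK.rieszMeasure Λc, hfin⟩, fun φ => ?_⟩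
  have h := RealRMK.integral_rieszMeasure Λc φ
  change Tendsto _ _ (𝓝 (∫ x, φ x ∂(RealRMK.rieszMeasure Λc)))
  rw [h]
  exact hΛ φ

lemma jordan_real_le_mass (μ : SignedMeasure E) :
    (jordanPos μ : Measure E).real univ ≤ mass μ ∧ (jordanNeg μ : Measure E).real univ ≤ mass μ := by
  have h : mass μ = (jordanPos μ : Measure E).real univ + (jordanNeg μ : Measure E).real univ := by
    rw [mass, SignedMeasure.totalVariation, Measure.add_apply,
      ENNReal.toReal_add (measure_ne_top _ _) (measure_ne_top _ _)]
    rfl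
  constructor
  · linarith [measureReal_nonneg (μ := (jordanNeg μ : Measure E)) (s := univ)]
  · linarith [measureReal_nonneg (μ := (jordanPos μ : Measure E)) (s := univ)]

/-- Sequences of signed measures of bounded mass converge vaguely along the hyperfilter. -/
lemma exists_vague_limit_signed (μ : ℕ → SignedMeasure E) {m : ℝ} (hm : ∀ n, mass (μ n) ≤ m) :
    ∃ ν : SignedMeasure E, ∀ φ : E → ℝ, IsTest φ →
      Tendsto (fun n => pairing (μ n) φ) (hyperfilter ℕ) (𝓝 (pairing ν φ)) := by
  obtain ⟨ρ, hρ⟩ := exists_vague_limit (fun n => jordanPos (μ n))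
    fun n => (jordan_real_le_mass (μ n)).1.trans (hm n)
  obtain ⟨σ, hσ⟩ := exists_vague_limit (fun n => jordanNeg (μ n))
    fun n => (jordan_real_le_mass (μ n)).2.trans (hm n)
  refine ⟨(ρ : Measure E).toSignedMeasure - (σ : Measure E).toSignedMeasure, fun φ hφ => ?_⟩
  rw [pairing_sub_measure _ _ hφ.isBC, pairing_toSignedMeasure, pairing_toSignedMeasure]
  let φc : C_c(E, ℝ) := ⟨⟨φ, hφ.1.continuous⟩, hφ.2⟩
  exact ((hρ φc).sub (hσ φc)).congr fun n => (pairing_eq (μ n) hφ.isBC).symm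

/-- A Cauchy sequence of signed measures of bounded mass converges for the generalized Wasserstein
norm. -/
lemma exists_gwNorm_limit {a b : ℝ} (ha : 0 < a) (hb : 0 < b) (μ : ℕ → SignedMeasure E) {m : ℝ}
    (hm : ∀ n, mass (μ n) ≤ m) {δ : ℕ → ℝ}
    (hδ : ∀ n k, n ≤ k → gwNorm a b (μ n - μ k) ≤ δ n) :
    ∃ ν : SignedMeasure E, ∀ n, gwNorm a b (μ n - ν) ≤ δ n := by
  obtain ⟨ν, hν⟩ := exists_vague_limit_signed μ hm
  refine ⟨ν, fun n => gwNorm_le_of_forall_test ha hb _ fun φ hφ hBL => ?_⟩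
  rw [pairing_sub_measure _ _ hφ.isBC]
  -- The norm is lower semicontinuous under vague convergence because compactly supported test
  -- functions compute it; mass escaping to infinity is therefore harmless.
  refine le_of_tendsto ((hν φ hφ).const_sub (pairing (μ n) φ)) ?_
  have hge : ∀ᶠ k in (hyperfilter ℕ : Filter ℕ), n ≤ k := by
    have := eventually_ge_atTop n
    rw [← Nat.cofinite_eq_atTop] at this
    exact hyperfilter_le_cofinite this
  filter_upwards [hge] with k hk
  rw [← pairing_sub_measure _ _ hφ.isBC]
  exact (pairing_le_gwNorm_of_BL ha hb _ hBL).trans (hδ n k hk)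

end WeakCompactness

/-! ### One step of the Euler scheme -/

section Coefficients

variable {E : Type*} [NormedAddCommGroup E] [NormedSpace ℝ E] [FiniteDimensional ℝ E]

/-- Quantitative bounds on a function and its first derivative. -/
structure C11Bound (B Λ A : ℝ) (φ : E → ℝ) : Prop where
  bound : ∀ x, |φ x| ≤ B
  fderiv_bound : ∀ x, ‖fderiv ℝ φ x‖ ≤ Λ
  fderiv_lip : ∀ x y, ‖fderiv ℝ φ x - fderiv ℝ φ y‖ ≤ A * ‖x - y‖

lemma IsTest.differentiable {φ : E → ℝ} (hφ : IsTest φ) : Differentiable ℝ φ :=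
  hφ.1.differentiable (by simp)

lemma exists_lip_of_contDiff_of_hasCompactSupport {F : Type*} [NormedAddCommGroup F]
    [NormedSpace ℝ F] {g : E → F} (hg : ContDiff ℝ 1 g) (hs : HasCompactSupport g) :
    ∃ A, 0 ≤ A ∧ ∀ x y, ‖g x - g y‖ ≤ A * ‖x - y‖ := by
  obtain ⟨A, hA⟩ := (hs.fderiv ℝ).exists_bound_of_continuous (hg.continuous_fderiv (by simp))
  exact ⟨A, (norm_nonneg _).trans (hA 0), lip_of_norm_fderiv_le (hg.differentiable (by simp)) hA⟩

lemma IsTest.exists_C11Bound {φ : E → ℝ} (hφ : IsTest φ) :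
    ∃ B Λ A, 0 ≤ B ∧ 0 ≤ Λ ∧ 0 ≤ A ∧ C11Bound B Λ A φ := by
  obtain ⟨-, B, hB⟩ := hφ.isBC
  obtain ⟨Λ, h0, hΛ⟩ := hφ.exists_fderiv_bound
  have h1 : ContDiff ℝ 1 (fderiv ℝ φ) := hφ.1.fderiv_right (m := 1) (by norm_cast)
  obtain ⟨A, hA0, hA⟩ := exists_lip_of_contDiff_of_hasCompactSupport h1 (hφ.2.fderiv ℝ)
  exact ⟨B, Λ, A, (abs_nonneg _).trans (hB 0), h0, hA0, hB, hΛ, hA⟩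

lemma C11Bound.toBL {B Λ A : ℝ} {φ : E → ℝ} (h : C11Bound B Λ A φ) (hφ : IsTest φ) : BL B Λ φ :=
  ⟨h.bound, lip_of_norm_fderiv_le hφ.differentiable h.fderiv_bound⟩

lemma C11Bound.taylor {B Λ A : ℝ} {φ : E → ℝ} (h : C11Bound B Λ A φ) (hA : 0 ≤ A) (hφ : IsTest φ)
    (x u : E) : |φ (x + u) - φ x - fderiv ℝ φ x u| ≤ A * ‖u‖ ^ 2 := by
  have := (convex_closedBall x ‖u‖).norm_image_sub_le_of_norm_hasFDerivWithin_le'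
    (f := φ) (f' := fderiv ℝ φ) (φ := fderiv ℝ φ x) (C := A * ‖u‖)
    (fun z _ => (hφ.differentiable z).hasFDerivAt.hasFDerivWithinAt)
    (fun z hz => (h.fderiv_lip z x).trans (by
      rw [Metric.mem_closedBall, dist_eq_norm] at hz
      gcongr)) (Metric.mem_closedBall_self (norm_nonneg u)) (y := x + u) (by simp)
  rw [add_sub_cancel_left] at this
  rw [sq, ← mul_assoc]
  exact this

lemma C11Bound.fderiv_apply_BL {B Λ A L M : ℝ} {φ : E → ℝ} (h : C11Bound B Λ A φ) {w : E → E}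
    (hΛ : 0 ≤ Λ) (hA : 0 ≤ A) (hM : ∀ x, ‖w x‖ ≤ M)
    (hL : ∀ x y, ‖w x - w y‖ ≤ L * ‖x - y‖) :
    BL (Λ * M) (Λ * L + A * M) (fun x => fderiv ℝ φ x (w x)) := by
  refine ⟨fun x => ?_, fun x y => ?_⟩
  · refine ((fderiv ℝ φ x).le_opNorm _).trans ?_
    exact mul_le_mul (h.fderiv_bound x) (hM x) (norm_nonneg _) hΛ
  · have e : fderiv ℝ φ x (w x) - fderiv ℝ φ y (w y) =
        fderiv ℝ φ x (w x - w y) + (fderiv ℝ φ x - fderiv ℝ φ y) (w y) := by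
      rw [map_sub, sub_apply]; ring
    rw [e]
    refine (abs_add_le _ _).trans ?_
    have h1 : |fderiv ℝ φ x (w x - w y)| ≤ Λ * (L * ‖x - y‖) :=
      ((fderiv ℝ φ x).le_opNorm _).trans
        (mul_le_mul (h.fderiv_bound x) (hL x y) (norm_nonneg _) hΛ)
    have h2 : |(fderiv ℝ φ x - fderiv ℝ φ y) (w y)| ≤ A * ‖x - y‖ * M :=
      ((fderiv ℝ φ x - fderiv ℝ φ y).le_opNorm _).trans
        (mul_le_mul (h.fderiv_lip x y) (hM y) (norm_nonneg _) (by positivity))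
    linarith

lemma norm_add_smul_sub_le {w : E → E} {τ L : ℝ} (hτ : 0 ≤ τ)
    (hw : ∀ x y, ‖w x - w y‖ ≤ L * ‖x - y‖) (x y : E) :
    ‖(x + τ • w x) - (y + τ • w y)‖ ≤ (1 + τ * L) * ‖x - y‖ := by
  have e : (x + τ • w x) - (y + τ • w y) = (x - y) + τ • (w x - w y) := by
    rw [smul_sub]; abel
  rw [e]
  refine (norm_add_le _ _).trans ?_
  rw [norm_smul, Real.norm_of_nonneg hτ]
  have := mul_le_mul_of_nonneg_left (hw x y) hτ
  linarith

variable [MeasurableSpace E] [BorelSpace E]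

/-- Lipschitz and boundedness assumptions on the velocity and the source. -/
structure Coeff (a b : ℝ) (v : SignedMeasure E → E → E) (h : SignedMeasure E → SignedMeasure E)
    (K L M Q P : ℝ) : Prop where
  a_pos : 0 < a
  b_pos : 0 < b
  K_nonneg : 0 ≤ K
  L_nonneg : 0 ≤ L
  M_nonneg : 0 ≤ M
  Q_nonneg : 0 ≤ Q
  P_nonneg : 0 ≤ P
  v_sub : ∀ μ ν x, ‖v μ x - v ν x‖ ≤ K * gwNorm a b (μ - ν)
  v_lip : ∀ μ x y, ‖v μ x - v μ y‖ ≤ L * ‖x - y‖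
  v_bound : ∀ μ x, ‖v μ x‖ ≤ M
  h_sub : ∀ μ ν, gwNorm a b (h μ - h ν) ≤ Q * gwNorm a b (μ - ν)
  h_mass : ∀ μ, mass (h μ) ≤ P

/-- The right-hand side of the weak formulation tested against `φ`. -/
def rhs (v : SignedMeasure E → E → E) (h : SignedMeasure E → SignedMeasure E) (φ : E → ℝ)
    (μ : SignedMeasure E) : ℝ :=
  pairing μ (fun x => fderiv ℝ φ x (v μ x)) + pairing (h μ) φ

/-- One step of the explicit Euler scheme. -/
def step (v : SignedMeasure E → E → E) (h : SignedMeasure E → SignedMeasure E) (τ : ℝ)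
    (μ : SignedMeasure E) : SignedMeasure E :=
  μ.map (fun x => x + τ • v μ x) + τ • h μ

variable {a b K L M Q P : ℝ} {v : SignedMeasure E → E → E} {h : SignedMeasure E → SignedMeasure E}

lemma Coeff.continuous (H : Coeff a b v h K L M Q P) (μ : SignedMeasure E) : Continuous (v μ) :=
  continuous_of_lip (H.v_lip μ)

lemma Coeff.pairing_step (H : Coeff a b v h K L M Q P) (τ : ℝ) (μ : SignedMeasure E) {f : E → ℝ}
    (hf : IsBC f) : pairing (step v h τ μ) f =
      pairing μ (fun x => f (x + τ • v μ x)) + τ * pairing (h μ) f := by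
  have hc := H.continuous μ
  rw [step, pairing_add_measure _ _ hf, pairing_smul_measure, pairing_map μ (by fun_prop) hf]

lemma Coeff.mass_step_le (H : Coeff a b v h K L M Q P) {τ : ℝ} (hτ : 0 ≤ τ)
    (μ : SignedMeasure E) : mass (step v h τ μ) ≤ mass μ + τ * P := by
  refine mass_le_of_forall_test _ fun φ hφ h1 => ?_
  rw [H.pairing_step τ μ hφ.isBC]
  have e1 := (le_abs_self _).trans (abs_pairing_le μ (f := fun x => φ (x + τ • v μ x))
    fun x => h1 _)
  have e2 := (le_abs_self _).trans (abs_pairing_le (h μ) h1)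
  have e3 := mul_le_mul_of_nonneg_left (e2.trans (by
    rw [one_mul]; exact H.h_mass μ : 1 * mass (h μ) ≤ P)) hτ
  linarith

lemma Coeff.comp_isBC (H : Coeff a b v h K L M Q P) {f : E → ℝ} (hf : IsBC f) (τ : ℝ)
    (μ : SignedMeasure E) : IsBC (fun x => f (x + τ • v μ x)) := by
  have hc := H.continuous μ
  exact hf.comp (T := fun x => x + τ • v μ x) (by fun_prop)

/-- Points move by at most `τ M`, which changes a `b`-Lipschitz function by at most `b τ M`; the
source adds a measure of mass at most `τ P`, tested against functions bounded by `a`. -/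
lemma Coeff.gwNorm_step_sub_le (H : Coeff a b v h K L M Q P) {τ : ℝ} (hτ : 0 ≤ τ)
    (μ : SignedMeasure E) : gwNorm a b (step v h τ μ - μ) ≤ τ * (b * M * mass μ + a * P) := by
  refine gwNorm_le_of_forall_test H.a_pos H.b_pos _ fun φ _ hBL => ?_
  rw [pairing_sub_measure _ _ hBL.isBC, H.pairing_step τ μ hBL.isBC]
  have e0 := pairing_sub μ (H.comp_isBC hBL.isBC τ μ) hBL.isBC
  have e1 := (le_abs_self _).trans (abs_pairing_le μ (f := fun x => φ (x + τ • v μ x) - φ x)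
    (C := b * (τ * M)) fun x => (hBL.lip _ _).trans (by
      rw [add_sub_cancel_left, norm_smul, Real.norm_of_nonneg hτ]
      have := H.b_pos
      have := H.v_bound μ x
      gcongr))
  have e2 := (le_abs_self _).trans (abs_pairing_le (h μ) hBL.bound)
  have e3 := mul_le_mul_of_nonneg_left (e2.trans
    (mul_le_mul_of_nonneg_left (H.h_mass μ) H.a_pos.le)) hτ
  linarith

/-- Three effects add up: composing the test function with the step map multiplies its Lipschitz
constant by `1 + τ L`; exchanging the velocities costs `b τ K` times the distance against the
measure `ν`; exchanging the sources costs `τ Q` times the distance. Only the mass of one of the two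
measures enters. -/
lemma Coeff.gwNorm_step_sub_step_le (H : Coeff a b v h K L M Q P) {τ : ℝ} (hτ : 0 ≤ τ)
    (μ ν : SignedMeasure E) {m : ℝ} (hm : mass ν ≤ m) :
    gwNorm a b (step v h τ μ - step v h τ ν) ≤
      (1 + τ * (L + b * K * m + Q)) * gwNorm a b (μ - ν) := by
  have := H.b_pos
  have := H.K_nonneg
  refine gwNorm_le_of_forall_test H.a_pos H.b_pos _ fun φ _ hBL => ?_
  rw [pairing_sub_measure _ _ hBL.isBC, H.pairing_step τ μ hBL.isBC, H.pairing_step τ ν hBL.isBC]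
  have b1 := H.comp_isBC hBL.isBC τ μ
  have b2 := H.comp_isBC hBL.isBC τ ν
  have e1 := pairing_sub_measure μ ν b1
  have e2 := pairing_sub ν b1 b2
  have e3 := pairing_sub_measure (h μ) (h ν) hBL.isBC
  have hτL : 0 ≤ τ * L := mul_nonneg hτ H.L_nonneg
  have hN := gwNorm_nonneg a b (μ - ν)
  have i1 : pairing (μ - ν) (fun x => φ (x + τ • v μ x)) ≤ (1 + τ * L) * gwNorm a b (μ - ν) := by
    have : ProperSpace E := FiniteDimensional.proper ℝ E
    refine (le_abs_self _).trans (abs_pairing_le_gwNorm H.a_pos H.b_pos _ (by linarith) ?_)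
    refine (hBL.comp H.b_pos.le (norm_add_smul_sub_le hτ (H.v_lip μ))).mono ?_ (le_of_eq ?_)
    · nlinarith [H.a_pos]
    · ring
  have i2 := (le_abs_self _).trans (abs_pairing_le ν
    (f := fun x => φ (x + τ • v μ x) - φ (x + τ • v ν x))
    (C := b * (τ * (K * gwNorm a b (μ - ν)))) fun x => (hBL.lip _ _).trans (by
      rw [add_sub_add_left_eq_sub, ← smul_sub, norm_smul, Real.norm_of_nonneg hτ]
      have := H.v_sub μ ν x
      gcongr))
  have i3 := mul_le_mul_of_nonneg_left ((pairing_le_gwNorm_of_BL H.a_pos H.b_pos (h μ - h ν)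
    hBL).trans (H.h_sub μ ν)) hτ
  have i4 : b * (τ * (K * gwNorm a b (μ - ν))) * mass ν ≤
      b * (τ * (K * gwNorm a b (μ - ν))) * m := by gcongr
  rw [e1] at i1
  rw [e2] at i2
  rw [e3] at i3
  nlinarith

/-- This is the local error of the scheme. After the first step the measure has moved by at most `τ
G` with `G = b M m + a P`, and points by at most `τ M`. So the second velocity is off by at most `K
τ G + L τ M` and the second source by `Q τ G` in norm, while the source of the first step is
transported over a distance at most `τ M`. Each effect carries a further factor `τ`. -/
lemma Coeff.gwNorm_step_step_sub_le (H : Coeff a b v h K L M Q P) {τ : ℝ} (hτ : 0 ≤ τ)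
    (μ : SignedMeasure E) {m : ℝ} (hm : mass μ ≤ m) :
    gwNorm a b (step v h τ (step v h τ μ) - step v h (2 * τ) μ) ≤
      τ ^ 2 * (b * (K * (b * M * m + a * P) + L * M) * m + b * M * P +
        Q * (b * M * m + a * P)) := by
  have hb := H.b_pos
  have hK := H.K_nonneg
  have hM := H.M_nonneg
  have hL := H.L_nonneg
  have hP := H.P_nonneg
  have ha := H.a_pos
  have hm0 : 0 ≤ m := (mass_nonneg μ).trans hm
  set μ' := step v h τ μ with hμ'
  set G := b * M * m + a * P with hG
  have hD : gwNorm a b (μ' - μ) ≤ τ * G := (H.gwNorm_step_sub_le hτ μ).trans (by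
    rw [hG]; gcongr)
  refine gwNorm_le_of_forall_test H.a_pos H.b_pos _ fun φ _ hBL => ?_
  have b1 := H.comp_isBC hBL.isBC τ μ'
  have b2 : IsBC (fun x => φ ((x + τ • v μ x) + τ • v μ' (x + τ • v μ x))) :=
    H.comp_isBC b1 τ μ
  have b3 := H.comp_isBC hBL.isBC (2 * τ) μ
  rw [pairing_sub_measure _ _ hBL.isBC, H.pairing_step τ μ' hBL.isBC, hμ', H.pairing_step τ μ b1,
    H.pairing_step (2 * τ) μ hBL.isBC, ← hμ']
  have e1 := pairing_sub μ b2 b3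
  have e2 := pairing_sub (h μ) b1 hBL.isBC
  have e3 := pairing_sub_measure (h μ') (h μ) hBL.isBC
  have i1 := (le_abs_self _).trans (abs_pairing_le μ
    (f := fun x => φ ((x + τ • v μ x) + τ • v μ' (x + τ • v μ x)) - φ (x + (2 * τ) • v μ x))
    (C := b * (τ * (K * (τ * G) + L * (τ * M)))) fun x => (hBL.lip _ _).trans (by
      have e : (x + τ • v μ x) + τ • v μ' (x + τ • v μ x) - (x + (2 * τ) • v μ x) =
          τ • ((v μ' (x + τ • v μ x) - v μ (x + τ • v μ x)) +
            (v μ (x + τ • v μ x) - v μ x)) := by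
        rw [two_mul, add_smul, smul_add, smul_sub, smul_sub]; abel
      rw [e, norm_smul, Real.norm_of_nonneg hτ]
      have n1 := (H.v_sub μ' μ (x + τ • v μ x)).trans (mul_le_mul_of_nonneg_left hD hK)
      have n2 := H.v_lip μ (x + τ • v μ x) x
      rw [add_sub_cancel_left, norm_smul, Real.norm_of_nonneg hτ] at n2
      have n3 : L * (τ * ‖v μ x‖) ≤ L * (τ * M) := by
        have := H.v_bound μ x
        gcongr
      have n4 := norm_add_le (v μ' (x + τ • v μ x) - v μ (x + τ • v μ x))
        (v μ (x + τ • v μ x) - v μ x)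
      gcongr
      linarith))
  have i2 := (le_abs_self _).trans (abs_pairing_le (h μ) (f := fun x => φ (x + τ • v μ' x) - φ x)
    (C := b * (τ * M)) fun x => (hBL.lip _ _).trans (by
      rw [add_sub_cancel_left, norm_smul, Real.norm_of_nonneg hτ]
      have := H.v_bound μ' x
      gcongr))
  have i3 := (pairing_le_gwNorm_of_BL H.a_pos H.b_pos (h μ' - h μ)
    hBL).trans ((H.h_sub μ' μ).trans (mul_le_mul_of_nonneg_left hD H.Q_nonneg))
  have hG0 : 0 ≤ G := by positivity
  have i1' : b * (τ * (K * (τ * G) + L * (τ * M))) * mass μ ≤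
    b * (τ * (K * (τ * G) + L * (τ * M))) * m := by gcongr
  have i2' : b * (τ * M) * mass (h μ) ≤ b * (τ * M) * P := by
    have := H.h_mass μ
    gcongr
  rw [e1] at i1
  have j2 := mul_le_mul_of_nonneg_left (i2.trans i2') hτ
  have j3 := mul_le_mul_of_nonneg_left i3 hτ
  rw [e2] at j2
  rw [e3] at j3
  nlinarith

end Coefficients

/-! ### Consistency and dyadic refinement of the Euler scheme -/

section EulerScheme

variable {E : Type*} [NormedAddCommGroup E] [NormedSpace ℝ E] [FiniteDimensional ℝ E]
  [MeasurableSpace E] [BorelSpace E]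

variable {a b K L M Q P : ℝ} {v : SignedMeasure E → E → E} {h : SignedMeasure E → SignedMeasure E}

/-- Lipschitz estimate for the right-hand side of the weak formulation. -/
lemma Coeff.exists_abs_rhs_sub_le (H : Coeff a b v h K L M Q P) {φ : E → ℝ} (hφ : IsTest φ)
    (m : ℝ) : ∃ C, 0 ≤ C ∧ ∀ μ ν : SignedMeasure E, mass ν ≤ m →
      |rhs v h φ μ - rhs v h φ ν| ≤ C * gwNorm a b (μ - ν) := by
  obtain ⟨B, Λ, A, hB, hΛ, hA, hC⟩ := hφ.exists_C11Bound
  have ha := H.a_pos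
  have hb := H.b_pos
  have hK := H.K_nonneg
  have hM := H.M_nonneg
  have hL := H.L_nonneg
  have hQ := H.Q_nonneg
  refine ⟨(Λ * M / a + (Λ * L + A * M) / b) + Λ * K * |m| + (B / a + Λ / b) * Q, by positivity,
    fun μ ν hm => ?_⟩
  have hBL := hC.toBL hφ
  have b1 := fun ρ => hC.fderiv_apply_BL hΛ hA (H.v_bound ρ) (H.v_lip ρ)
  have e1 := pairing_sub_measure μ ν (b1 μ).isBC
  have e2 := pairing_sub ν (b1 μ).isBC (b1 ν).isBC
  have e3 := pairing_sub_measure (h μ) (h ν) hBL.isBC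
  have i1 := abs_pairing_le_of_BL ha hb (μ - ν) (by positivity) (b1 μ)
  have i2 := abs_pairing_le ν (f := fun x => fderiv ℝ φ x (v μ x) - fderiv ℝ φ x (v ν x))
    (C := Λ * (K * gwNorm a b (μ - ν))) fun x => by
      rw [← map_sub]
      exact ((fderiv ℝ φ x).le_opNorm _).trans
        (mul_le_mul (hC.fderiv_bound x) (H.v_sub μ ν x) (norm_nonneg _) hΛ)
  have i3 := (abs_pairing_le_of_BL ha hb (h μ - h ν) hΛ hBL).trans
    (mul_le_mul_of_nonneg_left (H.h_sub μ ν) (by positivity))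
  have hN := gwNorm_nonneg a b (μ - ν)
  have i2' : Λ * (K * gwNorm a b (μ - ν)) * mass ν ≤ Λ * (K * gwNorm a b (μ - ν)) * |m| := by
    have := hm.trans (le_abs_self m)
    gcongr
  have e : rhs v h φ μ - rhs v h φ ν =
      pairing (μ - ν) (fun x => fderiv ℝ φ x (v μ x)) +
      pairing ν (fun x => fderiv ℝ φ x (v μ x) - fderiv ℝ φ x (v ν x)) +
      pairing (h μ - h ν) φ := by
    rw [e1, e2, e3, rhs, rhs]; ring
  rw [e]
  refine (abs_add_three _ _ _).trans ?_
  linarith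

/-- Consistency of one Euler step with the weak formulation. -/
lemma Coeff.exists_abs_pairing_step_sub_le (H : Coeff a b v h K L M Q P) {φ : E → ℝ}
    (hφ : IsTest φ) (m : ℝ) : ∃ C, 0 ≤ C ∧ ∀ (μ : SignedMeasure E) (τ : ℝ), mass μ ≤ m → 0 ≤ τ →
      |pairing (step v h τ μ) φ - pairing μ φ - τ * rhs v h φ μ| ≤ C * τ ^ 2 := by
  obtain ⟨B, Λ, A, hB, hΛ, hA, hC⟩ := hφ.exists_C11Bound
  have hM := H.M_nonneg
  refine ⟨A * M ^ 2 * |m|, by positivity, fun μ τ hm hτ => ?_⟩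
  have b1 := (hC.fderiv_apply_BL hΛ hA (H.v_bound μ) (H.v_lip μ)).isBC
  have b2 := H.comp_isBC hφ.isBC τ μ
  have e1 := pairing_sub μ b2 hφ.isBC
  have e2 := pairing_sub μ (b2.sub hφ.isBC) (b1.const_mul τ)
  have i1 := abs_pairing_le μ
    (f := fun x => φ (x + τ • v μ x) - φ x - τ * fderiv ℝ φ x (v μ x))
    (C := A * (τ * M) ^ 2) fun x => by
      have h1 := hC.taylor hA hφ x (τ • v μ x)
      rw [map_smul, smul_eq_mul, norm_smul, Real.norm_of_nonneg hτ] at h1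
      have := H.v_bound μ x
      refine h1.trans (by gcongr)
  rw [pairing_const_mul] at e2
  have e : pairing (step v h τ μ) φ - pairing μ φ - τ * rhs v h φ μ =
      pairing μ (fun x => φ (x + τ • v μ x) - φ x - τ * fderiv ℝ φ x (v μ x)) := by
    rw [e2, e1, H.pairing_step τ μ hφ.isBC, rhs]; ring
  rw [e]
  refine i1.trans ?_
  have : A * (τ * M) ^ 2 * mass μ ≤ A * (τ * M) ^ 2 * |m| := by
    have := hm.trans (le_abs_self m)
    gcongr
  refine this.trans (le_of_eq (by ring))

/-- Iterates of the Euler scheme with step `2⁻ⁿ`. -/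
def euler (v : SignedMeasure E → E → E) (h : SignedMeasure E → SignedMeasure E)
    (μ₀ : SignedMeasure E) (n k : ℕ) : SignedMeasure E :=
  (step v h ((1 / 2 : ℝ) ^ n))^[k] μ₀

lemma euler_succ (μ₀ : SignedMeasure E) (n k : ℕ) :
    euler v h μ₀ n (k + 1) = step v h ((1 / 2 : ℝ) ^ n) (euler v h μ₀ n k) :=
  Function.iterate_succ_apply' _ _ _

variable (μ₀ : SignedMeasure E)

lemma Coeff.mass_euler_le (H : Coeff a b v h K L M Q P) (n k : ℕ) :
    mass (euler v h μ₀ n k) ≤ mass μ₀ + k * (1 / 2 : ℝ) ^ n * P := by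
  induction k with
  | zero => simp [euler]
  | succ k ih =>
    rw [euler_succ]
    refine (H.mass_step_le (by positivity) _).trans ?_
    push_cast
    linarith

lemma Coeff.mass_euler_le' (H : Coeff a b v h K L M Q P) {n k : ℕ}
    (hk : (k : ℝ) * (1 / 2 : ℝ) ^ n ≤ 1) : mass (euler v h μ₀ n k) ≤ mass μ₀ + P := by
  refine (H.mass_euler_le μ₀ n k).trans ?_
  have := mul_le_mul_of_nonneg_right hk H.P_nonneg
  linarith

lemma Coeff.gwNorm_euler_sub_le (H : Coeff a b v h K L M Q P) {n j k : ℕ}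
    (hk : ((j + k : ℕ) : ℝ) * (1 / 2 : ℝ) ^ n ≤ 1) :
    gwNorm a b (euler v h μ₀ n (j + k) - euler v h μ₀ n j) ≤
      k * (1 / 2 : ℝ) ^ n * (b * M * (mass μ₀ + P) + a * P) := by
  have hb := H.b_pos
  have hM := H.M_nonneg
  induction k with
  | zero => simp [gwNorm_zero H.a_pos H.b_pos]
  | succ k ih =>
    have hk' : ((j + k : ℕ) : ℝ) * (1 / 2 : ℝ) ^ n ≤ 1 := by
      refine le_trans ?_ hk
      gcongr
      omega
    have i1 := ih hk'
    have i2 := H.gwNorm_step_sub_le (τ := (1 / 2 : ℝ) ^ n) (by positivity)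
      (euler v h μ₀ n (j + k))
    rw [← euler_succ] at i2
    have i3 : (1 / 2 : ℝ) ^ n * (b * M * mass (euler v h μ₀ n (j + k)) + a * P) ≤
        (1 / 2 : ℝ) ^ n * (b * M * (mass μ₀ + P) + a * P) := by
      have := H.mass_euler_le' μ₀ hk'
      gcongr
    have i4 := gwNorm_sub_le H.a_pos H.b_pos (euler v h μ₀ n (j + k + 1))
      (euler v h μ₀ n (j + k)) (euler v h μ₀ n j)
    rw [← add_assoc]
    push_cast
    linarith

/-- A discrete Gronwall inequality, with each of the `k` defects `β` amplified by at most the full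
factor `(1 + α) ^ k`. -/
lemma le_of_affine_recursion {e : ℕ → ℝ} {α β : ℝ} (hα : 0 ≤ α) (hβ : 0 ≤ β) (h0 : e 0 ≤ 0)
    {N : ℕ} (hs : ∀ k < N, e (k + 1) ≤ β + (1 + α) * e k) {k : ℕ} (hk : k ≤ N) :
    e k ≤ k * β * (1 + α) ^ k := by
  induction k with
  | zero => simpa using h0
  | succ k ih =>
    have h1 := hs k (by omega)
    have h2 := mul_le_mul_of_nonneg_left (ih (by omega)) (show 0 ≤ 1 + α by linarith)
    have h3 : β * 1 ≤ β * (1 + α) ^ (k + 1) := by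
      gcongr
      exact one_le_pow₀ (by linarith)
    calc e (k + 1) ≤ β * (1 + α) ^ (k + 1) + (1 + α) * (k * β * (1 + α) ^ k) := by linarith
      _ = _ := by push_cast; ring

/-- One coarse step is compared with two fine ones through the coarse step started at the fine
iterate: the local error bounds the first difference and stability of the coarse step the second. -/
lemma Coeff.gwNorm_euler_refine_succ_le (H : Coeff a b v h K L M Q P) {n k : ℕ} {τ m : ℝ}
    (hτ : (1 / 2 : ℝ) ^ (n + 1) = τ) (hm : mass μ₀ + P = m)
    (hk : (k : ℝ) * (1 / 2 : ℝ) ^ n ≤ 1) :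
    gwNorm a b (euler v h μ₀ (n + 1) (2 * (k + 1)) - euler v h μ₀ n (k + 1)) ≤
      τ ^ 2 * (b * (K * (b * M * m + a * P) + L * M) * m + b * M * P + Q * (b * M * m + a * P)) +
      (1 + 2 * τ * (L + b * K * m + Q)) *
        gwNorm a b (euler v h μ₀ (n + 1) (2 * k) - euler v h μ₀ n k) := by
  have hτ0 : 0 < τ := by rw [← hτ]; positivity
  have hτ2 : (1 / 2 : ℝ) ^ n = 2 * τ := by rw [← hτ, pow_succ]; ring
  have m1 : mass (euler v h μ₀ (n + 1) (2 * k)) ≤ m := by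
    rw [← hm]
    refine H.mass_euler_le' μ₀ ?_
    rw [hτ2] at hk
    rw [hτ]
    push_cast
    linarith
  have m2 : mass (euler v h μ₀ n k) ≤ m := hm ▸ H.mass_euler_le' μ₀ hk
  have i1 := H.gwNorm_step_step_sub_le hτ0.le _ m1
  have i2 := H.gwNorm_step_sub_step_le (τ := 2 * τ) (by positivity)
    (euler v h μ₀ (n + 1) (2 * k)) _ m2
  have i3 := gwNorm_sub_le H.a_pos H.b_pos
    (step v h τ (step v h τ (euler v h μ₀ (n + 1) (2 * k))))
    (step v h (2 * τ) (euler v h μ₀ (n + 1) (2 * k))) (step v h (2 * τ) (euler v h μ₀ n k))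
  rw [show 2 * (k + 1) = 2 * k + 1 + 1 by ring, euler_succ, euler_succ, euler_succ, hτ, hτ2]
  exact i3.trans (add_le_add i1 i2)

/-- Comparison of two successive dyadic Euler schemes. -/
lemma Coeff.exists_gwNorm_euler_refine_le (H : Coeff a b v h K L M Q P) :
    ∃ A, 0 ≤ A ∧ ∀ n k : ℕ, (k : ℝ) * (1 / 2 : ℝ) ^ n ≤ 1 →
      gwNorm a b (euler v h μ₀ (n + 1) (2 * k) - euler v h μ₀ n k) ≤ A * (1 / 2 : ℝ) ^ n := by
  have ha := H.a_pos
  have hb := H.b_pos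
  have hK := H.K_nonneg
  have hM := H.M_nonneg
  have hL := H.L_nonneg
  have hQ := H.Q_nonneg
  have hP := H.P_nonneg
  have hm0 : 0 ≤ mass μ₀ + P := add_nonneg (mass_nonneg _) hP
  obtain ⟨m, hm⟩ : ∃ m, mass μ₀ + P = m := ⟨_, rfl⟩
  rw [hm] at hm0
  obtain ⟨C₄, hC₄⟩ : ∃ C, b * (K * (b * M * m + a * P) + L * M) * m + b * M * P +
    Q * (b * M * m + a * P) = C := ⟨_, rfl⟩
  obtain ⟨C₃, hC₃⟩ : ∃ C, L + b * K * m + Q = C := ⟨_, rfl⟩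
  have hC₄0 : 0 ≤ C₄ := by rw [← hC₄]; positivity
  have hC₃0 : 0 ≤ C₃ := by rw [← hC₃]; positivity
  refine ⟨C₄ * Real.exp C₃, by positivity, fun n k hk => ?_⟩
  obtain ⟨τ, hτ⟩ : ∃ τ, (1 / 2 : ℝ) ^ (n + 1) = τ := ⟨_, rfl⟩
  have hτ0 : 0 < τ := by rw [← hτ]; positivity
  have hτ2 : (1 / 2 : ℝ) ^ n = 2 * τ := by rw [← hτ, pow_succ]; ring
  have key : gwNorm a b (euler v h μ₀ (n + 1) (2 * k) - euler v h μ₀ n k) ≤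
      k * (τ ^ 2 * C₄) * (1 + 2 * τ * C₃) ^ k := by
    refine le_of_affine_recursion
      (e := fun k => gwNorm a b (euler v h μ₀ (n + 1) (2 * k) - euler v h μ₀ n k))
      (by positivity) (by positivity) (by simp [euler, gwNorm_zero ha hb]) (N := k)
      (fun j hj => ?_) le_rfl
    have hj' : (j : ℝ) * (1 / 2 : ℝ) ^ n ≤ 1 := by
      refine le_trans ?_ hk
      gcongr
    have := H.gwNorm_euler_refine_succ_le μ₀ hτ hm hj'
    rwa [hC₄, hC₃] at this
  refine key.trans ?_
  -- Since `k · 2τ ≤ 1`, the accumulated local errors `k τ² C₄` are `O(τ)` and the amplification `(1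
  -- + 2τ C₃) ^ k` is at most `exp C₃`.
  rw [hτ2] at hk ⊢
  have i1 : (1 + 2 * τ * C₃) ^ k ≤ Real.exp C₃ := by
    calc (1 + 2 * τ * C₃) ^ k ≤ Real.exp (2 * τ * C₃) ^ k := by
          gcongr
          rw [add_comm]; exact Real.add_one_le_exp _
      _ = Real.exp (k * (2 * τ) * C₃) := by rw [← Real.exp_nat_mul]; ring_nf
      _ ≤ Real.exp C₃ := Real.exp_le_exp.2 (mul_le_of_le_one_left hC₃0 hk)
  have i2 : k * (τ ^ 2 * C₄) ≤ 2 * τ * C₄ := by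
    have e1 : k * (2 * τ) * (τ * C₄) ≤ 1 * (τ * C₄) :=
      mul_le_mul_of_nonneg_right hk (by positivity)
    have e2 : 0 ≤ τ * C₄ := by positivity
    linarith [show k * (τ ^ 2 * C₄) = k * (2 * τ) * (τ * C₄) / 2 by ring]
  calc k * (τ ^ 2 * C₄) * (1 + 2 * τ * C₃) ^ k ≤ 2 * τ * C₄ * Real.exp C₃ := by gcongr
    _ = _ := by ring

/-- Consistency of several Euler steps with the weak formulation. -/
lemma Coeff.exists_abs_pairing_euler_sub_le (H : Coeff a b v h K L M Q P) {φ : E → ℝ}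
    (hφ : IsTest φ) : ∃ C, 0 ≤ C ∧ ∀ n j k : ℕ, ((j + k : ℕ) : ℝ) * (1 / 2 : ℝ) ^ n ≤ 1 →
      |pairing (euler v h μ₀ n (j + k)) φ - pairing (euler v h μ₀ n j) φ -
        k * (1 / 2 : ℝ) ^ n * rhs v h φ (euler v h μ₀ n j)| ≤ C * (k * (1 / 2 : ℝ) ^ n) ^ 2 := by
  have ha := H.a_pos
  have hb := H.b_pos
  have hM := H.M_nonneg
  have hP := H.P_nonneg
  have hm0 : 0 ≤ mass μ₀ := mass_nonneg μ₀
  obtain ⟨C₁, hC₁, h₁⟩ := H.exists_abs_rhs_sub_le hφ (mass μ₀ + P)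
  obtain ⟨C₂, hC₂, h₂⟩ := H.exists_abs_pairing_step_sub_le hφ (mass μ₀ + P)
  set G := b * M * (mass μ₀ + P) + a * P with hG
  have hG0 : 0 ≤ G := by positivity
  refine ⟨C₂ + C₁ * G, by positivity, fun n j k hk => ?_⟩
  set τ : ℝ := (1 / 2 : ℝ) ^ n with hτ
  have hτ0 : 0 < τ := by positivity
  -- The first term sums the Taylor errors of the single steps. The second comes from freezing the
  -- right-hand side at index `j`: after `i` steps it has drifted by at most `C₁ G i τ`, and summing
  -- over `i` gives a quadratic bound.
  have key : |pairing (euler v h μ₀ n (j + k)) φ - pairing (euler v h μ₀ n j) φ -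
      k * τ * rhs v h φ (euler v h μ₀ n j)| ≤ k * (C₂ * τ ^ 2) + C₁ * G * τ ^ 2 * k ^ 2 := by
    induction k with
    | zero => simp
    | succ k ih =>
      have hk' : ((j + k : ℕ) : ℝ) * τ ≤ 1 := by
        refine le_trans ?_ hk
        gcongr
        omega
      have hj : ((j : ℕ) : ℝ) * τ ≤ 1 := by
        refine le_trans ?_ hk'
        gcongr
        omega
      have i1 := ih hk'
      have i2 := h₂ _ τ (H.mass_euler_le' μ₀ hk') hτ0.le
      rw [← euler_succ] at i2
      have i3 := h₁ (euler v h μ₀ n (j + k)) _ (H.mass_euler_le' μ₀ hj)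
      have i4 := mul_le_mul_of_nonneg_left (H.gwNorm_euler_sub_le μ₀ hk') hC₁
      have i5 := mul_le_mul_of_nonneg_left (i3.trans i4) hτ0.le
      have i5' : |τ * (rhs v h φ (euler v h μ₀ n (j + k)) - rhs v h φ (euler v h μ₀ n j))| ≤
          τ * (C₁ * (k * τ * G)) := by
        rw [abs_mul, abs_of_pos hτ0]
        exact i5
      rw [← add_assoc]
      rw [abs_le] at i1 i2 i5' ⊢
      push_cast
      have i6 : 0 ≤ C₁ * G * τ ^ 2 * (k + 1) := by positivity
      constructor <;> nlinarith
  refine key.trans ?_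
  have : (k : ℝ) ≤ k ^ 2 := by exact_mod_cast Nat.le_self_pow two_ne_zero k
  have : (k : ℝ) * (C₂ * τ ^ 2) ≤ k ^ 2 * (C₂ * τ ^ 2) := by gcongr
  nlinarith

end EulerScheme

/-! ### Convergence of the Euler scheme and existence -/

section Existence

variable {E : Type*} [NormedAddCommGroup E] [NormedSpace ℝ E] [FiniteDimensional ℝ E]
  [MeasurableSpace E] [BorelSpace E]

variable {a b K L M Q P : ℝ} {v : SignedMeasure E → E → E} {h : SignedMeasure E → SignedMeasure E}

/-- The number of steps of length `2⁻ⁿ` up to time `t`. -/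
def dyadicIndex (n : ℕ) (t : ℝ) : ℕ := ⌊t * 2 ^ n⌋₊

lemma dyadicIndex_mul_le (n : ℕ) {t : ℝ} (ht : 0 ≤ t) :
    (dyadicIndex n t : ℝ) * (1 / 2 : ℝ) ^ n ≤ t := by
  have h1 := Nat.floor_le (show 0 ≤ t * 2 ^ n by positivity)
  rw [one_div, inv_pow, ← div_eq_mul_inv, div_le_iff₀ (by positivity)]
  exact h1

lemma lt_dyadicIndex_mul_add (n : ℕ) (t : ℝ) :
    t < (dyadicIndex n t : ℝ) * (1 / 2 : ℝ) ^ n + (1 / 2 : ℝ) ^ n := by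
  have h1 := Nat.lt_floor_add_one (t * 2 ^ n)
  rw [one_div, inv_pow, ← add_one_mul, ← div_eq_mul_inv, lt_div_iff₀ (by positivity)]
  exact h1

lemma dyadicIndex_mono (n : ℕ) {s t : ℝ} (hst : s ≤ t) : dyadicIndex n s ≤ dyadicIndex n t :=
  Nat.floor_mono (by gcongr)

/-- Halving the step changes the discretized time by at most one fine step, so two successive
schemes at time `t` differ by the refinement error and at most one extra step. -/
lemma dyadicIndex_succ (n : ℕ) {t : ℝ} (ht : 0 ≤ t) :
    ∃ r ≤ 1, dyadicIndex (n + 1) t = 2 * dyadicIndex n t + r := by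
  have h1 := Nat.floor_le (show 0 ≤ t * 2 ^ n by positivity)
  have h2 := Nat.lt_floor_add_one (t * 2 ^ n)
  have h3 : 2 * dyadicIndex n t ≤ dyadicIndex (n + 1) t := by
    refine Nat.le_floor ?_
    rw [pow_succ]
    push_cast
    change 2 * ((⌊t * 2 ^ n⌋₊ : ℕ) : ℝ) ≤ _
    linarith
  have h4 : dyadicIndex (n + 1) t < 2 * dyadicIndex n t + 2 := by
    refine (Nat.floor_lt (by positivity)).2 ?_
    rw [pow_succ]
    push_cast
    change _ < 2 * ((⌊t * 2 ^ n⌋₊ : ℕ) : ℝ) + 2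
    linarith
  exact ⟨dyadicIndex (n + 1) t - 2 * dyadicIndex n t, by omega, by omega⟩

lemma tendsto_dyadicIndex_mul (t : ℝ) (ht : 0 ≤ t) :
    Tendsto (fun n => (dyadicIndex n t : ℝ) * (1 / 2 : ℝ) ^ n) atTop (𝓝 t) := by
  have h0 : Tendsto (fun n : ℕ => t - (1 / 2 : ℝ) ^ n) atTop (𝓝 t) := by
    simpa using (tendsto_pow_atTop_nhds_zero_of_lt_one (r := (1 / 2 : ℝ)) (by norm_num)
      (by norm_num)).const_sub t
  exact tendsto_of_tendsto_of_tendsto_of_le_of_le h0 tendsto_const_nhds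
    (fun n => by linarith [lt_dyadicIndex_mul_add n t]) fun n => dyadicIndex_mul_le n ht

/-- The dyadic Euler approximation at time `t`. -/
def eulerAt (v : SignedMeasure E → E → E) (h : SignedMeasure E → SignedMeasure E)
    (μ₀ : SignedMeasure E) (n : ℕ) (t : ℝ) : SignedMeasure E :=
  euler v h μ₀ n (dyadicIndex n t)

variable (μ₀ : SignedMeasure E)

lemma Coeff.mass_eulerAt_le (H : Coeff a b v h K L M Q P) (n : ℕ) {t : ℝ}
    (ht : t ∈ Icc (0 : ℝ) 1) : mass (eulerAt v h μ₀ n t) ≤ mass μ₀ + P :=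
  H.mass_euler_le' μ₀ ((dyadicIndex_mul_le n ht.1).trans ht.2)

/-- The Euler approximations converge uniformly in time. -/
lemma Coeff.exists_eulerAt_limit (H : Coeff a b v h K L M Q P) :
    ∃ (C : ℝ) (μ : ℝ → SignedMeasure E), ∀ t ∈ Icc (0 : ℝ) 1, ∀ n,
      gwNorm a b (eulerAt v h μ₀ n t - μ t) ≤ C * (1 / 2 : ℝ) ^ n := by
  have ha := H.a_pos
  have hb := H.b_pos
  have hM := H.M_nonneg
  have hP := H.P_nonneg
  have hm0 := mass_nonneg μ₀
  obtain ⟨A, hA, hA'⟩ := H.exists_gwNorm_euler_refine_le μ₀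
  obtain ⟨G, hG⟩ : ∃ G, b * M * (mass μ₀ + P) + a * P = G := ⟨_, rfl⟩
  have hG0 : 0 ≤ G := by rw [← hG]; positivity
  -- Here `A` accounts for the refinement at equal discrete times, and `G` for the possible extra
  -- fine step.
  have hsucc : ∀ t ∈ Icc (0 : ℝ) 1, ∀ n,
      gwNorm a b (eulerAt v h μ₀ (n + 1) t - eulerAt v h μ₀ n t) ≤ (A + G) * (1 / 2 : ℝ) ^ n := by
    intro t ht n
    obtain ⟨r, hr, hr'⟩ := dyadicIndex_succ n ht.1
    have hk := (dyadicIndex_mul_le (n + 1) ht.1).trans ht.2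
    rw [hr'] at hk
    have i1 := H.gwNorm_euler_sub_le μ₀ hk
    have i2 := hA' n (dyadicIndex n t) ((dyadicIndex_mul_le n ht.1).trans ht.2)
    have i3 := gwNorm_sub_le ha hb (euler v h μ₀ (n + 1) (2 * dyadicIndex n t + r))
      (euler v h μ₀ (n + 1) (2 * dyadicIndex n t)) (euler v h μ₀ n (dyadicIndex n t))
    rw [hG] at i1
    have hr1 : (r : ℝ) ≤ 1 := by exact_mod_cast hr
    have i4 : r * (1 / 2 : ℝ) ^ (n + 1) * G ≤ 1 * (1 / 2 : ℝ) ^ n * G := by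
      gcongr ?_ * ?_ * G
      exact pow_le_pow_of_le_one (by norm_num) (by norm_num) (Nat.le_succ n)
    rw [eulerAt, eulerAt, hr']
    linarith
  -- The bound is the exact geometric sum, in the form in which the induction on `j` closes.
  have hcauchy : ∀ t ∈ Icc (0 : ℝ) 1, ∀ n j,
      gwNorm a b (eulerAt v h μ₀ n t - eulerAt v h μ₀ (n + j) t) ≤
        2 * (A + G) * ((1 / 2 : ℝ) ^ n - (1 / 2 : ℝ) ^ (n + j)) := by
    intro t ht n j
    induction j with
    | zero => simp [gwNorm_zero ha hb]
    | succ j ih =>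
      have i1 := hsucc t ht (n + j)
      rw [gwNorm_sub_comm ha hb] at i1
      have i2 := gwNorm_sub_le ha hb (eulerAt v h μ₀ n t) (eulerAt v h μ₀ (n + j) t)
        (eulerAt v h μ₀ (n + j + 1) t)
      rw [← add_assoc, pow_succ _ (n + j)]
      linarith
  have hlim : ∀ t : ℝ, ∃ ν : SignedMeasure E, t ∈ Icc (0 : ℝ) 1 → ∀ n,
      gwNorm a b (eulerAt v h μ₀ n t - ν) ≤ 2 * (A + G) * (1 / 2 : ℝ) ^ n := by
    intro t
    by_cases ht : t ∈ Icc (0 : ℝ) 1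
    · obtain ⟨ν, hν⟩ := exists_gwNorm_limit ha hb (fun n => eulerAt v h μ₀ n t)
        (fun n => H.mass_eulerAt_le μ₀ n ht) (δ := fun n => 2 * (A + G) * (1 / 2 : ℝ) ^ n)
        fun n k hnk => by
          obtain ⟨j, rfl⟩ := Nat.exists_eq_add_of_le hnk
          refine (hcauchy t ht n j).trans ?_
          gcongr
          have : 0 ≤ (1 / 2 : ℝ) ^ (n + j) := by positivity
          linarith
      exact ⟨ν, fun _ => hν⟩
    · exact ⟨0, fun h => absurd h ht⟩
  choose μ hμ using hlim
  exact ⟨2 * (A + G), μ, hμ⟩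

lemma tendsto_of_abs_sub_le {u : ℕ → ℝ} {l C : ℝ} (hu : ∀ n, |u n - l| ≤ C * (1 / 2 : ℝ) ^ n) :
    Tendsto u atTop (𝓝 l) := by
  rw [tendsto_iff_norm_sub_tendsto_zero]
  refine squeeze_zero (fun n => norm_nonneg _) hu ?_
  simpa using (tendsto_pow_atTop_nhds_zero_of_lt_one (r := (1 / 2 : ℝ)) (by norm_num)
      (by norm_num)).const_mul C

lemma hasDerivWithinAt_of_abs_le_sq {F : ℝ → ℝ} {g C t : ℝ} {S : Set ℝ}
    (hF : ∀ s ∈ S, |F s - F t - (s - t) * g| ≤ C * (s - t) ^ 2) : HasDerivWithinAt F g S t := by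
  rw [hasDerivWithinAt_iff_isLittleO]
  have h1 : (fun s => F s - F t - (s - t) • g) =O[𝓝[S] t] fun s => ‖s - t‖ ^ 2 := by
    refine Asymptotics.IsBigO.of_bound C ?_
    filter_upwards [self_mem_nhdsWithin] with s hs
    rw [norm_pow, norm_norm, Real.norm_eq_abs, Real.norm_eq_abs, sq_abs]
    exact hF s hs
  exact h1.trans_isLittleO
    ((Asymptotics.isLittleO_pow_sub_sub t one_lt_two).mono nhdsWithin_le_nhds)

/-- Existence of solutions. -/
theorem Coeff.exists_solution (H : Coeff a b v h K L M Q P) :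
    ∃ μ : ℝ → SignedMeasure E, μ 0 = μ₀ ∧
      (∃ C, ∀ s ∈ Icc (0 : ℝ) 1, ∀ t ∈ Icc (0 : ℝ) 1, gwNorm a b (μ t - μ s) ≤ C * |t - s|) ∧
      ∀ φ : E → ℝ, IsTest φ → ∀ t ∈ Icc (0 : ℝ) 1,
        HasDerivWithinAt (fun s => pairing (μ s) φ) (rhs v h φ (μ t)) (Icc 0 1) t := by
  have ha := H.a_pos
  have hb := H.b_pos
  obtain ⟨C, μ, hμ⟩ := H.exists_eulerAt_limit μ₀
  obtain ⟨G, hG⟩ : ∃ G, b * M * (mass μ₀ + P) + a * P = G := ⟨_, rfl⟩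
  have hdiff : ∀ n s t, 0 ≤ s → s ≤ t → t ≤ 1 → ∃ k : ℕ,
      dyadicIndex n t = dyadicIndex n s + k ∧
      ((dyadicIndex n s + k : ℕ) : ℝ) * (1 / 2 : ℝ) ^ n ≤ 1 := by
    intro n s t hs hst ht
    obtain ⟨k, hk⟩ := Nat.exists_eq_add_of_le (dyadicIndex_mono n hst)
    exact ⟨k, hk, hk ▸ (dyadicIndex_mul_le n (hs.trans hst)).trans ht⟩
  have hkτ : ∀ s t, 0 ≤ s → s ≤ t → Tendsto (fun n => ((dyadicIndex n t : ℝ) * (1 / 2 : ℝ) ^ n -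
      (dyadicIndex n s : ℝ) * (1 / 2 : ℝ) ^ n)) atTop (𝓝 (t - s)) := fun s t hs hst =>
    (tendsto_dyadicIndex_mul t (hs.trans hst)).sub (tendsto_dyadicIndex_mul s hs)
  have hδ : Tendsto (fun n : ℕ => C * (1 / 2 : ℝ) ^ n) atTop (𝓝 0) := by
    simpa using (tendsto_pow_atTop_nhds_zero_of_lt_one (r := (1 / 2 : ℝ)) (by norm_num)
      (by norm_num)).const_mul C
  have hlip : ∀ s t, 0 ≤ s → s ≤ t → t ≤ 1 → gwNorm a b (μ t - μ s) ≤ G * (t - s) := by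
    intro s t hs hst ht
    have hlim := ((hδ.add ((hkτ s t hs hst).const_mul G)).add hδ)
    rw [zero_add, add_zero] at hlim
    refine ge_of_tendsto' hlim fun n => ?_
    obtain ⟨k, hk, hk1⟩ := hdiff n s t hs hst ht
    have i1 := hμ t ⟨hs.trans hst, ht⟩ n
    have i2 := hμ s ⟨hs, hst.trans ht⟩ n
    have i3 := H.gwNorm_euler_sub_le μ₀ hk1
    rw [← hk, hG] at i3
    rw [gwNorm_sub_comm ha hb] at i1
    have i4 := gwNorm_sub_le ha hb (μ t) (eulerAt v h μ₀ n t) (μ s)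
    have i5 := gwNorm_sub_le ha hb (eulerAt v h μ₀ n t) (eulerAt v h μ₀ n s) (μ s)
    change gwNorm a b (eulerAt v h μ₀ n t - eulerAt v h μ₀ n s) ≤ _ at i3
    rw [hk]
    push_cast
    linarith
  refine ⟨μ, ?_, ⟨G, fun s hs t ht => ?_⟩, fun φ hφ => ?_⟩
  · have h0 : gwNorm a b (μ₀ - μ 0) ≤ 0 := by
      refine ge_of_tendsto' hδ fun n => ?_
      have := hμ 0 ⟨le_rfl, zero_le_one⟩ n
      simpa [eulerAt, euler, dyadicIndex] using this
    exact (sub_eq_zero.1 (eq_zero_of_gwNorm_eq_zero ha hb h0)).symm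
  · rcases le_total s t with hst | hst
    · rw [abs_of_nonneg (sub_nonneg.2 hst)]
      exact hlip s t hs.1 hst ht.2
    · rw [gwNorm_sub_comm ha hb, abs_sub_comm, abs_of_nonneg (sub_nonneg.2 hst)]
      exact hlip t s ht.1 hst hs.2
  obtain ⟨C₁, hC₁, h₁⟩ := H.exists_abs_rhs_sub_le hφ (mass μ₀ + P)
  obtain ⟨C₂, hC₂, h₂⟩ := H.exists_abs_pairing_euler_sub_le μ₀ hφ
  obtain ⟨B, Λ, hΛ, hBL⟩ := hφ.exists_BL
  have hF : ∀ t ∈ Icc (0 : ℝ) 1, Tendsto (fun n => pairing (eulerAt v h μ₀ n t) φ) atTop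
      (𝓝 (pairing (μ t) φ)) := fun t ht => by
    refine tendsto_of_abs_sub_le (C := (B / a + Λ / b) * C) fun n => ?_
    rw [← pairing_sub_measure _ _ hφ.isBC, mul_assoc]
    have hB := hBL.bound_nonneg
    exact (abs_pairing_le_of_BL ha hb _ hΛ hBL).trans
      (mul_le_mul_of_nonneg_left (hμ t ht n) (by positivity))
  have hg : ∀ t ∈ Icc (0 : ℝ) 1, Tendsto (fun n => rhs v h φ (eulerAt v h μ₀ n t)) atTop
      (𝓝 (rhs v h φ (μ t))) := fun t ht => by
    refine tendsto_of_abs_sub_le (C := C₁ * C) fun n => ?_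
    -- The difference is reversed so that the Euler approximation, whose mass is controlled, is the
    -- measure on which the Lipschitz estimate of the right-hand side requires a mass bound.
    rw [abs_sub_comm, mul_assoc]
    refine (h₁ _ _ (H.mass_eulerAt_le μ₀ n ht)).trans (mul_le_mul_of_nonneg_left ?_ hC₁)
    rw [gwNorm_sub_comm ha hb]
    exact hμ t ht n
  have hrhs : ∀ s t, 0 ≤ s → s ≤ t → t ≤ 1 →
      |rhs v h φ (μ t) - rhs v h φ (μ s)| ≤ C₁ * G * (t - s) := by
    intro s t hs hst ht
    refine le_of_tendsto_of_tendsto' ((hg t ⟨hs.trans hst, ht⟩).sub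
      (hg s ⟨hs, hst.trans ht⟩)).abs ((hkτ s t hs hst).const_mul (C₁ * G)) fun n => ?_
    obtain ⟨k, hk, hk1⟩ := hdiff n s t hs hst ht
    refine (h₁ _ _ (H.mass_eulerAt_le μ₀ n ⟨hs, hst.trans ht⟩)).trans ?_
    have i3 := H.gwNorm_euler_sub_le μ₀ hk1
    rw [← hk, hG] at i3
    have i4 := mul_le_mul_of_nonneg_left i3 hC₁
    rw [eulerAt, eulerAt]
    refine i4.trans (le_of_eq ?_)
    rw [hk]
    push_cast
    ring
  -- The consistency constant does not depend on `n`, so the first-order expansion with quadratic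
  -- remainder passes to the limit. It is based at the earlier time.
  have htaylor : ∀ s t, 0 ≤ s → s ≤ t → t ≤ 1 →
      |pairing (μ t) φ - pairing (μ s) φ - (t - s) * rhs v h φ (μ s)| ≤ C₂ * (t - s) ^ 2 := by
    intro s t hs hst ht
    have hs' : s ∈ Icc (0 : ℝ) 1 := ⟨hs, hst.trans ht⟩
    refine le_of_tendsto_of_tendsto' (((hF t ⟨hs.trans hst, ht⟩).sub (hF s hs')).sub
      ((hkτ s t hs hst).mul (hg s hs'))).abs (((hkτ s t hs hst).pow 2).const_mul C₂) fun n => ?_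
    obtain ⟨k, hk, hk1⟩ := hdiff n s t hs hst ht
    have := h₂ n (dyadicIndex n s) k hk1
    rw [← hk] at this
    have e : (dyadicIndex n t : ℝ) * (1 / 2 : ℝ) ^ n - (dyadicIndex n s : ℝ) * (1 / 2 : ℝ) ^ n =
        k * (1 / 2 : ℝ) ^ n := by
      rw [hk]
      push_cast
      ring
    rw [e]
    exact this
  intro t ht
  refine hasDerivWithinAt_of_abs_le_sq (C := C₂ + C₁ * G) fun s hs => ?_
  have hG0 : 0 ≤ G := by
    have := H.M_nonneg
    have := H.P_nonneg
    have := mass_nonneg μ₀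
    rw [← hG]; positivity
  rcases le_total t s with hst | hst
  · refine (htaylor t s ht.1 hst hs.2).trans ?_
    have : 0 ≤ C₁ * G * (s - t) ^ 2 := by positivity
    linarith
  -- For the left derivative the base point is the later time, so the right-hand side at `s` is
  -- exchanged for that at `t`, which costs another `C₁ G (t - s)²`.
  · have i1 := htaylor s t hs.1 hst ht.2
    have i2 := hrhs s t hs.1 hst ht.2
    have i3 := mul_le_mul_of_nonneg_left i2 (sub_nonneg.2 hst)
    have i4 : |(t - s) * (rhs v h φ (μ t) - rhs v h φ (μ s))| ≤
        (t - s) * (C₁ * G * (t - s)) := by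
      rw [abs_mul, abs_of_nonneg (sub_nonneg.2 hst)]; exact i3
    rw [abs_le] at i1 i4 ⊢
    constructor <;> nlinarith

end Existence

/-! ### Test functions under one backward step -/

section Flow

variable {E : Type*} [NormedAddCommGroup E] [NormedSpace ℝ E] [FiniteDimensional ℝ E]
  {B Λ A L M c ε τ : ℝ} {ψ : E → ℝ} {w W : E → E}

lemma IsSmoothApprox.lip (h : IsSmoothApprox c L M ε w W) (x y : E) :
    ‖W x - W y‖ ≤ L * ‖x - y‖ :=
  lip_of_norm_fderiv_le (h.contDiff.differentiable (by simp)) h.fderiv_bound x y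

lemma IsSmoothApprox.bound_nonneg (h : IsSmoothApprox c L M ε w W) : 0 ≤ M :=
  (norm_nonneg _).trans (h.bound 0)

lemma IsSmoothApprox.lip_nonneg (h : IsSmoothApprox c L M ε w W) : 0 ≤ L :=
  (norm_nonneg _).trans (h.fderiv_bound 0)

lemma IsTest.comp_flow (hψ : IsTest ψ) (h : IsSmoothApprox c L M ε w W) (hτ : 0 ≤ τ) :
    IsTest (fun x => ψ (x + τ • W x)) := by
  have hW := h.contDiff
  refine ⟨hψ.1.comp (contDiff_id.add (contDiff_const.smul hW)), ?_⟩
  obtain ⟨r, hr⟩ := hψ.2.isCompact.isBounded.subset_ball 0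
  refine hasCompactSupport_of_norm (r := r + τ * M) fun x hx => ?_
  by_contra hne
  have h1 := mem_ball_zero_iff.1 (hr (subset_tsupport _ hne))
  have h2 : ‖τ • W x‖ ≤ τ * M := by
    rw [norm_smul, Real.norm_of_nonneg hτ]
    exact mul_le_mul_of_nonneg_left (h.bound x) hτ
  have h3 := norm_sub_le (x + τ • W x) (τ • W x)
  rw [add_sub_cancel_right] at h3
  linarith

lemma IsSmoothApprox.hasFDerivAt_comp (h : IsSmoothApprox c L M ε w W) (hψ : IsTest ψ) (τ : ℝ)
    (x : E) : HasFDerivAt (fun x => ψ (x + τ • W x))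
      ((fderiv ℝ ψ (x + τ • W x)).comp (ContinuousLinearMap.id ℝ E + τ • fderiv ℝ W x)) x := by
  have hW : DifferentiableAt ℝ W x := h.contDiff.differentiable (by simp) x
  have hT : HasFDerivAt (fun x => x + τ • W x) (ContinuousLinearMap.id ℝ E + τ • fderiv ℝ W x) x :=
    (hasFDerivAt_id x).add (hW.hasFDerivAt.const_smul τ)
  exact (hψ.differentiable _).hasFDerivAt.comp x hT

lemma IsSmoothApprox.norm_id_add_smul_fderiv_le (h : IsSmoothApprox c L M ε w W) (hτ : 0 ≤ τ)
    (x : E) : ‖ContinuousLinearMap.id ℝ E + τ • fderiv ℝ W x‖ ≤ 1 + τ * L := by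
  refine (norm_add_le _ _).trans (add_le_add ContinuousLinearMap.norm_id_le ?_)
  rw [norm_smul, Real.norm_of_nonneg hτ]
  exact mul_le_mul_of_nonneg_left (h.fderiv_bound x) hτ

/-- By the chain rule the gradient is multiplied by a factor of norm at most `1 + τ L`. Its
variation picks up two such factors, and a term from the derivative of `W`, whose Lipschitz constant
is only controlled by `c L / ε`. -/
lemma C11Bound.comp_flow (hb : C11Bound B Λ A ψ) (hψ : IsTest ψ) (hA : 0 ≤ A) (hΛ : 0 ≤ Λ)
    (h : IsSmoothApprox c L M ε w W) (hτ : 0 ≤ τ) :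
    C11Bound B ((1 + τ * L) * Λ) ((1 + τ * L) ^ 2 * A + τ * (c * L / ε) * Λ)
      (fun x => ψ (x + τ • W x)) := by
  have hL := h.lip_nonneg
  refine ⟨fun x => hb.bound _, fun x => ?_, fun x y => ?_⟩
  · rw [(h.hasFDerivAt_comp hψ τ x).fderiv, mul_comm]
    exact (ContinuousLinearMap.opNorm_comp_le _ _).trans (mul_le_mul (hb.fderiv_bound _)
      (h.norm_id_add_smul_fderiv_le hτ x) (norm_nonneg _) hΛ)
  · rw [(h.hasFDerivAt_comp hψ τ x).fderiv, (h.hasFDerivAt_comp hψ τ y).fderiv]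
    set T : E → E := fun x => x + τ • W x
    set T' : E → E →L[ℝ] E := fun x => ContinuousLinearMap.id ℝ E + τ • fderiv ℝ W x
    have e : (fderiv ℝ ψ (T x)).comp (T' x) - (fderiv ℝ ψ (T y)).comp (T' y) =
        (fderiv ℝ ψ (T x) - fderiv ℝ ψ (T y)).comp (T' x) +
          (fderiv ℝ ψ (T y)).comp (T' x - T' y) := by
      rw [ContinuousLinearMap.sub_comp, ContinuousLinearMap.comp_sub]; abel
    change ‖(fderiv ℝ ψ (T x)).comp (T' x) - (fderiv ℝ ψ (T y)).comp (T' y)‖ ≤ _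
    rw [e]
    have i1 : ‖(fderiv ℝ ψ (T x) - fderiv ℝ ψ (T y)).comp (T' x)‖ ≤
        A * ((1 + τ * L) * ‖x - y‖) * (1 + τ * L) :=
      (ContinuousLinearMap.opNorm_comp_le _ _).trans (mul_le_mul
        ((hb.fderiv_lip _ _).trans
          (mul_le_mul_of_nonneg_left (norm_add_smul_sub_le hτ h.lip x y) hA))
        (h.norm_id_add_smul_fderiv_le hτ x) (norm_nonneg _) (by positivity))
    have i2 : ‖(fderiv ℝ ψ (T y)).comp (T' x - T' y)‖ ≤ Λ * (τ * (c * L / ε * ‖x - y‖)) := by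
      refine (ContinuousLinearMap.opNorm_comp_le _ _).trans (mul_le_mul (hb.fderiv_bound _) ?_
        (norm_nonneg _) hΛ)
      have e2 : T' x - T' y = τ • (fderiv ℝ W x - fderiv ℝ W y) := by
        simp only [T']; rw [smul_sub]; abel
      rw [e2, norm_smul, Real.norm_of_nonneg hτ]
      exact mul_le_mul_of_nonneg_left (h.fderiv_lip x y) hτ
    refine (norm_add_le _ _).trans ((add_le_add i1 i2).trans (le_of_eq ?_))
    ring

/-- The Taylor remainder is quadratic in `τ` in sup norm, but with only one derivative of the
gradient available its Lipschitz constant is merely linear in `τ`. This suffices because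
`NearBoundedMass` weights the Lipschitz constant by a small factor. -/
lemma C11Bound.remainder_BL (hb : C11Bound B Λ A ψ) (hψ : IsTest ψ) (hA : 0 ≤ A) (hΛ : 0 ≤ Λ)
    (h : IsSmoothApprox c L M ε w W) (hτ : 0 ≤ τ) :
    BL (A * (τ * M) ^ 2) (2 * τ * (Λ * L + A * M))
      (fun x => ψ (x + τ • W x) - ψ x - τ * fderiv ℝ ψ x (W x)) := by
  have hM := h.bound_nonneg
  have hτW : ∀ x, ‖τ • W x‖ ≤ τ * M := fun x => by
    rw [norm_smul, Real.norm_of_nonneg hτ]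
    exact mul_le_mul_of_nonneg_left (h.bound x) hτ
  refine ⟨fun x => ?_, fun x y => ?_⟩
  · have := hb.taylor hA hψ x (τ • W x)
    rw [map_smul, smul_eq_mul] at this
    refine this.trans (mul_le_mul_of_nonneg_left ?_ hA)
    exact pow_le_pow_left₀ (norm_nonneg _) (hτW x) 2
  · have hd : ∀ x, HasFDerivAt (fun x => ψ (x + τ • W x) - ψ x)
        ((fderiv ℝ ψ (x + τ • W x)).comp (ContinuousLinearMap.id ℝ E + τ • fderiv ℝ W x) -
          fderiv ℝ ψ x) x := fun x =>
      (h.hasFDerivAt_comp hψ τ x).sub (hψ.differentiable x).hasFDerivAt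
    have i1 := lip_of_norm_fderiv_le (φ := fun x => ψ (x + τ • W x) - ψ x)
      (Λ := τ * (Λ * L + A * M)) (fun x => (hd x).differentiableAt) (fun x => by
        rw [(hd x).fderiv, ContinuousLinearMap.comp_add, ContinuousLinearMap.comp_id,
          ContinuousLinearMap.comp_smul, add_sub_right_comm]
        refine (norm_add_le _ _).trans ?_
        have j1 : ‖fderiv ℝ ψ (x + τ • W x) - fderiv ℝ ψ x‖ ≤ A * (τ * M) := by
          refine (hb.fderiv_lip _ _).trans (mul_le_mul_of_nonneg_left ?_ hA)
          rw [add_sub_cancel_left]; exact hτW x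
        have j2 : ‖τ • (fderiv ℝ ψ (x + τ • W x)).comp (fderiv ℝ W x)‖ ≤ τ * (Λ * L) := by
          rw [norm_smul, Real.norm_of_nonneg hτ]
          exact mul_le_mul_of_nonneg_left ((ContinuousLinearMap.opNorm_comp_le _ _).trans
            (mul_le_mul (hb.fderiv_bound _) (h.fderiv_bound x) (norm_nonneg _) hΛ)) hτ
        linarith) x y
    have i2 := mul_le_mul_of_nonneg_left ((hb.fderiv_apply_BL hΛ hA h.bound h.lip).lip x y) hτ
    rw [Real.norm_eq_abs] at i1
    rw [← abs_of_nonneg hτ, ← abs_mul, abs_of_nonneg hτ] at i2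
    rw [abs_le] at *
    constructor <;> linarith

end Flow

/-! ### A priori control of weak solutions over a short time -/

section Solutions

variable {E : Type*} [NormedAddCommGroup E] [NormedSpace ℝ E] [FiniteDimensional ℝ E]
  [MeasurableSpace E] [BorelSpace E]
  {a b K L M Q P : ℝ} {v : SignedMeasure E → E → E} {h : SignedMeasure E → SignedMeasure E}
  {σ : ℝ → SignedMeasure E}

/-- Weak solutions on `[0,1]`, without initial condition. -/
structure IsSol (a b : ℝ) (v : SignedMeasure E → E → E) (h : SignedMeasure E → SignedMeasure E)
    (σ : ℝ → SignedMeasure E) : Prop where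
  continuous : ∀ s ∈ Icc (0 : ℝ) 1,
    Tendsto (fun t => gwNorm a b (σ t - σ s)) (𝓝[Icc 0 1] s) (𝓝 0)
  weak : ∀ φ, IsTest φ → ∀ t ∈ Icc (0 : ℝ) 1,
    HasDerivWithinAt (fun s => pairing (σ s) φ) (rhs v h φ (σ t)) (Icc 0 1) t

lemma IsSol.exists_modulus (S : IsSol a b v h σ) (ha : 0 < a) (hb : 0 < b) {θ : ℝ} (hθ : 0 < θ) :
    ∃ τ₀ > 0, ∀ r ∈ Icc (0 : ℝ) 1, ∀ s ∈ Icc (0 : ℝ) 1, |r - s| < τ₀ →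
      gwNorm a b (σ r - σ s) < θ := by
  let _ := gwPseudoMetric (E := E) ha hb
  have hc : ContinuousOn σ (Icc 0 1) := fun s hs => by
    rw [ContinuousWithinAt, tendsto_iff_dist_tendsto_zero]
    exact S.continuous s hs
  have hu := isCompact_Icc.uniformContinuousOn_of_continuous hc
  rw [Metric.uniformContinuousOn_iff] at hu
  obtain ⟨τ₀, h0, h1⟩ := hu θ hθ
  exact ⟨τ₀, h0, fun r hr s hs hrs => h1 r hr s hs hrs⟩

/-- `σ s` is uniformly close to measures of mass at most `m`, tested against bounded Lipschitz
functions. -/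
def NearBoundedMass (σ : ℝ → SignedMeasure E) (η m : ℝ) (T : Set ℝ) : Prop :=
  ∀ s ∈ T, ∀ B Λ f, 0 ≤ Λ → BL B Λ f → |pairing (σ s) f| ≤ η * (B + Λ) + m * B

/-- Near each time `x` the solution is close in norm to the fixed finite measure `σ x`, and
compactness of `[0,1]` leaves finitely many such measures. This stands in for a uniform mass bound,
which is proved only later and by means of this property. -/
lemma IsSol.exists_nearBoundedMass (S : IsSol a b v h σ) (ha : 0 < a) (hb : 0 < b) {η : ℝ}
    (hη : 0 < η) : ∃ m, 0 ≤ m ∧ NearBoundedMass σ η m (Icc 0 1) := by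
  refine isCompact_Icc.induction_on (p := fun T => ∃ m, 0 ≤ m ∧ NearBoundedMass σ η m T)
    ⟨0, le_rfl, fun s hs => absurd hs (notMem_empty s)⟩
    (fun s t hst ⟨m, hm, ht⟩ => ⟨m, hm, fun x hx => ht x (hst hx)⟩)
    (fun s t ⟨m, hm, hs⟩ ⟨m', hm', ht⟩ => ⟨max m m', le_max_of_le_left hm, ?_⟩) fun x hx => ?_
  · intro r hr B Λ f hΛ hf
    have hB := hf.bound_nonneg
    rcases hr with hr | hr
    · exact (hs r hr B Λ f hΛ hf).trans (by gcongr; exact le_max_left _ _)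
    · exact (ht r hr B Λ f hΛ hf).trans (by gcongr; exact le_max_right _ _)
  -- With this radius, the factor `B / a + Λ / b` from duality produces at most `η (B + Λ)`.
  · have hη' : 0 < η * min a b := mul_pos hη (lt_min ha hb)
    refine ⟨{t | gwNorm a b (σ t - σ x) < η * min a b},
      (S.continuous x hx).eventually (gt_mem_nhds hη'), mass (σ x), mass_nonneg _, ?_⟩
    intro s hs B Λ f hΛ hf
    have hs' : gwNorm a b (σ s - σ x) < η * min a b := hs
    have hB := hf.bound_nonneg
    have e := pairing_sub_measure (σ s) (σ x) hf.isBC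
    have i1 := abs_pairing_le_of_BL ha hb (σ s - σ x) hΛ hf
    have i2 := abs_pairing_le (σ x) hf.bound
    have i3 : (B / a + Λ / b) * gwNorm a b (σ s - σ x) ≤ η * (B + Λ) := by
      have k1 : B / a * gwNorm a b (σ s - σ x) ≤ B / a * (η * a) :=
        mul_le_mul_of_nonneg_left (hs'.le.trans
          (mul_le_mul_of_nonneg_left (min_le_left _ _) hη.le)) (by positivity)
      have k2 : Λ / b * gwNorm a b (σ s - σ x) ≤ Λ / b * (η * b) :=
        mul_le_mul_of_nonneg_left (hs'.le.trans
          (mul_le_mul_of_nonneg_left (min_le_right _ _) hη.le)) (by positivity)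
      have k3 : B / a * (η * a) = η * B := by field_simp
      have k4 : Λ / b * (η * b) = η * Λ := by field_simp
      rw [add_mul]; linarith
    rw [abs_le] at *
    constructor <;> linarith

variable {B Λ A c ε τ s η m η' m' θ : ℝ} {ψ : E → ℝ} {w W : E → E}

/-- The velocity difference is small in sup norm, by `K θ`, but its Lipschitz constant is only
bounded by `2 L`. Hence the last term carries `η` instead of `θ`: it is made small by the choice of
`η`, not by shortening the time. -/
lemma IsSol.abs_rhs_sub_le (H : Coeff a b v h K L M Q P)
    (hN : NearBoundedMass σ η m (Icc 0 1)) (hψ : IsTest ψ) (hA : 0 ≤ A)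
    (hΛ : 0 ≤ Λ) (hb : C11Bound B Λ A ψ) {r : ℝ} (hs : s ∈ Icc (0 : ℝ) 1)
    (hθ : gwNorm a b (σ r - σ s) ≤ θ) :
    |rhs v h ψ (σ r) - rhs v h ψ (σ s)| ≤
      (Λ * M / a + (Λ * L + A * M) / b + (B / a + Λ / b) * Q + (η + m) * Λ * K + η * A * K) * θ +
        η * (2 * L * Λ) := by
  have ha := H.a_pos
  have hb' := H.b_pos
  have hK := H.K_nonneg
  have hL := H.L_nonneg
  have hM := H.M_nonneg
  have hQ := H.Q_nonneg
  have hB := (hb.toBL hψ).bound_nonneg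
  have hθ0 : 0 ≤ θ := (gwNorm_nonneg _ _ _).trans hθ
  have f1 := hb.fderiv_apply_BL hΛ hA (H.v_bound (σ r)) (H.v_lip (σ r))
  have f2 := hb.fderiv_apply_BL hΛ hA (H.v_bound (σ s)) (H.v_lip (σ s))
  have f3 := hb.fderiv_apply_BL (w := fun x => v (σ r) x - v (σ s) x) (M := K * θ) (L := 2 * L)
    hΛ hA (fun x => (H.v_sub _ _ x).trans (by gcongr)) (fun x y => by
      have e : v (σ r) x - v (σ s) x - (v (σ r) y - v (σ s) y) =
          (v (σ r) x - v (σ r) y) - (v (σ s) x - v (σ s) y) := by abel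
      rw [e]
      refine (norm_sub_le _ _).trans ?_
      linarith [H.v_lip (σ r) x y, H.v_lip (σ s) x y])
  have e1 := pairing_sub_measure (σ r) (σ s) f1.isBC
  have e2 := pairing_sub (σ s) f1.isBC f2.isBC
  have e2' : (fun x => fderiv ℝ ψ x (v (σ r) x) - fderiv ℝ ψ x (v (σ s) x)) =
      fun x => fderiv ℝ ψ x (v (σ r) x - v (σ s) x) := by
    funext x; rw [map_sub]
  rw [e2'] at e2
  have e3 := pairing_sub_measure (h (σ r)) (h (σ s)) (hb.toBL hψ).isBC
  have i1 := (abs_pairing_le_of_BL ha hb' (σ r - σ s) (by positivity) f1).trans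
    (mul_le_mul_of_nonneg_left hθ (by positivity))
  have i2 := hN s hs _ _ _ (by positivity) f3
  have i3 := (abs_pairing_le_of_BL ha hb' (h (σ r) - h (σ s)) hΛ (hb.toBL hψ)).trans
    (mul_le_mul_of_nonneg_left ((H.h_sub _ _).trans (mul_le_mul_of_nonneg_left hθ hQ))
      (by positivity))
  have e : rhs v h ψ (σ r) - rhs v h ψ (σ s) =
      pairing (σ r - σ s) (fun x => fderiv ℝ ψ x (v (σ r) x)) +
      pairing (σ s) (fun x => fderiv ℝ ψ x (v (σ r) x - v (σ s) x)) +
      pairing (h (σ r) - h (σ s)) ψ := by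
    rw [e1, e2, e3, rhs, rhs]; ring
  rw [e]
  refine (abs_add_three _ _ _).trans ((add_le_add (add_le_add i1 i2) i3).trans (le_of_eq ?_))
  ring

/-- The error splits into the variation of the right-hand side over the time step, the Taylor
remainder of the step map, and the smoothing error `w - W`. The remainder is measured with a second
pair `η', m'`, because its Lipschitz constant involves `A`, which is of order `1/ε` and hence known
only after `η` has been fixed. -/
lemma IsSol.abs_pairing_step_sub_le (S : IsSol a b v h σ) (H : Coeff a b v h K L M Q P)
    (hN : NearBoundedMass σ η m (Icc 0 1))
    (hN' : NearBoundedMass σ η' m' (Icc 0 1)) (hε : 0 ≤ ε)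
    (hψ : IsTest ψ) (hA : 0 ≤ A) (hΛ : 0 ≤ Λ) (hb : C11Bound B Λ A ψ)
    (hw : ∀ x y, ‖w x - w y‖ ≤ L * ‖x - y‖) (hwM : ∀ x, ‖w x‖ ≤ M)
    (hW : IsSmoothApprox c L M ε w W) (hs : 0 ≤ s) (hτ : 0 ≤ τ) (hsτ : s + τ ≤ 1)
    (hθ : ∀ r ∈ Icc s (s + τ), gwNorm a b (σ r - σ s) ≤ θ) :
    |pairing (σ (s + τ)) ψ - pairing (σ s) (fun x => ψ (x + τ • W x)) -
      τ * (pairing (σ s) (fun x => fderiv ℝ ψ x (v (σ s) x - w x)) + pairing (h (σ s)) ψ)| ≤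
    τ * ((Λ * M / a + (Λ * L + A * M) / b + (B / a + Λ / b) * Q + (η + m) * Λ * K + η * A * K) * θ +
      η * (2 * L * Λ) + (η' * (A * τ * M ^ 2 + 2 * (Λ * L + A * M)) + m' * (A * τ * M ^ 2)) +
      (η * (Λ * (L * ε) + (2 * Λ * L + A * (L * ε))) + m * (Λ * (L * ε)))) := by
  have hL := H.L_nonneg
  have hM := H.M_nonneg
  have hsI : s ∈ Icc (0 : ℝ) 1 := ⟨hs, by linarith⟩
  have hsub : Icc s (s + τ) ⊆ Icc 0 1 := Icc_subset_Icc hs hsτ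
  set C := (Λ * M / a + (Λ * L + A * M) / b + (B / a + Λ / b) * Q + (η + m) * Λ * K +
    η * A * K) * θ + η * (2 * L * Λ) with hC
  have h1 : |pairing (σ (s + τ)) ψ - pairing (σ s) ψ - τ * rhs v h ψ (σ s)| ≤ C * τ := by
    have hd : ∀ r ∈ Icc s (s + τ), HasDerivWithinAt
        (fun r => pairing (σ r) ψ - r * rhs v h ψ (σ s))
        (rhs v h ψ (σ r) - rhs v h ψ (σ s)) (Icc s (s + τ)) r := fun r hr => by
      have := ((S.weak ψ hψ r (hsub hr)).mono hsub).sub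
        ((hasDerivWithinAt_id r (Icc s (s + τ))).mul_const (rhs v h ψ (σ s)))
      rw [one_mul] at this
      exact this
    have := (convex_Icc s (s + τ)).norm_image_sub_le_of_norm_hasDerivWithin_le (C := C) hd
      (fun r hr => IsSol.abs_rhs_sub_le H hN hψ hA hΛ hb hsI (hθ r hr))
      (left_mem_Icc.2 (by linarith)) (right_mem_Icc.2 (by linarith))
    rw [Real.norm_eq_abs, Real.norm_eq_abs, add_sub_cancel_left, abs_of_nonneg hτ] at this
    refine le_trans (le_of_eq ?_) this
    congr 1; ring
  have fr := hb.remainder_BL hψ hA hΛ hW hτ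
  have h2 := hN' s hsI _ _ _ (by positivity) fr
  have fd := hb.fderiv_apply_BL (w := fun x => w x - W x) (M := L * ε) (L := 2 * L) hΛ hA
    (fun x => by rw [norm_sub_rev]; exact hW.close x) (fun x y => by
      have e : w x - W x - (w y - W y) = (w x - w y) - (W x - W y) := by abel
      rw [e]
      refine (norm_sub_le _ _).trans ?_
      linarith [hw x y, hW.lip x y])
  have h3 := mul_le_mul_of_nonneg_left (hN s hsI _ _ _ (by positivity) fd) hτ
  rw [← abs_of_nonneg hτ, ← abs_mul, abs_of_nonneg hτ] at h3
  have fW := hb.fderiv_apply_BL hΛ hA hW.bound hW.lip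
  have fw := hb.fderiv_apply_BL hΛ hA hwM hw
  have fv := hb.fderiv_apply_BL hΛ hA (H.v_bound (σ s)) (H.v_lip (σ s))
  have fc := (hψ.comp_flow hW hτ).isBC
  have e1 := pairing_sub (σ s) (fc.sub hψ.isBC) (fW.isBC.const_mul τ)
  have e2 := pairing_sub (σ s) fc hψ.isBC
  have e3 := pairing_const_mul (σ s) τ (fun x => fderiv ℝ ψ x (W x))
  have e4 := pairing_sub (σ s) fw.isBC fW.isBC
  have e5 := pairing_sub (σ s) fv.isBC fw.isBC
  simp only [← map_sub] at e4 e5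
  have e : pairing (σ (s + τ)) ψ - pairing (σ s) (fun x => ψ (x + τ • W x)) -
      τ * (pairing (σ s) (fun x => fderiv ℝ ψ x (v (σ s) x - w x)) + pairing (h (σ s)) ψ) =
      (pairing (σ (s + τ)) ψ - pairing (σ s) ψ - τ * rhs v h ψ (σ s)) -
      pairing (σ s) (fun x => ψ (x + τ • W x) - ψ x - τ * fderiv ℝ ψ x (W x)) +
      τ * pairing (σ s) (fun x => fderiv ℝ ψ x (w x - W x)) := by
    rw [e1, e2, e3, e4, e5, rhs]; ring
  rw [e]
  refine (abs_add_le _ _).trans ((add_le_add ((abs_sub _ _).trans (add_le_add h1 h2)) h3).trans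
    (le_of_eq ?_))
  ring

end Solutions

/-! ### Propagation along the discrete backward flow -/

section Backward

variable {E : Type*} [NormedAddCommGroup E] [NormedSpace ℝ E] [FiniteDimensional ℝ E]

lemma C11Bound.mono {B Λ A B' Λ' A' : ℝ} {φ : E → ℝ} (h : C11Bound B Λ A φ) (hB : B ≤ B')
    (hΛ : Λ ≤ Λ') (hA : A ≤ A') : C11Bound B' Λ' A' φ :=
  ⟨fun x => (h.bound x).trans hB, fun x => (h.fderiv_bound x).trans hΛ, fun x y =>
    (h.fderiv_lip x y).trans (mul_le_mul_of_nonneg_right hA (norm_nonneg _))⟩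

lemma one_add_mul_exp_neg_le (L s τ : ℝ) :
    (1 + τ * L) * Real.exp (-(L * (s + τ))) ≤ Real.exp (-(L * s)) := by
  have h1 : 1 + τ * L ≤ Real.exp (τ * L) := by linarith [Real.add_one_le_exp (τ * L)]
  refine (mul_le_mul_of_nonneg_right h1 (Real.exp_pos _).le).trans (le_of_eq ?_)
  rw [← Real.exp_add]; congr 1; ring

/-- Propagation of bounds along the backward discrete flow: it suffices to control one step, up to
an arbitrarily small relative error. -/
lemma le_of_backward_steps {c L M : ℝ} (hc : 0 ≤ c) (hL : 0 ≤ L) {I : ℝ → (E → ℝ) → ℝ}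
    {G : ℝ → (E → ℝ) → Prop} {s₀ t r c₀ : ℝ} (hs₀ : 0 ≤ s₀) (hst : s₀ ≤ t) (ht : t ≤ 1)
    (hG : ∀ s τ ψ ε w W, s₀ ≤ s → 0 ≤ τ → s + τ ≤ t → G (s + τ) ψ → IsSmoothApprox c L M ε w W →
      G s (fun x => ψ (x + τ • W x)))
    (hstep : ∀ B Λ A κ δ, 0 ≤ B → 0 ≤ Λ → 0 ≤ A → 0 ≤ κ → 0 < δ →
      ∀ᶠ ε in 𝓝[>] (0 : ℝ), ∃ τ₀ > 0, ∀ s τ ψ, s₀ ≤ s → 0 ≤ τ → τ < τ₀ → s + τ ≤ t →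
        IsTest ψ → C11Bound B Λ (A + κ / ε) ψ → G (s + τ) ψ →
        ∃ w W, IsSmoothApprox c L M ε w W ∧
          I (s + τ) ψ ≤ I s (fun x => ψ (x + τ • W x)) + τ * (r + δ))
    (hinit : ∀ ψ, IsTest ψ → G s₀ ψ → I s₀ ψ ≤ c₀) {φ : E → ℝ} (hφ : IsTest φ) (hGφ : G t φ) :
    I t φ ≤ c₀ + (t - s₀) * r := by
  refine le_of_forall_pos_le_add fun δ hδ => ?_
  obtain ⟨B, Λ, A, hB, hΛ, hA, hb⟩ := hφ.exists_C11Bound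
  -- The weight `e` grows backward in time fast enough to absorb the factor `1 + τ L` of each step,
  -- so the invariant bounds below do not deteriorate with the number of steps.
  set e : ℝ → ℝ := fun s => Real.exp (-(L * s)) with he
  have he0 : ∀ s, 0 < e s := fun s => Real.exp_pos _
  have he1 : ∀ s, 0 ≤ s → e s ≤ 1 := fun s hs => Real.exp_le_one_iff.2 (by
    have := mul_nonneg hL hs
    linarith)
  have heL : ∀ s, s ≤ 1 → 1 ≤ Real.exp L * e s := fun s hs => by
    rw [he, ← Real.exp_add]
    refine Real.one_le_exp ?_
    nlinarith
  have heL2 : ∀ s, s ≤ 1 → 1 ≤ Real.exp L ^ 2 * e s ^ 2 := fun s hs => by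
    rw [← mul_pow]; exact one_le_pow₀ (heL s hs)
  set Λ' := Λ * Real.exp L with hΛ'
  set A' := A * Real.exp L ^ 2 with hA'
  -- The total growth of the second-order bound over unit time is `κ / ε`; the factor `exp L ^ 2`
  -- makes up for the weight `e s ^ 2`. Likewise `Λ'` and `A'` are enlarged so that the weighted
  -- bounds at time `t` still dominate `Λ` and `A`.
  set κ := c * L * Λ' * Real.exp L ^ 2 with hκ
  have hΛ'0 : 0 ≤ Λ' := by positivity
  have hA'0 : 0 ≤ A' := by positivity
  have hκ0 : 0 ≤ κ := by positivity
  -- The smoothing scale is fixed first and the time step only afterwards, since the admissible step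
  -- length depends on `κ / ε`.
  obtain ⟨ε, ⟨τ₀, hτ₀, hst'⟩, hε⟩ :=
    ((hstep B Λ' A' κ δ hB hΛ'0 hA'0 hκ0 hδ).and self_mem_nhdsWithin).exists
  have hε : 0 < ε := hε
  obtain ⟨n, hn⟩ := exists_nat_gt ((t - s₀) / τ₀)
  have hn0 : (0 : ℝ) < n := lt_of_le_of_lt (div_nonneg (sub_nonneg.2 hst) hτ₀.le) hn
  set τ := (t - s₀) / n with hτ
  have hτ0 : 0 ≤ τ := div_nonneg (sub_nonneg.2 hst) hn0.le
  have hττ₀ : τ < τ₀ := by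
    rw [hτ, div_lt_iff₀ hn0]
    rwa [div_lt_iff₀ hτ₀, mul_comm] at hn
  have hnτ : n * τ = t - s₀ := by rw [hτ]; field_simp
  -- Induction on the number of steps from `s₀`. The term `κ / ε * (1 - s)` grows by `κ τ / ε` with
  -- each step backward, which pays for the contribution of the derivative of `W`.
  have key : ∀ k : ℕ, k ≤ n → ∀ ψ, IsTest ψ → C11Bound B (Λ' * e (s₀ + k * τ))
      ((A' + κ / ε * (1 - (s₀ + k * τ))) * e (s₀ + k * τ) ^ 2) ψ → G (s₀ + k * τ) ψ →
      I (s₀ + k * τ) ψ ≤ c₀ + k * τ * (r + δ) := by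
    intro k
    induction k with
    | zero =>
      intro _ ψ hψ _ hGψ
      simp only [Nat.cast_zero, zero_mul, add_zero] at hGψ ⊢
      exact hinit ψ hψ hGψ
    | succ k ih =>
      intro hk ψ hψ hbψ hGψ
      set s := s₀ + k * τ with hs
      have es : s₀ + ((k + 1 : ℕ) : ℝ) * τ = s + τ := by rw [hs]; push_cast; ring
      rw [es] at hbψ hGψ ⊢
      have hkτ : 0 ≤ (k : ℝ) * τ := by positivity
      have hs0 : s₀ ≤ s := by linarith
      have hk1 : ((k + 1 : ℕ) : ℝ) * τ ≤ n * τ :=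
        mul_le_mul_of_nonneg_right (Nat.cast_le.2 hk) hτ0
      have hsτ : s + τ ≤ t := by linarith
      have hs' : 0 ≤ 1 - (s + τ) := by linarith
      have hAk : 0 ≤ (A' + κ / ε * (1 - (s + τ))) * e (s + τ) ^ 2 := by positivity
      have hΛk : 0 ≤ Λ' * e (s + τ) := mul_nonneg hΛ'0 (he0 _).le
      have hbψ' : C11Bound B Λ' (A' + κ / ε) ψ := by
        refine hbψ.mono le_rfl (mul_le_of_le_one_right hΛ'0 (he1 _ (by linarith))) ?_
        have i1 : e (s + τ) ^ 2 ≤ 1 := pow_le_one₀ (he0 _).le (he1 _ (by linarith))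
        refine (mul_le_of_le_one_right (by positivity) i1).trans ?_
        have i2 : κ / ε * (1 - (s + τ)) ≤ κ / ε :=
          mul_le_of_le_one_right (by positivity) (by linarith)
        linarith
      obtain ⟨w, W, hW, hI⟩ := hst' s τ ψ hs0 hτ0 hττ₀ hsτ hψ hbψ' hGψ
      have hq := one_add_mul_exp_neg_le L s τ
      have hq0 : 0 ≤ (1 + τ * L) * e (s + τ) := by have := he0 (s + τ); positivity
      have i3 := ih (by omega) _ (hψ.comp_flow hW hτ0)
        ((hbψ.comp_flow hψ hAk hΛk hW hτ0).mono le_rfl (by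
          rw [mul_left_comm]
          exact mul_le_mul_of_nonneg_left hq hΛ'0) (by
          have j1 : ((1 + τ * L) * e (s + τ)) ^ 2 ≤ e s ^ 2 := pow_le_pow_left₀ hq0 hq 2
          have j2 := mul_le_mul_of_nonneg_left j1
            (by positivity : 0 ≤ A' + κ / ε * (1 - (s + τ)))
          have j3 : τ * (c * L / ε) * (Λ' * e (s + τ)) ≤ κ / ε * τ * e s ^ 2 := by
            have k1 : e (s + τ) ≤ Real.exp L ^ 2 * e s ^ 2 :=
              (he1 _ (by linarith)).trans (heL2 s (by linarith))
            have k2 := mul_le_mul_of_nonneg_left k1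
              (by positivity : 0 ≤ τ * (c * L / ε) * Λ')
            refine le_trans (le_of_eq ?_) (k2.trans (le_of_eq ?_))
            · ring
            · rw [hκ]; ring
          refine le_trans (le_of_eq ?_) ((add_le_add j2 j3).trans (le_of_eq ?_)) <;> ring))
        (hG s τ ψ ε w W hs0 hτ0 hsτ hGψ hW)
      push_cast
      linarith
  have hsn : s₀ + n * τ = t := by linarith
  have := key n le_rfl φ hφ
  rw [hsn] at this
  have h1 := this (hb.mono le_rfl (by
      rw [hΛ', mul_assoc]; exact le_mul_of_one_le_right hΛ (heL t ht)) (by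
      have j1 : A ≤ A' * e t ^ 2 := by
        rw [hA', mul_assoc]; exact le_mul_of_one_le_right hA (heL2 t ht)
      refine j1.trans (mul_le_mul_of_nonneg_right ?_ (by positivity))
      have : 0 ≤ κ / ε * (1 - t) := mul_nonneg (by positivity) (by linarith)
      linarith)) hGφ
  rw [hnτ] at h1
  have h2 : (t - s₀) * δ ≤ δ := mul_le_of_le_one_left hδ.le (by linarith)
  linarith

variable [MeasurableSpace E] [BorelSpace E]
  {a b K L M Q P : ℝ} {v : SignedMeasure E → E → E} {h : SignedMeasure E → SignedMeasure E}
  {σ : ℝ → SignedMeasure E}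

lemma mul_div_add_one_le {x δ k : ℝ} (hx : 0 ≤ x) (hδ : 0 ≤ δ) (hk : 0 < k) :
    x * (δ / (k * (x + 1))) ≤ δ / k := by
  rw [mul_div_assoc', div_le_div_iff₀ (by positivity) hk]
  nlinarith [mul_nonneg hδ hk.le]

/-- Everything depends on the order of choices: first `η` and its `m`, then `ε`, then `η'` and `m'`,
finally `τ₀`. Each constant is chosen against quantities already fixed, and each error receives a
fixed share of `δ`. -/
lemma IsSol.eventually_abs_pairing_step_sub_le (S : IsSol a b v h σ)
    (H : Coeff a b v h K L M Q P) {B Λ A₀ κ δ : ℝ} (c : ℝ) (hB : 0 ≤ B) (hΛ : 0 ≤ Λ) (hA₀ : 0 ≤ A₀)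
    (hκ : 0 ≤ κ) (hδ : 0 < δ) :
    ∀ᶠ ε in 𝓝[>] (0 : ℝ), ∃ τ₀ > 0, ∀ s τ ψ w W, 0 ≤ s → 0 ≤ τ → τ < τ₀ → s + τ ≤ 1 →
      IsTest ψ → C11Bound B Λ (A₀ + κ / ε) ψ → (∀ x y, ‖w x - w y‖ ≤ L * ‖x - y‖) →
      (∀ x, ‖w x‖ ≤ M) → IsSmoothApprox c L M ε w W →
      |pairing (σ (s + τ)) ψ - pairing (σ s) (fun x => ψ (x + τ • W x)) -
        τ * (pairing (σ s) (fun x => fderiv ℝ ψ x (v (σ s) x - w x)) + pairing (h (σ s)) ψ)| ≤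
      τ * δ := by
  have ha := H.a_pos
  have hb := H.b_pos
  have hK := H.K_nonneg
  have hL := H.L_nonneg
  have hM := H.M_nonneg
  have hQ := H.Q_nonneg
  -- These are the Lipschitz constants weighted by `η`. The second-order bound enters only as `A *
  -- ε`, which is at most `A₀ + κ` for every `ε ≤ 1`; therefore `η` can be chosen before `ε`.
  set c₁ := 2 * L * Λ + Λ * L + 2 * Λ * L + L * (A₀ + κ) with hc₁
  have hc₁0 : 0 ≤ c₁ := by positivity
  set η := δ / (4 * (c₁ + 1)) with hη
  have hη0 : 0 < η := by positivity
  obtain ⟨m, hm, hN⟩ := S.exists_nearBoundedMass ha hb hη0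
  have hmΛL : 0 ≤ m * Λ * L := by positivity
  have hε₀ : 0 < min 1 (δ / (4 * (m * Λ * L + 1))) := lt_min one_pos (by positivity)
  filter_upwards [Ioo_mem_nhdsGT hε₀] with ε hε
  have hε0 : 0 < ε := hε.1
  have hε1 : ε ≤ 1 := hε.2.le.trans (min_le_left _ _)
  have hε2 : ε ≤ δ / (4 * (m * Λ * L + 1)) := hε.2.le.trans (min_le_right _ _)
  set A := A₀ + κ / ε with hA
  have hA0 : 0 ≤ A := by positivity
  have hAε : A * ε ≤ A₀ + κ := by
    rw [hA, add_mul, div_mul_cancel₀ _ hε0.ne']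
    linarith [mul_le_of_le_one_right hA₀ hε1]
  -- From here on `ε`, and with it `A`, is fixed, so the large constants `c₂`, `c₃`, `c₄` can be
  -- beaten by `η'`, by the time step and by the modulus of continuity.
  set c₂ := 2 * (Λ * L + A * M) with hc₂
  have hc₂0 : 0 ≤ c₂ := by positivity
  set η' := δ / (8 * (c₂ + 1)) with hη'
  have hη'0 : 0 < η' := by positivity
  obtain ⟨m', hm', hN'⟩ := S.exists_nearBoundedMass ha hb hη'0
  set c₃ := (η' + m') * (A * M ^ 2) with hc₃
  have hc₃0 : 0 ≤ c₃ := by positivity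
  set c₄ := Λ * M / a + (Λ * L + A * M) / b + (B / a + Λ / b) * Q + (η + m) * Λ * K + η * A * K
    with hc₄
  have hc₄0 : 0 ≤ c₄ := by positivity
  have hθ : 0 < δ / (4 * (c₄ + 1)) := by positivity
  obtain ⟨τ₁, hτ₁, hmod⟩ := S.exists_modulus ha hb hθ
  refine ⟨min τ₁ (δ / (8 * (c₃ + 1))), lt_min hτ₁ (by positivity), ?_⟩
  intro s τ ψ w W hs hτ hττ hsτ hψ hbψ hw hwM hW
  have hτ1 : τ < τ₁ := hττ.trans_le (min_le_left _ _)
  have hτ2 : τ ≤ δ / (8 * (c₃ + 1)) := hττ.le.trans (min_le_right _ _)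
  refine (S.abs_pairing_step_sub_le H hN hN' hε0.le hψ hA0 hΛ hbψ hw hwM hW hs hτ hsτ
    (θ := δ / (4 * (c₄ + 1))) fun r hr => ?_).trans (mul_le_mul_of_nonneg_left ?_ hτ)
  · refine (hmod r ⟨hs.trans hr.1, hr.2.trans hsτ⟩ s ⟨hs, by linarith⟩ ?_).le
    rw [abs_of_nonneg (sub_nonneg.2 hr.1)]
    linarith [hr.2]
  · have i1 : c₄ * (δ / (4 * (c₄ + 1))) ≤ δ / 4 := mul_div_add_one_le hc₄0 hδ.le (by norm_num)
    have i2 : c₂ * η' ≤ δ / 8 := mul_div_add_one_le hc₂0 hδ.le (by norm_num)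
    have i3 : c₃ * τ ≤ δ / 8 :=
      (mul_le_mul_of_nonneg_left hτ2 hc₃0).trans (mul_div_add_one_le hc₃0 hδ.le (by norm_num))
    have i4 : c₁ * η ≤ δ / 4 := mul_div_add_one_le hc₁0 hδ.le (by norm_num)
    have i5 : m * Λ * L * ε ≤ δ / 4 :=
      (mul_le_mul_of_nonneg_left hε2 hmΛL).trans (mul_div_add_one_le hmΛL hδ.le (by norm_num))
    have i6 : η * (2 * L * Λ + (Λ * (L * ε) + (2 * Λ * L + A * (L * ε)))) ≤ η * c₁ := by
      refine mul_le_mul_of_nonneg_left ?_ hη0.le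
      have j1 := mul_le_mul_of_nonneg_left hAε hL
      have j2 := mul_le_of_le_one_right (mul_nonneg hΛ hL) hε1
      rw [hc₁]; linarith
    have e : c₄ * (δ / (4 * (c₄ + 1))) + η * (2 * L * Λ) +
        (η' * (A * τ * M ^ 2 + 2 * (Λ * L + A * M)) + m' * (A * τ * M ^ 2)) +
        (η * (Λ * (L * ε) + (2 * Λ * L + A * (L * ε))) + m * (Λ * (L * ε))) =
        c₄ * (δ / (4 * (c₄ + 1))) + c₂ * η' + c₃ * τ +
        η * (2 * L * Λ + (Λ * (L * ε) + (2 * Λ * L + A * (L * ε)))) + m * Λ * L * ε := by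
      rw [hc₂, hc₃]; ring
    rw [e]
    linarith

end Backward

/-! ### Mass, support, time regularity and stability of solutions -/

section Estimates

variable {E : Type*} [NormedAddCommGroup E] [NormedSpace ℝ E] [FiniteDimensional ℝ E]
  [MeasurableSpace E] [BorelSpace E]
  {a b K L M Q P : ℝ} {v : SignedMeasure E → E → E} {h : SignedMeasure E → SignedMeasure E}
  {σ μ ν : ℝ → SignedMeasure E}

/-- One step of the backward flow along the solution's own velocity. -/
lemma IsSol.eventually_exists_step (S : IsSol a b v h σ) (H : Coeff a b v h K L M Q P) :
    ∃ c, 0 ≤ c ∧ ∀ B Λ A κ δ, 0 ≤ B → 0 ≤ Λ → 0 ≤ A → 0 ≤ κ → 0 < δ →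
      ∀ᶠ ε in 𝓝[>] (0 : ℝ), ∃ τ₀ > 0, ∀ s τ ψ, 0 ≤ s → 0 ≤ τ → τ < τ₀ → s + τ ≤ 1 →
        IsTest ψ → C11Bound B Λ (A + κ / ε) ψ →
        ∃ w W, IsSmoothApprox c L M ε w W ∧
          |pairing (σ (s + τ)) ψ - pairing (σ s) (fun x => ψ (x + τ • W x)) -
            τ * pairing (h (σ s)) ψ| ≤ τ * δ := by
  obtain ⟨c, hc, hc'⟩ := exists_isSmoothApprox E E
  refine ⟨c, hc, fun B Λ A κ δ hB hΛ hA hκ hδ => ?_⟩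
  filter_upwards [S.eventually_abs_pairing_step_sub_le H c hB hΛ hA hκ hδ, self_mem_nhdsWithin]
    with ε ⟨τ₀, hτ₀, hs⟩ hε
  refine ⟨τ₀, hτ₀, fun s τ ψ h0 hτ hττ h1 hψ hb => ?_⟩
  obtain ⟨W, hW⟩ := hc' (v (σ s)) L M ε hε H.L_nonneg (H.v_bound _) (H.v_lip _)
  refine ⟨_, W, hW, ?_⟩
  have := hs s τ ψ (v (σ s)) W h0 hτ hττ h1 hψ hb (H.v_lip _) (H.v_bound _) hW
  have e : pairing (σ s) (fun x => fderiv ℝ ψ x (v (σ s) x - v (σ s) x)) = 0 :=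
    pairing_eq_zero_of_supp _ fun x _ => by rw [sub_self, map_zero]
  rwa [e, zero_add] at this

/-- The backward step preserves `|ψ| ≤ 1`, and against such functions the source contributes at most
`P` per unit time. -/
theorem IsSol.mass_le (S : IsSol a b v h σ) (H : Coeff a b v h K L M Q P) {t : ℝ}
    (ht : t ∈ Icc (0 : ℝ) 1) : mass (σ t) ≤ mass (σ 0) + P * t := by
  obtain ⟨c, hc, hS⟩ := S.eventually_exists_step H
  refine mass_le_of_forall_test _ fun φ hφ h1 => ?_
  have := le_of_backward_steps (I := fun s ψ => pairing (σ s) ψ) (G := fun _ ψ => ∀ x, |ψ x| ≤ 1)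
    (r := P) (c₀ := mass (σ 0)) hc H.L_nonneg le_rfl ht.1 ht.2
    (fun s τ ψ ε w W _ _ _ hψ _ x => hψ _) (fun B Λ A κ δ hB hΛ hA hκ hδ => by
      filter_upwards [hS B Λ A κ δ hB hΛ hA hκ hδ] with ε ⟨τ₀, hτ₀, hs⟩
      refine ⟨τ₀, hτ₀, fun s τ ψ h0 hτ hττ hst hψ hb h1 => ?_⟩
      obtain ⟨w, W, hW, hle⟩ := hs s τ ψ h0 hτ hττ (hst.trans ht.2) hψ hb
      refine ⟨w, W, hW, ?_⟩
      have i1 := (le_abs_self _).trans (abs_pairing_le (h (σ s)) h1)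
      rw [one_mul] at i1
      have i2 := mul_le_mul_of_nonneg_left (i1.trans (H.h_mass (σ s))) hτ
      have i3 := (le_abs_self _).trans hle
      linarith)
    (fun ψ _ h1 => by
      have := (le_abs_self _).trans (abs_pairing_le (σ 0) h1)
      rwa [one_mul] at this) hφ h1
  linarith

/-- A backward step moves points by at most `τ M`, so vanishing on the ball of radius `R' + (s + τ)
M` becomes vanishing on the ball of radius `R' + s M`. All these balls contain the supports of the
sources, which therefore contribute nothing. -/
theorem IsSol.supp_subset (S : IsSol a b v h σ) (H : Coeff a b v h K L M Q P) {R' : ℝ}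
    (h0 : supp (σ 0) ⊆ Metric.closedBall 0 R') (hh : ∀ μ, supp (h μ) ⊆ Metric.closedBall 0 R')
    {t : ℝ} (ht : t ∈ Icc (0 : ℝ) 1) : supp (σ t) ⊆ Metric.closedBall 0 (R' + t * M) := by
  obtain ⟨c, hc, hS⟩ := S.eventually_exists_step H
  have hM := H.M_nonneg
  refine supp_subset_of_forall_test _ Metric.isClosed_closedBall fun φ hφ hz => ?_
  have := le_of_backward_steps (I := fun s ψ => |pairing (σ s) ψ|)
    (G := fun s ψ => ∀ x ∈ Metric.closedBall (0 : E) (R' + s * M), ψ x = 0)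
    (M := M) (r := 0) (c₀ := 0) hc H.L_nonneg le_rfl ht.1 ht.2
    (fun s τ ψ ε w W _ hτ _ hψ hW x hx => hψ _ (by
      rw [mem_closedBall_zero_iff] at hx ⊢
      refine (norm_add_le _ _).trans ?_
      rw [norm_smul, Real.norm_of_nonneg hτ]
      have := mul_le_mul_of_nonneg_left (hW.bound x) hτ
      linarith)) (fun B Λ A κ δ hB hΛ hA hκ hδ => by
      filter_upwards [hS B Λ A κ δ hB hΛ hA hκ hδ] with ε ⟨τ₀, hτ₀, hs⟩
      refine ⟨τ₀, hτ₀, fun s τ ψ h0 hτ hττ hst hψ hb h1 => ?_⟩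
      obtain ⟨w, W, hW, hle⟩ := hs s τ ψ h0 hτ hττ (hst.trans ht.2) hψ hb
      refine ⟨w, W, hW, ?_⟩
      have e : pairing (h (σ s)) ψ = 0 := pairing_eq_zero_of_supp _ fun x hx =>
        h1 x (Metric.closedBall_subset_closedBall
          (by have : 0 ≤ (s + τ) * M := by positivity
              linarith) (hh _ hx))
      rw [e, mul_zero, sub_zero] at hle
      have := (abs_sub_abs_le_abs_sub _ _).trans hle
      linarith)
    (fun ψ _ h1 => by
      rw [pairing_eq_zero_of_supp _ fun x hx => h1 x (by simpa using h0 hx), abs_zero]) hφ hz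
  rw [mul_zero, add_zero] at this
  exact abs_eq_zero.1 (le_antisymm this (abs_nonneg _))

/-- For an admissible test function the time derivative of the pairing is at most `a P + b M |σ r|`,
and the mass bound controls `|σ r|`; the mean value inequality concludes. -/
theorem IsSol.gwNorm_sub_le_mul (S : IsSol a b v h σ) (H : Coeff a b v h K L M Q P) {t τ : ℝ}
    (ht : 0 ≤ t) (hτ : 0 ≤ τ) (h1 : t + τ ≤ 1) :
    gwNorm a b (σ (t + τ) - σ t) ≤ (a * P + b * M * (P * (t + τ) + mass (σ 0))) * τ := by
  have ha := H.a_pos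
  have hb := H.b_pos
  have hM := H.M_nonneg
  have hsub : Icc t (t + τ) ⊆ Icc 0 1 := Icc_subset_Icc ht h1
  refine gwNorm_le_of_forall_test ha hb _ fun φ hφ hBL => ?_
  rw [pairing_sub_measure _ _ hBL.isBC]
  have := (convex_Icc t (t + τ)).norm_image_sub_le_of_norm_hasDerivWithin_le
    (f := fun s => pairing (σ s) φ) (C := a * P + b * M * (P * (t + τ) + mass (σ 0)))
    (fun r hr => (S.weak φ hφ r (hsub hr)).mono hsub)
    (fun r hr => by
      have hr' := hsub hr
      have i1 := abs_pairing_le (σ r) (f := fun x => fderiv ℝ φ x (v (σ r) x)) (C := b * M)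
        fun x => ((fderiv ℝ φ x).le_opNorm _).trans (mul_le_mul
          (norm_fderiv_le_of_lip' ℝ hb.le (Eventually.of_forall fun y => hBL.lip y x))
          (H.v_bound _ x) (norm_nonneg _) hb.le)
      have i2 := abs_pairing_le (h (σ r)) hBL.bound
      have i3 := mul_le_mul_of_nonneg_left (H.h_mass (σ r)) ha.le
      have i4 : mass (σ r) ≤ P * (t + τ) + mass (σ 0) := by
        have := S.mass_le H hr'
        have := mul_le_mul_of_nonneg_left hr.2 H.P_nonneg
        linarith
      have i5 := mul_le_mul_of_nonneg_left i4 (mul_nonneg hb.le hM)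
      rw [rhs, Real.norm_eq_abs]
      refine (abs_add_le _ _).trans ?_
      linarith)
    (left_mem_Icc.2 (by linarith)) (right_mem_Icc.2 (by linarith))
  rw [Real.norm_eq_abs, Real.norm_eq_abs, add_sub_cancel_left, abs_of_nonneg hτ] at this
  exact (le_abs_self _).trans this

/-- Test functions are carried backward for both solutions by the flow of `μ`, with sup bound `a`
and a Lipschitz constant growing like `b exp (L (t - s))`. The source term is controlled by `Q D`,
and the use of the wrong velocity by `b K D` times the mass of `ν`; an a priori bound `D` on the
distance turns these into constants. -/
lemma IsSol.gwNorm_sub_le_of_bound (Sμ : IsSol a b v h μ) (Sν : IsSol a b v h ν)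
    (H : Coeff a b v h K L M Q P) {s₀ t D : ℝ} (hs₀ : 0 ≤ s₀) (hst : s₀ ≤ t) (ht : t ≤ 1)
    (hD : ∀ s ∈ Icc s₀ t, gwNorm a b (μ s - ν s) ≤ D) :
    gwNorm a b (μ t - ν t) ≤ Real.exp (L * (t - s₀)) * gwNorm a b (μ s₀ - ν s₀) +
      (t - s₀) * (Real.exp (L * (t - s₀)) * (Q + b * K * (P + mass (ν 0))) * D) := by
  have : ProperSpace E := FiniteDimensional.proper ℝ E
  have ha := H.a_pos
  have hb := H.b_pos
  have hK := H.K_nonneg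
  have hL := H.L_nonneg
  have hQ := H.Q_nonneg
  have hP := H.P_nonneg
  have hm0 := mass_nonneg (ν 0)
  have hD0 : 0 ≤ D := (gwNorm_nonneg a b _).trans (hD s₀ (left_mem_Icc.2 hst))
  obtain ⟨c, hc, hc'⟩ := exists_isSmoothApprox E E
  have hexp : ∀ s ≤ t, 1 ≤ Real.exp (L * (t - s)) := fun s hs =>
    Real.one_le_exp (mul_nonneg hL (sub_nonneg.2 hs))
  refine gwNorm_le_of_forall_test ha hb _ fun φ hφ hBL => ?_
  refine le_of_backward_steps (I := fun s ψ => pairing (μ s - ν s) ψ)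
    (G := fun s ψ => BL a (b * Real.exp (L * (t - s))) ψ) hc hL (M := M)
    hs₀ hst ht ?_ ?_ ?_ hφ (by simpa using hBL)
  · intro s τ ψ ε w W _ hτ _ hψ hW
    refine (hψ.comp (by positivity) (norm_add_smul_sub_le hτ hW.lip)).mono le_rfl ?_
    rw [mul_assoc]
    refine mul_le_mul_of_nonneg_left ?_ hb.le
    have i1 := mul_le_mul_of_nonneg_left (one_add_mul_exp_neg_le L s τ) (Real.exp_pos (L * t)).le
    have e1 : Real.exp (L * t) * ((1 + τ * L) * Real.exp (-(L * (s + τ)))) =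
        Real.exp (L * (t - (s + τ))) * (1 + τ * L) := by
      rw [mul_left_comm, ← Real.exp_add, mul_comm]; congr 2; ring
    have e2 : Real.exp (L * t) * Real.exp (-(L * s)) = Real.exp (L * (t - s)) := by
      rw [← Real.exp_add]; congr 1; ring
    rwa [e1, e2] at i1
  · intro B Λ A κ δ hB hΛ hA hκ hδ
    filter_upwards [Sμ.eventually_abs_pairing_step_sub_le H c hB hΛ hA hκ (half_pos hδ),
      Sν.eventually_abs_pairing_step_sub_le H c hB hΛ hA hκ (half_pos hδ), self_mem_nhdsWithin]
      with ε ⟨τ₁, hτ₁, h₁⟩ ⟨τ₂, hτ₂, h₂⟩ hε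
    refine ⟨min τ₁ τ₂, lt_min hτ₁ hτ₂, fun s τ ψ hs hτ hττ hsτ hψ hbψ hGψ => ?_⟩
    -- The same smoothed velocity serves both solutions, so that the two composed pairings combine
    -- into a pairing with `μ s - ν s`. The velocity defect then appears only for `ν`.
    obtain ⟨W, hW⟩ := hc' (v (μ s)) L M ε hε hL (H.v_bound _) (H.v_lip _)
    refine ⟨_, W, hW, ?_⟩
    have hs0 : 0 ≤ s := hs₀.trans hs
    have j1 := h₁ s τ ψ (v (μ s)) W hs0 hτ (hττ.trans_le (min_le_left _ _)) (hsτ.trans ht) hψ hbψ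
      (H.v_lip _) (H.v_bound _) hW
    have j2 := h₂ s τ ψ (v (μ s)) W hs0 hτ (hττ.trans_le (min_le_right _ _)) (hsτ.trans ht) hψ hbψ
      (H.v_lip _) (H.v_bound _) hW
    have e : pairing (μ s) (fun x => fderiv ℝ ψ x (v (μ s) x - v (μ s) x)) = 0 :=
      pairing_eq_zero_of_supp _ fun x _ => by rw [sub_self, map_zero]
    rw [e, zero_add] at j1
    have hDs : gwNorm a b (μ s - ν s) ≤ D := hD s ⟨hs, by linarith⟩
    set q := Real.exp (L * (t - s₀)) with hq
    have hq1 : 1 ≤ q := hexp s₀ hst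
    have hGq : BL (q * a) (q * b) ψ := by
      refine hGψ.mono (le_mul_of_one_le_left ha.le hq1) ?_
      rw [mul_comm]
      refine mul_le_mul_of_nonneg_right (Real.exp_le_exp.2 (mul_le_mul_of_nonneg_left ?_ hL)) hb.le
      linarith
    have k1 : |pairing (h (μ s) - h (ν s)) ψ| ≤ q * (Q * D) :=
      (abs_pairing_le_gwNorm ha hb _ (by linarith) hGq).trans (mul_le_mul_of_nonneg_left
        ((H.h_sub _ _).trans (mul_le_mul_of_nonneg_left hDs hQ)) (by linarith))
    have hqb : 0 ≤ q * b := by positivity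
    have k2 : |pairing (ν s) (fun x => fderiv ℝ ψ x (v (ν s) x - v (μ s) x))| ≤
        q * b * (K * D) * (P + mass (ν 0)) := by
      refine (abs_pairing_le (ν s) (C := q * b * (K * D)) fun x =>
        ((fderiv ℝ ψ x).le_opNorm _).trans (mul_le_mul
          (norm_fderiv_le_of_lip' ℝ hqb (Eventually.of_forall fun y => hGq.lip y x))
          ((H.v_sub _ _ x).trans (mul_le_mul_of_nonneg_left ?_ hK)) (norm_nonneg _) hqb)).trans
        (mul_le_mul_of_nonneg_left ?_ (by positivity))
      · rw [gwNorm_sub_comm ha hb]; exact hDs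
      · have := Sν.mass_le H (t := s) ⟨hs0, by linarith⟩
        have := mul_le_of_le_one_right hP (by linarith : s ≤ 1)
        linarith
    have hfc := (hψ.comp_flow hW hτ).isBC
    rw [pairing_sub_measure _ _ hψ.isBC, pairing_sub_measure _ _ hfc]
    rw [pairing_sub_measure _ _ hψ.isBC] at k1
    have k3 := mul_le_mul_of_nonneg_left ((le_abs_self _).trans k1) hτ
    have k4 := mul_le_mul_of_nonneg_left ((neg_le_abs _).trans k2) hτ
    have k5 := (le_abs_self _).trans j1
    have k6 := (neg_le_abs _).trans j2
    linarith
  · intro ψ _ hψ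
    refine (le_abs_self _).trans (abs_pairing_le_gwNorm ha hb _ (Real.exp_pos _).le
      (hψ.mono (le_mul_of_one_le_left ha.le (hexp s₀ hst)) (le_of_eq (mul_comm _ _))))

lemma IsSol.continuousOn_gwNorm_sub (Sμ : IsSol a b v h μ) (Sν : IsSol a b v h ν) (ha : 0 < a)
    (hb : 0 < b) : ContinuousOn (fun t => gwNorm a b (μ t - ν t)) (Icc 0 1) := by
  let _ := gwPseudoMetric (E := E) ha hb
  have hc : ∀ {ρ : ℝ → SignedMeasure E}, IsSol a b v h ρ → ContinuousOn ρ (Icc 0 1) :=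
    fun S s hs => by
      rw [ContinuousWithinAt, tendsto_iff_dist_tendsto_zero]
      exact S.continuous s hs
  exact fun s hs => Filter.Tendsto.dist (hc Sμ s hs) (hc Sν s hs)

/-- The estimate over a short interval starting at `x`, with `D` slightly above the distance at `x`,
bounds the right Dini derivative of the distance by `(L + Γ)` times the distance. Gronwall's lemma
in its Dini form applies because the distance is continuous in time. -/
theorem IsSol.gwNorm_sub_le_exp (Sμ : IsSol a b v h μ) (Sν : IsSol a b v h ν)
    (H : Coeff a b v h K L M Q P) {t : ℝ} (ht : t ∈ Icc (0 : ℝ) 1) :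
    gwNorm a b (μ t - ν t) ≤ gwNorm a b (μ 0 - ν 0) *
      Real.exp ((L + (Q + b * K * (P + mass (ν 0)))) * t) := by
  set Γ := Q + b * K * (P + mass (ν 0)) with hΓ
  have hΓ0 : 0 ≤ Γ := by
    have := H.b_pos
    have := H.K_nonneg
    have := H.Q_nonneg
    have := H.P_nonneg
    have := mass_nonneg (ν 0)
    positivity
  set D := fun t => gwNorm a b (μ t - ν t) with hDdef
  have hcont : ContinuousOn D (Icc 0 1) := Sμ.continuousOn_gwNorm_sub Sν H.a_pos H.b_pos
  have key := le_gronwallBound_of_liminf_deriv_right_le (f := D) (f' := fun s => (L + Γ) * D s)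
    (δ := D 0) (K := L + Γ) (ε := 0) hcont (fun x hx r hr => ?_) le_rfl
    (fun x _ => (add_zero _).ge) t ht
  · rw [gronwallBound_ε0, sub_zero] at key
    exact key
  · have hx' : x ∈ Icc (0 : ℝ) 1 := ⟨hx.1, hx.2.le⟩
    refine Eventually.frequently ?_
    -- The slack `ζ` consumes at most half of the gap between `r` and `(L + Γ) D x`; the `+ 1` in
    -- the denominator avoids a separate case `Γ = 0`.
    obtain ⟨ζ, hζ, hζr⟩ : ∃ ζ > 0, L * D x + Γ * (D x + ζ) < r := by
      refine ⟨(r - (L + Γ) * D x) / (2 * (Γ + 1)), by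
        have := sub_pos.2 hr
        positivity, ?_⟩
      have h1 := sub_pos.2 hr
      have h2 : Γ * ((r - (L + Γ) * D x) / (2 * (Γ + 1))) ≤ (r - (L + Γ) * D x) / 2 :=
        mul_div_add_one_le hΓ0 h1.le two_pos
      linarith
    have hnear : ∀ᶠ z in 𝓝[Icc 0 1] x, D z < D x + ζ :=
      (hcont x hx').eventually (gt_mem_nhds (by linarith))
    obtain ⟨z₁, hz₁, hz₁'⟩ : ∃ z₁ > x, ∀ s ∈ Ico x z₁, s ≤ 1 → D s < D x + ζ := by
      rw [Metric.nhdsWithin_basis_ball.eventually_iff] at hnear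
      obtain ⟨ρ, hρ, hρ'⟩ := hnear
      refine ⟨x + ρ, by linarith, fun s hs hs1 => hρ' ⟨?_, hx.1.trans hs.1, hs1⟩⟩
      rw [Metric.mem_ball, Real.dist_eq, abs_of_nonneg (sub_nonneg.2 hs.1)]
      linarith [hs.2]
    have hlim : Tendsto (fun z => slope (fun z => Real.exp (L * (z - x))) x z * D x +
        Real.exp (L * (z - x)) * Γ * (D x + ζ)) (𝓝[>] x) (𝓝 (L * D x + Γ * (D x + ζ))) := by
      have hd : HasDerivAt (fun z => Real.exp (L * (z - x))) L x := by
        have := (((hasDerivAt_id x).sub_const x).const_mul L).exp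
        simpa using this
      have h1 := (hasDerivAt_iff_tendsto_slope.1 hd).mono_left
        (nhdsWithin_mono x fun z (hz : x < z) => hz.ne')
      have h2 : Tendsto (fun z => Real.exp (L * (z - x))) (𝓝[>] x) (𝓝 1) := by
        have := hd.continuousAt.tendsto.mono_left (nhdsWithin_le_nhds (s := Ioi x))
        simpa using this
      have := (h1.mul_const (D x)).add ((h2.mul_const Γ).mul_const (D x + ζ))
      rwa [one_mul] at this
    filter_upwards [hlim.eventually (gt_mem_nhds hζr), Ioo_mem_nhdsGT hz₁, Ioo_mem_nhdsGT hx.2]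
      with z hz hzz hz1
    refine lt_of_le_of_lt ?_ hz
    have hzx : 0 < z - x := sub_pos.2 hzz.1
    have i1 := Sμ.gwNorm_sub_le_of_bound Sν H (D := D x + ζ) hx.1 hzz.1.le hz1.2.le
      fun s hs => (hz₁' s ⟨hs.1, hs.2.trans_lt hzz.2⟩ (hs.2.trans hz1.2.le)).le
    rw [slope_def_field, sub_self, mul_zero, Real.exp_zero, inv_mul_le_iff₀ hzx]
    have e : (z - x) * ((Real.exp (L * (z - x)) - 1) / (z - x) * D x +
        Real.exp (L * (z - x)) * Γ * (D x + ζ)) = (Real.exp (L * (z - x)) - 1) * D x +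
        (z - x) * (Real.exp (L * (z - x)) * Γ * (D x + ζ)) := by
      field_simp
    rw [e]
    linarith

/-- The one-sided estimate involves the initial mass of one solution only, so exchanging the roles
of the two solutions gives the minimum. The constants here are larger than those of the one-sided
estimate. -/
theorem IsSol.gwNorm_sub_le_exp_min (Sμ : IsSol a b v h μ) (Sν : IsSol a b v h ν)
    (H : Coeff a b v h K L M Q P) {t : ℝ} (ht : t ∈ Icc (0 : ℝ) 1) :
    gwNorm a b (μ t - ν t) ≤ gwNorm a b (μ 0 - ν 0) *
      Real.exp ((2 * L + 2 * b * K * (P + min (mass (μ 0)) (mass (ν 0))) + Q) * t) := by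
  have ha := H.a_pos
  have hb := H.b_pos
  have aux : ∀ m, 0 ≤ m → Real.exp ((L + (Q + b * K * (P + m))) * t) ≤
      Real.exp ((2 * L + 2 * b * K * (P + m) + Q) * t) := fun m hm => by
    refine Real.exp_le_exp.2 (mul_le_mul_of_nonneg_right ?_ ht.1)
    have h1 := H.L_nonneg
    have h2 : 0 ≤ b * K * (P + m) :=
      mul_nonneg (mul_nonneg hb.le H.K_nonneg) (add_nonneg H.P_nonneg hm)
    linarith
  rcases le_total (mass (μ 0)) (mass (ν 0)) with hle | hle
  · rw [min_eq_left hle, gwNorm_sub_comm ha hb (μ t), gwNorm_sub_comm ha hb (μ 0)]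
    exact (Sν.gwNorm_sub_le_exp Sμ H ht).trans
      (mul_le_mul_of_nonneg_left (aux _ (mass_nonneg _)) (gwNorm_nonneg _ _ _))
  · rw [min_eq_right hle]
    exact (Sμ.gwNorm_sub_le_exp Sν H ht).trans
      (mul_le_mul_of_nonneg_left (aux _ (mass_nonneg _)) (gwNorm_nonneg _ _ _))

end Estimates

/-! ### From the hypotheses of the theorem to the abstract setting -/

section Main

variable {d : ℕ} {a b K L M Q P R : ℝ}
  {v : Ms d → EuclideanSpace ℝ (Fin d) → EuclideanSpace ℝ (Fin d)} {h : Ms d → Ms d}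

lemma exists_gwNorm_pos {E : Type*} [NormedAddCommGroup E] [NormedSpace ℝ E]
    [FiniteDimensional ℝ E] [MeasurableSpace E] [BorelSpace E] (ha : 0 < a) (hb : 0 < b) :
    ∃ μ : SignedMeasure E, 0 < gwNorm a b μ := by
  refine ⟨(Measure.dirac 0).toSignedMeasure, lt_of_not_ge fun hle => ?_⟩
  have h0 := eq_zero_of_gwNorm_eq_zero ha hb hle
  have h1 := congrArg (fun μ : SignedMeasure E => μ univ) h0
  simp [Measure.toSignedMeasure_apply_measurable MeasurableSet.univ] at h1

/-- The signs of `K` and `Q` are forced by the inequalities themselves once some measure has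
positive norm, for instance a Dirac mass; those of `M` and `P` follow since they bound nonnegative
quantities. -/
lemma Coeff.of_hypotheses (ha : 0 < a) (hb : 0 < b) (hv1 : H1 a b v K) (hv2 : H2 v L M)
    (hh : H3 a b h Q P R) : Coeff a b v h K L M Q P := by
  obtain ⟨μ, hμ⟩ := exists_gwNorm_pos (E := EuclideanSpace ℝ (Fin d)) ha hb
  rw [← sub_zero μ] at hμ
  exact
    { a_pos := ha
      b_pos := hb
      K_nonneg := nonneg_of_mul_nonneg_left ((norm_nonneg _).trans (hv1 μ 0 0)) hμ
      L_nonneg := hv2.1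
      M_nonneg := (norm_nonneg _).trans ((hv2.2 0).2 0)
      Q_nonneg := nonneg_of_mul_nonneg_left ((gwNorm_nonneg a b _).trans (hh.1 μ 0)) hμ
      P_nonneg := (mass_nonneg _).trans (hh.2 0).1
      v_sub := hv1
      v_lip := fun μ => (hv2.2 μ).1
      v_bound := fun μ => (hv2.2 μ).2
      h_sub := hh.1
      h_mass := fun μ => (hh.2 μ).1 }

lemma IsWeakSolution.isSol {μ₀ : Ms d} {μ : ℝ → Ms d} (S : IsWeakSolution a b v h μ₀ μ) :
    IsSol a b v h μ :=
  ⟨S.continuous, fun φ hφ => S.weak φ hφ.1 hφ.2⟩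

lemma Coeff.exists_isWeakSolution (H : Coeff a b v h K L M Q P) (μ₀ : Ms d) :
    ∃ μ, IsWeakSolution a b v h μ₀ μ := by
  obtain ⟨μ, h0, ⟨C, hC⟩, hw⟩ := H.exists_solution μ₀
  refine ⟨μ, fun s hs => ?_, h0, fun φ h1 h2 => hw φ ⟨h1, h2⟩⟩
  have hlim : Tendsto (fun t => C * |t - s|) (𝓝[Icc 0 1] s) (𝓝 0) := by
    have : Continuous fun t : ℝ => C * |t - s| := by fun_prop
    have := (this.tendsto s).mono_left (nhdsWithin_le_nhds (s := Icc 0 1))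
    simpa using this
  refine squeeze_zero' (Eventually.of_forall fun t => gwNorm_nonneg _ _ _) ?_ hlim
  filter_upwards [self_mem_nhdsWithin] with t ht
  exact hC s hs t ht

end Main

end SignedTransport

end

theorem theorem1 (d : ℕ) (a b : ℝ) (ha : 0 < a) (hb : 0 < b)
    (v : SignedTransport.Ms d → EuclideanSpace ℝ (Fin d) → EuclideanSpace ℝ (Fin d))
    (h : SignedTransport.Ms d → SignedTransport.Ms d)
    (K L M Q P R : ℝ)
    (hv1 : SignedTransport.H1 a b v K)
    (hv2 : SignedTransport.H2 v L M)
    (hh : SignedTransport.H3 a b h Q P R) :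
    -- existence and uniqueness on `[0,1]`
    (∀ μ₀ : SignedTransport.Ms d, IsCompact (SignedTransport.supp μ₀) →
      ∃ μ : ℝ → SignedTransport.Ms d, SignedTransport.IsWeakSolution a b v h μ₀ μ ∧
        ∀ ν : ℝ → SignedTransport.Ms d, SignedTransport.IsWeakSolution a b v h μ₀ ν →
          Set.EqOn ν μ (Set.Icc 0 1)) ∧
    -- continuous dependence on the initial datum
    (∀ (μ₀ ν₀ : SignedTransport.Ms d) (μ ν : ℝ → SignedTransport.Ms d),
      SignedTransport.IsWeakSolution a b v h μ₀ μ →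
      SignedTransport.IsWeakSolution a b v h ν₀ ν →
      ∀ t ∈ Set.Icc (0 : ℝ) 1,
        SignedTransport.gwNorm a b (μ t - ν t) ≤
          SignedTransport.gwNorm a b (μ₀ - ν₀) *
            Real.exp ((2 * L + 2 * b * K *
              (P + min (SignedTransport.mass μ₀) (SignedTransport.mass ν₀)) + Q) * t)) ∧
    -- mass, support and time regularity of the solution
    (∀ μ₀ : SignedTransport.Ms d, IsCompact (SignedTransport.supp μ₀) →
      ∀ μ : ℝ → SignedTransport.Ms d, SignedTransport.IsWeakSolution a b v h μ₀ μ →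
        (∀ t ∈ Set.Icc (0 : ℝ) 1,
          SignedTransport.mass (μ t) ≤ SignedTransport.mass μ₀ + P * t) ∧
        (∀ R' : ℝ,
          SignedTransport.supp μ₀ ∪ Metric.closedBall 0 R ⊆ Metric.closedBall 0 R' →
          ∀ t ∈ Set.Icc (0 : ℝ) 1,
            SignedTransport.supp (μ t) ⊆ Metric.closedBall 0 (R' + t * M)) ∧
        (∀ t τ : ℝ, 0 ≤ t → 0 ≤ τ → t + τ ≤ 1 →
          SignedTransport.gwNorm a b (μ (t + τ) - μ t) ≤
            (a * P + b * M * (P * (t + τ) + SignedTransport.mass μ₀)) * τ)) := by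
  have H := SignedTransport.Coeff.of_hypotheses ha hb hv1 hv2 hh
  have stab : ∀ (μ₀ ν₀ : SignedTransport.Ms d) (μ ν : ℝ → SignedTransport.Ms d),
      SignedTransport.IsWeakSolution a b v h μ₀ μ →
      SignedTransport.IsWeakSolution a b v h ν₀ ν →
      ∀ t ∈ Set.Icc (0 : ℝ) 1,
        SignedTransport.gwNorm a b (μ t - ν t) ≤
          SignedTransport.gwNorm a b (μ₀ - ν₀) *
            Real.exp ((2 * L + 2 * b * K *
              (P + min (SignedTransport.mass μ₀) (SignedTransport.mass ν₀)) + Q) * t) := by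
    intro μ₀ ν₀ μ ν hμ hν t ht
    have := hμ.isSol.gwNorm_sub_le_exp_min hν.isSol H ht
    rwa [hμ.initial, hν.initial] at this
  refine ⟨fun μ₀ _ => ?_, stab, fun μ₀ _ μ hμ => ⟨fun t ht => ?_, fun R' hR' t ht => ?_,
    fun t τ ht hτ h1 => ?_⟩⟩
  · obtain ⟨μ, hμ⟩ := H.exists_isWeakSolution μ₀
    refine ⟨μ, hμ, fun ν hν t ht => ?_⟩
    have := stab μ₀ μ₀ ν μ hν hμ t ht
    rw [sub_self, SignedTransport.gwNorm_zero ha hb, zero_mul] at this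
    exact sub_eq_zero.1 (SignedTransport.eq_zero_of_gwNorm_eq_zero ha hb this)
  · rw [← hμ.initial]
    exact hμ.isSol.mass_le H ht
  · rw [Set.union_subset_iff] at hR'
    refine hμ.isSol.supp_subset H ?_ (fun ρ => (hh.2 ρ).2.trans hR'.2) ht
    rw [hμ.initial]
    exact hR'.1
  · rw [← hμ.initial]
    exact hμ.isSol.gwNorm_sub_le_mul H ht hτ h1
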